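/- Let $n\ge 1$ and $1<p\le 2$. For $f\in L^p(\mathbb{R}^n)$ let $\widehat f$ denote its Fourier transform (with $\widehat f(\xi)=\int f(x)e^{-2\pi i x\cdot\xi}\,dx$ for $f\in L^1$, the Plancherel extension for $f\in L^2$, and hence a function defined on $L^p\subset L^1+L^2$), and let $^\vee$ denote the inverse Fourier transform. For $\psi\in C_c^\infty(\mathbb{R})$ with $\operatorname{supp}\psi\subset(\tfrac12,2)$, an integer $j\ge 0$ and $t>0$, put $$B^\psi_{2^{-j},t}f(x)=\big[\psi\big(2^j(1-|\xi/t|^2)\big)\widehat f(\xi)\big]^\vee(x),\qquad \tilde G^\psi_jf(x)=\sup_{R>0}\Big(\frac1R\int_0^R|B^\psi_{2^{-j},t}f(x)|^2\,dt\Big)^{1/2}.$$ For $\delta>-\tfrac12$ and $t>0$, put $$B^\delta_tf(x)=\int_{\mathbb{R}^n}\big(1-|\xi/t|^2\big)_+^\delta\,\widehat f(\xi)\,e^{2\pi i x\cdot\xi}\,d\xi,\qquad \tilde G^\delta f(x)=\sup_{R>0}\Big(\frac1R\int_0^R|B^\delta_tf(x)|^2\,dt\Big)^{1/2},$$ where $(1-|\xi|^2)_+^\delta$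 is understood to be $0$ for $|\xi|\ge1$. Then for every such $\psi$ and every $\epsilon>0$ there is a constant $C_\epsilon>0$, depending only on $n,p,\psi,\epsilon$, such that for all integers $j\ge0$ and all $f\in L^p(\mathbb{R}^n)$: (i) $$\Big\|\sup_{t>0}|B^\psi_{2^{-j},t}f|\Big\|_{L^p(\mathbb{R}^n)}\le C_\epsilon\,2^{j\left((n-1)(\frac1p-\frac12)+\epsilon\right)}\|f\|_{L^p(\mathbb{R}^n)};$$ (ii) $$\|\tilde G^\psi_jf\|_{L^p(\mathbb{R}^n)}\le C_\epsilon\,2^{j\left(n(\frac1p-\frac12)-\frac12+\epsilon\right)}\|f\|_{L^p(\mathbb{R}^n)}.$$ (iii) For every $\delta>n(\tfrac1p-\tfrac12)-\tfrac12$ there is a constant $C>0$, depending only on $n,p,\delta$, such that for all $f\in L^p(\mathbb{R}^n)$ $$\|\tilde G^\delta f\|_{L^p(\mathbb{R}^n)}\le C\,\|f\|_{L^p(\mathbb{R}^n)}.$$ -/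

import Mathlib

open MeasureTheory FourierTransform
open scoped ENNReal

noncomputable section

namespace BochnerRiesz

/-- The Euclidean space `ℝⁿ`. -/
abbrev Euc (n : ℕ) : Type := EuclideanSpace ℝ (Fin n)

open Classical in
/-- The part `f · 1_{|f| > 1}` of `f`. It is integrable if `f ∈ L^p`, `1 ≤ p < ∞`. -/
def highPart {n : ℕ} (f : Euc n → ℂ) (x : Euc n) : ℂ :=
  if 1 < ‖f x‖ then f x else 0

open Classical in
/-- The part `f · 1_{|f| ≤ 1}` of `f`. It is square integrable if `f ∈ L^p`, `1 ≤ p ≤ 2`. -/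
def lowPart {n : ℕ} (f : Euc n → ℂ) (x : Euc n) : ℂ :=
  if ‖f x‖ ≤ 1 then f x else 0

open Classical in
/-- The Plancherel extension of the Fourier transform to square integrable functions
(and `0` for functions which are not square integrable). -/
def fourierL2 {n : ℕ} (g : Euc n → ℂ) : Euc n → ℂ :=
  if h : MemLp g 2 volume then ((𝓕 (h.toLp g) : Lp ℂ 2 (volume : Measure (Euc n))) : Euc n → ℂ)
  else 0

/-- The Fourier transform of `f ∈ L^p(ℝⁿ)`, `1 ≤ p ≤ 2`: split `f` into an `L¹` and an `L²` part,
transform the first by the Fourier integral `∫ f(x) e^{-2πi x·ξ} dx` and the second by the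
Plancherel extension. -/
def fhat {n : ℕ} (f : Euc n → ℂ) (ξ : Euc n) : ℂ :=
  𝓕 (highPart f) ξ + fourierL2 (lowPart f) ξ

/-- The Fourier multiplier operator
`f ↦ (m f̂)^∨`, that is `x ↦ ∫ m(ξ) f̂(ξ) e^{2πi x·ξ} dξ`. -/
def multiplierOp {n : ℕ} (m : Euc n → ℂ) (f : Euc n → ℂ) : Euc n → ℂ :=
  𝓕⁻ (fun ξ => m ξ * fhat f ξ)

/-- `B^ψ_{2^{-j},t} f`, with multiplier `ψ(2^j (1 - |ξ/t|²))`. -/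
def BPsi {n : ℕ} (ψ : ℝ → ℂ) (j : ℕ) (t : ℝ) (f : Euc n → ℂ) : Euc n → ℂ :=
  multiplierOp (fun ξ => ψ ((2 : ℝ) ^ j * (1 - ‖t⁻¹ • ξ‖ ^ 2))) f

/-- The Bochner-Riesz multiplier `(1 - |ξ|²)_+^δ`, equal to `0` off the open unit ball
(also when `δ ≤ 0`). -/
def brMultiplier {n : ℕ} (δ : ℝ) (ξ : Euc n) : ℝ :=
  if ‖ξ‖ < 1 then (1 - ‖ξ‖ ^ 2) ^ δ else 0

/-- The Bochner-Riesz mean `B^δ_t f`, with multiplier `(1 - |ξ/t|²)_+^δ`. -/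
def BMean {n : ℕ} (δ : ℝ) (t : ℝ) (f : Euc n → ℂ) : Euc n → ℂ :=
  multiplierOp (fun ξ => (brMultiplier δ (t⁻¹ • ξ) : ℂ)) f

/-- `sup_{t > 0} |F_t(x)|`, with values in `[0, ∞]`. -/
def supOp {n : ℕ} (F : ℝ → Euc n → ℂ) (x : Euc n) : ℝ≥0∞ :=
  ⨆ (t : ℝ) (_ : 0 < t), ‖F t x‖ₑ

/-- `sup_{R > 0} (R⁻¹ ∫_0^R |F_t(x)|² dt)^{1/2}`, with values in `[0, ∞]`. -/
def squareSup {n : ℕ} (F : ℝ → Euc n → ℂ) (x : Euc n) : ℝ≥0∞ :=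
  ⨆ (R : ℝ) (_ : 0 < R),
    ((ENNReal.ofReal R)⁻¹ * ∫⁻ t in Set.Ioc 0 R, ‖F t x‖ₑ ^ 2) ^ (1 / 2 : ℝ)

/-- The maximal operator `sup_{t > 0} |B^ψ_{2^{-j},t} f|`. -/
def maximalPsi {n : ℕ} (ψ : ℝ → ℂ) (j : ℕ) (f : Euc n → ℂ) : Euc n → ℝ≥0∞ :=
  supOp (fun t => BPsi ψ j t f)

/-- The localized square function `G̃^ψ_j f`. -/
def squarePsi {n : ℕ} (ψ : ℝ → ℂ) (j : ℕ) (f : Euc n → ℂ) : Euc n → ℝ≥0∞ :=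
  squareSup (fun t => BPsi ψ j t f)

/-- The square function `G̃^δ f`. -/
def squareBR {n : ℕ} (δ : ℝ) (f : Euc n → ℂ) : Euc n → ℝ≥0∞ :=
  squareSup (fun t => BMean δ t f)

end BochnerRiesz

end

/-!
The multiplier `ψ(λ (1 - |ξ/t|²))`, `λ = 2^j`, lives on a shell of width about `t/λ` around the
sphere of radius `t`. The bounds for the maximal function and for the square function both
interpolate between an endpoint at `L¹` and one at `L²`, without any loss `ε`.

*The `L¹` endpoint.* Up to a factor `λ^{(n-1)/2}` and a dilation, all kernels are dominated by
`|x|^{-(n-1)} (1 + |x|²)⁻¹` (`exists_kernel_bound`). Stationary phase is not needed for this. After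
rescaling the shell to radius `λ` and width `1`, the weighted `L²` norms of the kernel follow from
Plancherel's theorem, because multiplication by `1 + |x|²` acts on the profile by a differential
operator with coefficients bounded in `λ` (`exists_profile_one_add_sq`). The kernel is radial and
solves a Helmholtz equation of frequency `λ` whose right-hand side is again such a kernel, and the
energy of the radial ordinary differential equation turns the weighted `L²` bounds into pointwise
decay (`energy_le`, `exists_ray_decay`). Hence `sup_t |B_t u| ≤ C λ^{(n-1)/2} M u`, with `M` the
Hardy-Littlewood maximal function, for `u ∈ L¹` (`exists_dil_fourier_le_maxFn`).

*The `L²` endpoint.* A fixed frequency `ξ` is active only for `t` in an interval of logarithmic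
length `O(1/λ)`. Plancherel's theorem therefore gives the gain `λ^{-1/2}` for the square function
with respect to `dt/t` (`lintegral_square_dilOp_le`), which dominates the averages over `(0, R]`.
The derivative of `B_t` in `log t` costs a factor `λ`, so the fundamental theorem of calculus
gives a bound without loss for the supremum (`lintegral_sup_dilOp_sq_le`).

*Interpolation.* For every decomposition `f = u + v` with `u ∈ L¹` and `v ∈ L²` the operator
splits accordingly (`multiplierOp_eq`), so both maximal operators are at most a multiple of `M u`
plus a function controlled in `L²` (`SplitBound`). Cutting `f` at a height proportional to the
level and integrating the distribution function gives the `L^p` bounds for `λ ≥ 4`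
(`exists_lintegral_rpow_le_of_splitBound`). For `λ ≤ 2` the maximal theorem suffices.

*The Bochner-Riesz means.* A smooth dyadic partition of unity in `1 - |ξ/t|²` writes `B^δ_t` as
`∑ 2^{-jδ} B^ψ_{2^{-j},t}`, with `ψ(v) = v^δ (χ(v) - χ(v/2))` (`tendsto_sum_BPsi`). Minkowski's
inequality in `t` and in `x` and the bound for the localized square functions leave a geometric
series, which converges for `δ > n (1/p - 1/2) - 1/2`.
-/

open MeasureTheory FourierTransform
open scoped ENNReal

noncomputable section

namespace BochnerRiesz

/-! ### The Fourier transform on `L¹ + L²` -/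

open scoped SchwartzMap in
/-- On `L¹ ∩ L²` the Fourier integral and the Plancherel extension agree: both define the same
tempered distribution. -/
theorem fourier_toLp_ae_eq {n : ℕ} {u : Euc n → ℂ} (h1 : Integrable u) (h2 : MemLp u 2 volume) :
    ((𝓕 (h2.toLp u) : Lp ℂ 2 (volume : Measure (Euc n))) : Euc n → ℂ) =ᵐ[volume] 𝓕 u := by
  have hc : Continuous (𝓕 u) := VectorFourier.fourierIntegral_continuous
    Real.continuous_fourierChar (by exact continuous_inner) h1
  refine ae_eq_of_integral_contDiff_smul_eq
    ((Lp.memLp _).locallyIntegrable (by norm_num)) hc.locallyIntegrable ?_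
  intro g hg hgc
  let φ : 𝓢(Euc n, ℂ) := HasCompactSupport.toSchwartzMap
    (f := fun x => (g x : ℂ)) (hgc.comp_left (g := fun r : ℝ => (r : ℂ)) (by simp))
    (Complex.ofRealCLM.contDiff.comp hg)
  have hφ : ∀ x, φ x = (g x : ℂ) := fun x => rfl
  have hT := congrArg (fun T => T φ) (Lp.fourier_toTemperedDistribution_eq (h2.toLp u))
  simp only [TemperedDistribution.fourier_apply, Lp.toTemperedDistribution_apply] at hT
  calc ∫ x, g x • ((𝓕 (h2.toLp u) : Lp ℂ 2 (volume : Measure (Euc n))) : Euc n → ℂ) x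
      = ∫ x, φ x • ((𝓕 (h2.toLp u) : Lp ℂ 2 (volume : Measure (Euc n))) : Euc n → ℂ) x := by
        simp [hφ]
    _ = ∫ x, (𝓕 φ) x • (h2.toLp u : Euc n → ℂ) x := hT.symm
    _ = ∫ x, (𝓕 φ) x • u x := by
        refine integral_congr_ae ?_
        filter_upwards [h2.coeFn_toLp] with x hx
        rw [hx]
    _ = ∫ x, φ x • 𝓕 u x := by
        have := VectorFourier.integral_fourierIntegral_smul_eq_flip
          (μ := (volume : Measure (Euc n))) (ν := (volume : Measure (Euc n))) (L := innerₗ (Euc n))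
          Real.continuous_fourierChar (by exact continuous_inner) φ.integrable h1
        rw [flip_innerₗ] at this
        exact this
    _ = _ := by simp [hφ]

theorem eLpNorm_fourier_eq {n : ℕ} {u : Euc n → ℂ} (h1 : Integrable u) (h2 : MemLp u 2 volume) :
    eLpNorm (𝓕 u) 2 volume = eLpNorm u 2 volume := by
  rw [← eLpNorm_congr_ae (fourier_toLp_ae_eq h1 h2), ← eLpNorm_congr_ae h2.coeFn_toLp,
    ← Lp.enorm_def, ← Lp.enorm_def, ← ofReal_norm, Lp.norm_fourier_eq, ofReal_norm]

/-- Plancherel's theorem for the inverse Fourier integral on `L¹ ∩ L²`. -/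
theorem eLpNorm_fourierInv_eq {n : ℕ} {u : Euc n → ℂ} (h1 : Integrable u)
    (h2 : MemLp u 2 volume) : eLpNorm (𝓕⁻ u) 2 volume = eLpNorm u 2 volume := by
  have hc : Continuous (𝓕 u) := VectorFourier.fourierIntegral_continuous
    Real.continuous_fourierChar (by exact continuous_inner) h1
  have : 𝓕⁻ u = 𝓕 u ∘ (fun x => -x) := by
    ext x; exact Real.fourierInv_eq_fourier_neg u x
  rw [this, eLpNorm_comp_measurePreserving hc.aestronglyMeasurable
    (Measure.measurePreserving_neg volume), eLpNorm_fourier_eq h1 h2]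

theorem lintegral_enorm_sq_eq {n : ℕ} (f : Euc n → ℂ) :
    ∫⁻ x, ‖f x‖ₑ ^ 2 = eLpNorm f 2 volume ^ (2 : ℕ) := by
  have := eLpNorm_nnreal_pow_eq_lintegral (f := f) (μ := (volume : Measure (Euc n)))
    (p := 2) (by norm_num)
  simpa using this.symm

theorem lintegral_enorm_fourierInv_sq {n : ℕ} {u : Euc n → ℂ} (h1 : Integrable u)
    (h2 : MemLp u 2 volume) : ∫⁻ x, ‖𝓕⁻ u x‖ₑ ^ 2 = ∫⁻ ξ, ‖u ξ‖ₑ ^ 2 := by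
  rw [lintegral_enorm_sq_eq, lintegral_enorm_sq_eq, eLpNorm_fourierInv_eq h1 h2]

theorem continuous_fourier {n : ℕ} {u : Euc n → ℂ} (h1 : Integrable u) : Continuous (𝓕 u) :=
  VectorFourier.fourierIntegral_continuous
    Real.continuous_fourierChar (by exact continuous_inner) h1

theorem continuous_fourierInv {n : ℕ} {u : Euc n → ℂ} (h1 : Integrable u) :
    Continuous (𝓕⁻ u) := by
  have : 𝓕⁻ u = 𝓕 u ∘ (fun x => -x) := by
    ext x; exact Real.fourierInv_eq_fourier_neg u x
  rw [this]
  exact (continuous_fourier h1).comp continuous_neg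

theorem norm_fourier_le {n : ℕ} (u : Euc n → ℂ) (x : Euc n) : ‖𝓕 u x‖ ≤ ∫ y, ‖u y‖ :=
  VectorFourier.norm_fourierIntegral_le_integral_norm _ _ _ _ _

theorem fourier_add_fun {n : ℕ} {u v : Euc n → ℂ} (hu : Integrable u) (hv : Integrable v) :
    𝓕 (u + v) = 𝓕 u + 𝓕 v :=
  VectorFourier.fourierIntegral_add Real.continuous_fourierChar (by exact continuous_inner) hu hv

theorem fourierInv_add_fun {n : ℕ} {u v : Euc n → ℂ} (hu : Integrable u) (hv : Integrable v) :
    𝓕⁻ (u + v) = 𝓕⁻ u + 𝓕⁻ v := by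
  ext x
  simp only [Pi.add_apply, Real.fourierInv_eq_fourier_neg, fourier_add_fun hu hv]

theorem memLp_fourierL2 {n : ℕ} (v : Euc n → ℂ) : MemLp (fourierL2 v) 2 volume := by
  unfold fourierL2
  split_ifs
  · exact Lp.memLp _
  · exact MemLp.zero

theorem eLpNorm_fourierL2 {n : ℕ} {v : Euc n → ℂ} (hv : MemLp v 2 volume) :
    eLpNorm (fourierL2 v) 2 volume = eLpNorm v 2 volume := by
  rw [fourierL2, dif_pos hv, ← eLpNorm_congr_ae hv.coeFn_toLp,
    ← Lp.enorm_def, ← Lp.enorm_def, ← ofReal_norm, Lp.norm_fourier_eq, ofReal_norm]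

theorem fourierL2_ae_eq {n : ℕ} {u : Euc n → ℂ} (h1 : Integrable u) (h2 : MemLp u 2 volume) :
    fourierL2 u =ᵐ[volume] 𝓕 u := by
  rw [fourierL2, dif_pos h2]
  exact fourier_toLp_ae_eq h1 h2

theorem fourierL2_sub {n : ℕ} {v w : Euc n → ℂ} (hv : MemLp v 2 volume) (hw : MemLp w 2 volume) :
    fourierL2 (v - w) =ᵐ[volume] fourierL2 v - fourierL2 w := by
  rw [fourierL2, dif_pos (hv.sub hw), fourierL2, dif_pos hv, fourierL2, dif_pos hw,
    MemLp.toLp_sub hv hw]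
  have : 𝓕 (hv.toLp v - hw.toLp w) = 𝓕 (hv.toLp v) - 𝓕 (hw.toLp w) :=
    (Lp.fourierTransformₗᵢ (Euc n) ℂ).map_sub _ _
  rw [this]
  exact Lp.coeFn_sub _ _

theorem highPart_add_lowPart {n : ℕ} (f : Euc n → ℂ) : highPart f + lowPart f = f := by
  ext x
  by_cases h : 1 < ‖f x‖
  · simp [highPart, lowPart, h, not_le.2 h]
  · simp [highPart, lowPart, h, not_lt.1 h]

/-- The function `fhat f` does not depend on the splitting of `f` into an integrable and a square
integrable part. -/
theorem fhat_ae_eq {n : ℕ} {f u v : Euc n → ℂ} (hh : Integrable (highPart f))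
    (hl : MemLp (lowPart f) 2 volume) (hu : Integrable u) (hv : MemLp v 2 volume)
    (hf : f =ᵐ[volume] u + v) :
    fhat f =ᵐ[volume] 𝓕 u + fourierL2 v := by
  -- the difference of the two splittings lies in `L¹ ∩ L²`, where both transforms agree
  have hw2 : MemLp (v - lowPart f) 2 volume := hv.sub hl
  have heq : highPart f - u =ᵐ[volume] v - lowPart f := by
    filter_upwards [hf] with x hx
    have := congrFun (highPart_add_lowPart f) x
    simp only [Pi.add_apply, Pi.sub_apply] at *
    linear_combination this + hx
  have hw1 : Integrable (v - lowPart f) := (hh.sub hu).congr heq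
  have hF : 𝓕 (v - lowPart f) = 𝓕 (highPart f) - 𝓕 u := by
    have h3 : highPart f = (highPart f - u) + u := by simp
    have h4 : 𝓕 (v - lowPart f) = 𝓕 (highPart f - u) := by
      ext x; exact (Real.fourier_congr_ae heq x).symm
    rw [h4]
    conv_rhs => rw [h3]
    rw [fourier_add_fun (hh.sub hu) hu]
    simp
  filter_upwards [fourierL2_ae_eq hw1 hw2, fourierL2_sub hv hl] with x h1 h2
  rw [hF, h2] at h1
  simp only [Pi.sub_apply, Pi.add_apply, fhat] at *
  linear_combination (-1 : ℂ) * h1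

/-- If `m ∈ L¹ ∩ L²`, the multiplier operator splits along any decomposition `f = u + v` with
`u ∈ L¹` and `v ∈ L²`. -/
theorem multiplierOp_eq {n : ℕ} {m f u v : Euc n → ℂ} (hm1 : Integrable m)
    (hm2 : MemLp m 2 volume) (hh : Integrable (highPart f))
    (hl : MemLp (lowPart f) 2 volume) (hu : Integrable u) (hv : MemLp v 2 volume)
    (hf : f =ᵐ[volume] u + v) (x : Euc n) :
    multiplierOp m f x = 𝓕⁻ (fun ξ => m ξ * 𝓕 u ξ) x + 𝓕⁻ (fun ξ => m ξ * fourierL2 v ξ) x := by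
  have i1 : Integrable (fun ξ => m ξ * 𝓕 u ξ) :=
    hm1.mul_bdd (c := ∫ y, ‖u y‖) (continuous_fourier hu).aestronglyMeasurable
      (ae_of_all _ (norm_fourier_le u))
  have i2 : Integrable (fun ξ => m ξ * fourierL2 v ξ) := hm2.integrable_mul (memLp_fourierL2 v)
  rw [← Pi.add_apply, ← fourierInv_add_fun i1 i2, multiplierOp]
  refine Real.fourierInv_congr_ae ?_ x
  filter_upwards [fhat_ae_eq hh hl hu hv hf] with ξ hξ
  simp [hξ, mul_add]

theorem integrable_indicator_gt {n : ℕ} {f : Euc n → ℂ} {p : ℝ} (hp1 : 1 ≤ p)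
    (hf : MemLp f (ENNReal.ofReal p) volume) {c : ℝ} (hc : 0 < c) :
    Integrable ({x | c < ‖f x‖}.indicator f) := by
  have hs : NullMeasurableSet {x | c < ‖f x‖} volume :=
    nullMeasurableSet_lt aemeasurable_const hf.1.norm.aemeasurable
  have hi := hf.integrable_norm_rpow (by simp; linarith) (by simp)
  rw [ENNReal.toReal_ofReal (by linarith)] at hi
  refine (hi.const_mul (c ^ (1 - p))).mono' (hf.1.indicator₀ hs) (ae_of_all _ fun x => ?_)
  by_cases hx : c < ‖f x‖
  · rw [Set.indicator_of_mem (by exact hx)]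
    have h0 : 0 < ‖f x‖ := hc.trans hx
    calc ‖f x‖ = ‖f x‖ ^ (1 - p) * ‖f x‖ ^ p := by
          rw [← Real.rpow_add h0]; simp
      _ ≤ c ^ (1 - p) * ‖f x‖ ^ p := by
          gcongr ?_ * _
          exact Real.rpow_le_rpow_of_nonpos hc hx.le (by linarith)
  · rw [Set.indicator_of_notMem (by exact hx), norm_zero]
    positivity

theorem memLp_two_indicator_le {n : ℕ} {f : Euc n → ℂ} {p : ℝ} (hp1 : 1 ≤ p) (hp2 : p ≤ 2)
    (hf : MemLp f (ENNReal.ofReal p) volume) {c : ℝ} (hc : 0 < c) :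
    MemLp ({x | ‖f x‖ ≤ c}.indicator f) 2 volume := by
  have hs : NullMeasurableSet {x | ‖f x‖ ≤ c} volume :=
    nullMeasurableSet_le hf.1.norm.aemeasurable aemeasurable_const
  have hi := hf.integrable_norm_rpow (by simp; linarith) (by simp)
  rw [ENNReal.toReal_ofReal (by linarith)] at hi
  rw [memLp_two_iff_integrable_sq_norm (hf.1.indicator₀ hs)]
  refine (hi.const_mul (c ^ (2 - p))).mono' ((hf.1.indicator₀ hs).norm.pow 2)
    (ae_of_all _ fun x => ?_)
  by_cases hx : ‖f x‖ ≤ c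
  · rw [Set.indicator_of_mem (by exact hx)]
    rcases eq_or_lt_of_le (norm_nonneg (f x)) with h0 | h0
    · rw [← h0]; simp; positivity
    calc ‖‖f x‖ ^ 2‖ = ‖f x‖ ^ (2 : ℝ) := by simp
      _ = ‖f x‖ ^ (2 - p) * ‖f x‖ ^ p := by
          rw [← Real.rpow_add h0]; simp
      _ ≤ c ^ (2 - p) * ‖f x‖ ^ p := by
          gcongr ?_ * _
          exact Real.rpow_le_rpow h0.le hx (by linarith)
  · rw [Set.indicator_of_notMem (by exact hx)]
    simp; positivity

theorem highPart_eq_indicator {n : ℕ} (f : Euc n → ℂ) :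
    highPart f = {x | 1 < ‖f x‖}.indicator f := by
  ext x; simp [highPart, Set.indicator]

theorem lowPart_eq_indicator {n : ℕ} (f : Euc n → ℂ) :
    lowPart f = {x | ‖f x‖ ≤ 1}.indicator f := by
  ext x; simp [lowPart, Set.indicator]

/-! ### Multipliers concentrated on a spherical shell -/

section ShellMultipliers

open scoped ContDiff SchwartzMap LineDeriv Laplacian RealInnerProductSpace

/-- Smooth functions on the line supported in `[1/2, 2]`. -/
def IsBump (Θ : ℝ → ℂ) : Prop := ContDiff ℝ ∞ Θ ∧ tsupport Θ ⊆ Set.Icc (1 / 2 : ℝ) 2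

namespace IsBump

variable {Θ Ψ : ℝ → ℂ}

theorem deriv (h : IsBump Θ) : IsBump (deriv Θ) :=
  ⟨(contDiff_infty_iff_deriv.1 h.1).2, tsupport_deriv_subset.trans h.2⟩

theorem mul_left {c : ℝ → ℂ} (hc : ContDiff ℝ ∞ c) (h : IsBump Θ) :
    IsBump (fun v => c v * Θ v) :=
  ⟨hc.mul h.1, (tsupport_mul_subset_right).trans h.2⟩

theorem add (h : IsBump Θ) (h' : IsBump Ψ) : IsBump (fun v => Θ v + Ψ v) :=
  ⟨h.1.add h'.1, (tsupport_add Θ Ψ).trans (Set.union_subset h.2 h'.2)⟩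

theorem eq_zero (h : IsBump Θ) {v : ℝ} (hv : v ∉ Set.Icc (1 / 2 : ℝ) 2) : Θ v = 0 :=
  image_eq_zero_of_notMem_tsupport fun hh => hv (h.2 hh)

theorem continuous (h : IsBump Θ) : Continuous Θ := h.1.continuous

theorem hasCompactSupport (h : IsBump Θ) : HasCompactSupport Θ :=
  isCompact_Icc.of_isClosed_subset (isClosed_tsupport _) h.2

theorem exists_bound (h : IsBump Θ) : ∃ C, 0 < C ∧ ∀ v, ‖Θ v‖ ≤ C := by
  obtain ⟨C, hC⟩ := h.continuous.bounded_above_of_compact_support h.hasCompactSupport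
  exact ⟨max C 1, by positivity, fun v => (hC v).trans (le_max_left _ _)⟩

end IsBump

/-- The multiplier `Θ(λ - |ξ|² / λ)`. It is the multiplier `Θ(λ (1 - |ξ|²))`, which lives on a
shell of radius about `1` and width `1/λ`, dilated to a shell of radius about `λ` and
width about `1`. -/
def shell {n : ℕ} (Θ : ℝ → ℂ) (lam : ℝ) (ξ : Euc n) : ℂ := Θ (lam - ‖ξ‖ ^ 2 / lam)

section shell

variable {n : ℕ} {Θ : ℝ → ℂ} {lam : ℝ}

theorem shell_eq_zero (h : IsBump Θ) (hl : 0 < lam) {ξ : Euc n} (hξ : lam < ‖ξ‖) :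
    shell Θ lam ξ = 0 := by
  apply h.eq_zero
  have : lam < ‖ξ‖ ^ 2 / lam := by rw [lt_div_iff₀ hl]; nlinarith
  intro hh
  have := hh.1
  linarith

theorem hasCompactSupport_shell (h : IsBump Θ) (hl : 0 < lam) :
    HasCompactSupport (shell (n := n) Θ lam) := by
  refine HasCompactSupport.intro (isCompact_closedBall (0 : Euc n) lam) fun ξ hξ => ?_
  exact shell_eq_zero h hl (by simpa using hξ)

theorem contDiff_shell (h : IsBump Θ) : ContDiff ℝ ∞ (shell (n := n) Θ lam) :=
  h.1.comp (contDiff_const.sub ((contDiff_norm_sq ℝ).div_const _))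

/-- The function `shell Θ lam` as a Schwartz function. -/
def shellS (n : ℕ) (h : IsBump Θ) (hl : 0 < lam) : 𝓢(Euc n, ℂ) :=
  (hasCompactSupport_shell h hl).toSchwartzMap (contDiff_shell h)

@[simp] theorem shellS_apply (h : IsBump Θ) (hl : 0 < lam) (ξ : Euc n) :
    shellS n h hl ξ = shell Θ lam ξ := rfl

theorem hasDerivAt_shell (h : Differentiable ℝ Θ) (x m : Euc n) :
    HasDerivAt (fun t : ℝ => shell Θ lam (x + t • m))
      (((-(2 * ⟪x, m⟫ / lam) : ℝ) : ℂ) * shell (deriv Θ) lam x) 0 := by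
  have h1 : HasDerivAt (fun t : ℝ => lam - ‖x + t • m‖ ^ 2 / lam) (-(2 * ⟪x, m⟫ / lam)) 0 := by
    have h2 : HasDerivAt (fun t : ℝ => x + t • m) m 0 := by
      simpa using ((hasDerivAt_id (0 : ℝ)).smul_const m).const_add x
    have h3 := h2.norm_sq
    simp only [zero_smul, add_zero] at h3
    exact (h3.div_const lam).const_sub lam
  have h4 : HasDerivAt Θ (deriv Θ (lam - ‖x‖ ^ 2 / lam)) (lam - ‖x + (0 : ℝ) • m‖ ^ 2 / lam) := by
    simpa using (h _).hasDerivAt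
  have := HasDerivAt.scomp (0 : ℝ) h4 h1
  simpa [shell, Function.comp_def] using this

theorem lineDerivOp_eq_of_hasDerivAt {f : 𝓢(Euc n, ℂ)} {x m : Euc n} {d : ℂ}
    (h : HasDerivAt (fun t : ℝ => f (x + t • m)) d 0) : ∂_{m} f x = d := by
  rw [SchwartzMap.lineDerivOp_apply]
  exact HasLineDerivAt.lineDeriv h

theorem laplacian_shellS (h : IsBump Θ) (hl : 0 < lam) (ξ : Euc n) :
    (Δ (shellS n h hl)) ξ =
      4 * shell (fun v => deriv (deriv Θ) v) lam ξ
        - (lam : ℂ)⁻¹ * shell (fun v => 2 * n * deriv Θ v + 4 * v * deriv (deriv Θ) v) lam ξ := by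
  have hd : Differentiable ℝ Θ := h.1.differentiable (by simp)
  have hd' : Differentiable ℝ (deriv Θ) := h.deriv.1.differentiable (by simp)
  let b := EuclideanSpace.basisFun (Fin n) ℝ
  have h1 : ∀ i, (∂_{b i} (∂_{b i} (shellS n h hl))) ξ =
      -(2 / lam) * shell (deriv Θ) lam ξ
        + (4 / lam ^ 2) * (ξ i ^ 2 : ℝ) * shell (deriv (deriv Θ)) lam ξ := by
    intro i
    have h2 : ∀ x, (∂_{b i} (shellS n h hl)) x =
        ((-(2 * ⟪x, b i⟫ / lam) : ℝ) : ℂ) * shell (deriv Θ) lam x := fun x =>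
      lineDerivOp_eq_of_hasDerivAt (hasDerivAt_shell hd x (b i))
    apply lineDerivOp_eq_of_hasDerivAt
    simp only [h2]
    have h3 : HasDerivAt (fun t : ℝ => ((-(2 * ⟪ξ + t • b i, b i⟫ / lam) : ℝ) : ℂ))
        ((-(2 / lam) : ℝ) : ℂ) 0 := by
      apply HasDerivAt.ofReal_comp
      have : (fun t : ℝ => -(2 * ⟪ξ + t • b i, b i⟫ / lam)) =
          fun t => -(2 / lam) * t + -(2 * ⟪ξ, b i⟫ / lam) := by
        ext t
        rw [inner_add_left, inner_smul_left, real_inner_self_eq_norm_sq, b.norm_eq_one]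
        simp; ring
      rw [this]
      simpa using ((hasDerivAt_id (0 : ℝ)).const_mul (-(2 / lam))).add_const (-(2 * ⟪ξ, b i⟫ / lam))
    have h4 := h3.mul (hasDerivAt_shell (lam := lam) hd' ξ (b i))
    have h5 : ⟪ξ, b i⟫ = ξ i := by simp [b, EuclideanSpace.inner_single_right]
    refine h4.congr_deriv ?_
    simp only [zero_smul, add_zero, h5]
    push_cast
    have : (lam : ℂ) ≠ 0 := by exact_mod_cast hl.ne'
    field_simp
    ring
  rw [SchwartzMap.laplacian_eq_sum b, sum_apply, Finset.sum_congr rfl (fun i _ => h1 i),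
    Finset.sum_add_distrib, ← Finset.sum_mul, ← Finset.sum_mul, ← Finset.mul_sum,
    ← Complex.ofReal_sum,
    ← EuclideanSpace.real_norm_sq_eq ξ]
  simp only [shell, Finset.sum_const, Finset.card_univ, Fintype.card_fin]
  have : (lam : ℂ) ≠ 0 := by exact_mod_cast hl.ne'
  push_cast
  field_simp
  simp only [nsmul_eq_mul]
  field_simp
  ring

theorem fourierInv_laplacian (f : 𝓢(Euc n, ℂ)) (x : Euc n) :
    (𝓕⁻ (Δ f)) x = ((-(4 * Real.pi ^ 2 * ‖x‖ ^ 2) : ℝ) : ℂ) * (𝓕⁻ f) x := by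
  let b := EuclideanSpace.basisFun (Fin n) ℝ
  have h1 : ∀ i, 𝓕⁻ (∂_{b i} (∂_{b i} f)) x = -(4 * Real.pi ^ 2) * (x i ^ 2 : ℝ) * (𝓕⁻ f) x := by
    intro i
    have : (inner ℝ · (b i)).HasTemperateGrowth := by fun_prop
    have h5 : ⟪x, b i⟫ = x i := by simp [b, EuclideanSpace.inner_single_right]
    simp [SchwartzMap.fourierInv_lineDerivOp_eq, this, h5]
    linear_combination (4 * (Real.pi : ℂ) ^ 2 * (x i) ^ 2 * (𝓕⁻ f) x) * Complex.I_sq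
  rw [SchwartzMap.laplacian_eq_sum b]
  have h2 : 𝓕⁻ (∑ i, ∂_{b i} (∂_{b i} f)) = ∑ i, 𝓕⁻ (∂_{b i} (∂_{b i} f)) :=
    map_sum (FourierTransform.fourierInvCLM ℂ 𝓢(Euc n, ℂ)) _ _
  rw [h2, sum_apply, Finset.sum_congr rfl (fun i _ => h1 i), ← Finset.sum_mul,
    ← Finset.mul_sum, ← Complex.ofReal_sum, ← EuclideanSpace.real_norm_sq_eq x]
  push_cast
  ring

theorem coe_fourierInv_shellS (h : IsBump Θ) (hl : 0 < lam) (x : Euc n) :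
    (𝓕⁻ (shellS n h hl)) x = 𝓕⁻ (shell (n := n) Θ lam) x := by
  rw [SchwartzMap.fourierInv_coe]; rfl

/-- Multiplication by `1 + |x|²` on the kernel side acts on the profile `Θ` by a second order
differential operator with coefficients bounded in `λ ≥ 1`. -/
theorem exists_profile_one_add_sq (n : ℕ) (h : IsBump Θ) :
    ∃ Θ₀ Θ₁ : ℝ → ℂ, IsBump Θ₀ ∧ IsBump Θ₁ ∧ ∀ lam : ℝ, 0 < lam → ∀ x : Euc n,
      ((1 + ‖x‖ ^ 2 : ℝ) : ℂ) * 𝓕⁻ (shell (n := n) Θ lam) x =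
        𝓕⁻ (shell (n := n) Θ₀ lam) x + (lam : ℂ)⁻¹ * 𝓕⁻ (shell (n := n) Θ₁ lam) x := by
  have hpi : (Real.pi : ℂ) ≠ 0 := by exact_mod_cast Real.pi_ne_zero
  have h0 : IsBump (fun v => Θ v + (-(1 / (Real.pi : ℂ) ^ 2)) * deriv (deriv Θ) v) :=
    h.add (h.deriv.deriv.mul_left contDiff_const)
  have h1 : IsBump (fun v => (n / (2 * (Real.pi : ℂ) ^ 2)) * deriv Θ v +
      ((v : ℂ) / (Real.pi : ℂ) ^ 2) * deriv (deriv Θ) v) :=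
    (h.deriv.mul_left contDiff_const).add
      (h.deriv.deriv.mul_left (Complex.ofRealCLM.contDiff.div_const _))
  refine ⟨_, _, h0, h1, fun lam hl x => ?_⟩
  have key : shellS n h0 hl + (lam : ℂ)⁻¹ • shellS n h1 hl =
      shellS n h hl + (-(1 / (4 * (Real.pi : ℂ) ^ 2))) • Δ (shellS n h hl) := by
    ext ξ
    simp only [add_apply, smul_apply, shellS_apply, laplacian_shellS,
      smul_eq_mul, shell]
    have : (lam : ℂ) ≠ 0 := by exact_mod_cast hl.ne'
    field_simp
    ring
  have key2 := congrArg (fun f => (𝓕⁻ f) x) key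
  simp only [FourierTransform.fourierInv_add, FourierTransform.fourierInv_smul,
    add_apply, smul_apply, fourierInv_laplacian, smul_eq_mul,
    coe_fourierInv_shellS] at key2
  rw [key2]
  push_cast
  field_simp

/-- The shell where `shell Θ lam` lives has volume `O(λ^{n-1})`. -/
theorem exists_volume_shell_le (n : ℕ) (hn : 1 ≤ n) :
    ∃ C : ℝ, 0 < C ∧ ∀ lam : ℝ, 1 ≤ lam →
      volume {ξ : Euc n | lam - ‖ξ‖ ^ 2 / lam ∈ Set.Icc (1 / 2 : ℝ) 2} ≤
        ENNReal.ofReal (C * lam ^ (n - 1)) := by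
  have : Nonempty (Fin n) := ⟨⟨0, hn⟩⟩
  set w := volume.real (Metric.ball (0 : Euc n) 1) with hw
  have hw0 : 0 < w := by
    rw [hw, measureReal_def]
    exact ENNReal.toReal_pos (Metric.measure_ball_pos _ _ one_pos).ne' measure_ball_lt_top.ne
  have hball : ∀ r : ℝ, 0 ≤ r → volume.real (Metric.closedBall (0 : Euc n) r) = r ^ n * w := by
    intro r hr
    rw [measureReal_def, Measure.addHaar_closedBall _ _ hr]
    simp [hw, measureReal_def, ENNReal.toReal_mul, ENNReal.toReal_ofReal (pow_nonneg hr n)]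
  have hball' : ∀ r : ℝ, 0 ≤ r → volume.real (Metric.ball (0 : Euc n) r) = r ^ n * w := by
    intro r hr
    rw [measureReal_def, Measure.addHaar_ball _ _ hr]
    simp [hw, measureReal_def, ENNReal.toReal_mul, ENNReal.toReal_ofReal (pow_nonneg hr n)]
  obtain ⟨m, rfl⟩ : ∃ m, n = m + 1 := ⟨n - 1, by omega⟩
  refine ⟨2 * (m + 1) * w, by positivity, fun lam hl => ?_⟩
  have hl0 : 0 < lam := by linarith
  simp only [Nat.add_sub_cancel]
  -- the shell lies in `λ - 2 ≤ |ξ| ≤ λ`, and in the full ball of radius `λ` if `λ ≤ 2`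
  rcases le_total lam 2 with h2 | h2
  · calc _ ≤ volume (Metric.closedBall (0 : Euc (m + 1)) lam) := by
          refine measure_mono fun ξ hξ => ?_
          rw [mem_closedBall_zero_iff]
          by_contra hlt
          have : lam < ‖ξ‖ ^ 2 / lam := by rw [lt_div_iff₀ hl0]; nlinarith
          have := hξ.1
          linarith
      _ = ENNReal.ofReal (lam ^ (m + 1) * w) := by
          rw [← hball lam hl0.le, measureReal_def, ENNReal.ofReal_toReal]
          exact measure_closedBall_lt_top.ne
      _ ≤ _ := by
          apply ENNReal.ofReal_le_ofReal
          rw [pow_succ]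
          have : 0 < lam ^ m := by positivity
          have hm : (0 : ℝ) ≤ m := by positivity
          calc lam ^ m * lam * w ≤ lam ^ m * 2 * w := by gcongr
            _ ≤ _ := by nlinarith [mul_nonneg hm (mul_pos this hw0).le]
  · calc _ ≤ volume (Metric.closedBall (0 : Euc (m + 1)) lam \ Metric.ball 0 (lam - 2)) := by
          refine measure_mono fun ξ hξ => ⟨?_, ?_⟩
          · rw [mem_closedBall_zero_iff]
            by_contra hlt
            have : lam < ‖ξ‖ ^ 2 / lam := by rw [lt_div_iff₀ hl0]; nlinarith
            have := hξ.1
            linarith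
          · rw [mem_ball_zero_iff]
            intro hlt
            have : ‖ξ‖ ^ 2 / lam < lam - 2 := by
              rw [div_lt_iff₀ hl0]; nlinarith [norm_nonneg ξ]
            have := hξ.2
            linarith
      _ = ENNReal.ofReal (lam ^ (m + 1) * w - (lam - 2) ^ (m + 1) * w) := by
          rw [← hball lam hl0.le, ← hball' (lam - 2) (by linarith), ← measureReal_sdiff
            (Metric.ball_subset_closedBall.trans
              (Metric.closedBall_subset_closedBall (by linarith)))
            measurableSet_ball measure_closedBall_lt_top.ne, measureReal_def, ENNReal.ofReal_toReal]
          exact ((measure_mono Set.sdiff_subset).trans_lt measure_closedBall_lt_top).ne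
      _ ≤ _ := by
          apply ENNReal.ofReal_le_ofReal
          rw [← sub_mul]
          have hb : lam ^ (m + 1) - (lam - 2) ^ (m + 1) ≤ 2 * (m + 1) * lam ^ m := by
            have hB := one_add_mul_le_pow (a := -(2 / lam))
              (by rw [neg_le_neg_iff, div_le_iff₀ hl0]; linarith) (m + 1)
            have h3 : (lam - 2) ^ (m + 1) = lam ^ (m + 1) * (1 + -(2 / lam)) ^ (m + 1) := by
              rw [← mul_pow]; congr 1; field_simp; ring
            rw [h3]
            have h4 : lam ^ (m + 1) * (1 + ((m + 1 : ℕ) : ℝ) * -(2 / lam)) =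
                lam ^ (m + 1) - 2 * (m + 1) * lam ^ m := by
              rw [pow_succ]; push_cast; field_simp; ring
            have h5 := mul_le_mul_of_nonneg_left hB (pow_pos hl0 (m + 1)).le
            linarith
          calc _ ≤ 2 * (m + 1) * lam ^ m * w := by gcongr
            _ = _ := by ring

theorem integrable_shell (h : IsBump Θ) (hl : 0 < lam) : Integrable (shell (n := n) Θ lam) :=
  (shellS n h hl).integrable

theorem memLp_shell (h : IsBump Θ) (hl : 0 < lam) : MemLp (shell (n := n) Θ lam) 2 volume :=
  (shellS n h hl).memLp 2 volume

theorem exists_eLpNorm_shell_le (n : ℕ) (hn : 1 ≤ n) (h : IsBump Θ) :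
    ∃ C : ℝ, 0 < C ∧ ∀ lam : ℝ, 1 ≤ lam →
      eLpNorm (shell (n := n) Θ lam) 2 volume ≤
        ENNReal.ofReal (C * lam ^ (((n : ℝ) - 1) / 2)) := by
  obtain ⟨V, hV0, hV⟩ := exists_volume_shell_le n hn
  obtain ⟨B, hB0, hB⟩ := h.exists_bound
  refine ⟨B * V ^ (1 / 2 : ℝ), by positivity, fun lam hl => ?_⟩
  have hl0 : 0 < lam := by linarith
  set S := {ξ : Euc n | lam - ‖ξ‖ ^ 2 / lam ∈ Set.Icc (1 / 2 : ℝ) 2}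
  have hS : MeasurableSet S := by
    have : Continuous fun ξ : Euc n => lam - ‖ξ‖ ^ 2 / lam := by fun_prop
    exact this.measurable measurableSet_Icc
  have hind : shell (n := n) Θ lam = S.indicator (shell Θ lam) := by
    ext ξ
    by_cases hξ : ξ ∈ S
    · rw [Set.indicator_of_mem hξ]
    · rw [Set.indicator_of_notMem hξ]; exact h.eq_zero hξ
  rw [hind, eLpNorm_indicator_eq_eLpNorm_restrict hS]
  refine (eLpNorm_le_of_ae_bound (C := B) (ae_of_all _ fun ξ => hB _)).trans ?_
  rw [Measure.restrict_apply_univ]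
  calc volume S ^ (2 : ℝ≥0∞).toReal⁻¹ * ENNReal.ofReal B
      ≤ ENNReal.ofReal (V * lam ^ (n - 1)) ^ (2 : ℝ≥0∞).toReal⁻¹ * ENNReal.ofReal B := by
        gcongr; exact hV lam hl
    _ = _ := by
        rw [ENNReal.ofReal_rpow_of_nonneg (by positivity) (by simp),
          ← ENNReal.ofReal_mul (by positivity)]
        congr 1
        rw [Real.mul_rpow hV0.le (by positivity), ← Real.rpow_natCast, ← Real.rpow_mul hl0.le,
          Nat.cast_sub hn]
        simp only [ENNReal.toReal_ofNat, Nat.cast_one, one_div]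
        rw [← div_eq_mul_inv]
        ring

/-- The weighted `L²` bound for the kernels: the decay `(1 + |x|²)^{-N}` costs nothing, uniformly
in `λ`. -/
theorem exists_eLpNorm_weighted_kernel_le (n : ℕ) (hn : 1 ≤ n) (N : ℕ) :
    ∀ Θ : ℝ → ℂ, IsBump Θ → ∃ C : ℝ, 0 < C ∧ ∀ lam : ℝ, 1 ≤ lam →
      eLpNorm (fun x : Euc n => (((1 + ‖x‖ ^ 2) ^ N : ℝ) : ℂ) * 𝓕⁻ (shell (n := n) Θ lam) x)
        2 volume ≤ ENNReal.ofReal (C * lam ^ (((n : ℝ) - 1) / 2)) := by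
  induction N with
  | zero =>
    intro Θ h
    obtain ⟨C, hC0, hC⟩ := exists_eLpNorm_shell_le n hn h
    refine ⟨C, hC0, fun lam hl => ?_⟩
    simp only [pow_zero, Complex.ofReal_one, one_mul]
    exact (eLpNorm_fourierInv_eq (integrable_shell h (by linarith))
      (memLp_shell h (by linarith))).trans_le (hC lam hl)
  | succ N ih =>
    intro Θ h
    obtain ⟨Θ₀, Θ₁, h0, h1, heq⟩ := exists_profile_one_add_sq n h
    obtain ⟨C₀, hC₀, hb₀⟩ := ih Θ₀ h0
    obtain ⟨C₁, hC₁, hb₁⟩ := ih Θ₁ h1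
    refine ⟨C₀ + C₁, by positivity, fun lam hl => ?_⟩
    have hl0 : 0 < lam := by linarith
    have hcont : ∀ {Ψ : ℝ → ℂ}, IsBump Ψ → AEStronglyMeasurable (fun x : Euc n =>
        (((1 + ‖x‖ ^ 2) ^ N : ℝ) : ℂ) * 𝓕⁻ (shell (n := n) Ψ lam) x) volume := by
      intro Ψ hΨ
      refine Continuous.aestronglyMeasurable (Continuous.mul ?_
        (continuous_fourierInv (integrable_shell hΨ hl0)))
      exact Complex.continuous_ofReal.comp (by fun_prop)
    have hfun : (fun x : Euc n =>
        (((1 + ‖x‖ ^ 2) ^ (N + 1) : ℝ) : ℂ) * 𝓕⁻ (shell (n := n) Θ lam) x) =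
        (fun x : Euc n => (((1 + ‖x‖ ^ 2) ^ N : ℝ) : ℂ) * 𝓕⁻ (shell (n := n) Θ₀ lam) x) +
        (lam : ℂ)⁻¹ • (fun x : Euc n =>
          (((1 + ‖x‖ ^ 2) ^ N : ℝ) : ℂ) * 𝓕⁻ (shell (n := n) Θ₁ lam) x) := by
      ext x
      have := heq lam hl0 x
      simp only [Pi.add_apply, Pi.smul_apply, smul_eq_mul]
      rw [pow_succ, Complex.ofReal_mul, mul_assoc, this]
      ring
    rw [hfun]
    refine (eLpNorm_add_le (hcont h0) ((hcont h1).const_smul _) (by norm_num)).trans ?_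
    rw [eLpNorm_const_smul, add_mul, ENNReal.ofReal_add (by positivity) (by positivity)]
    refine add_le_add (hb₀ lam hl) ?_
    have h2 : ‖(lam : ℂ)⁻¹‖ₑ ≤ 1 := by
      rw [← ofReal_norm, ENNReal.ofReal_le_one, norm_inv, Complex.norm_real, Real.norm_of_nonneg
        hl0.le]
      exact inv_le_one_of_one_le₀ hl
    calc _ ≤ 1 * ENNReal.ofReal (C₁ * lam ^ (((n : ℝ) - 1) / 2)) :=
          mul_le_mul' h2 (hb₁ lam hl)
      _ = _ := one_mul _

end shell

end ShellMultipliers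

/-! ### Pointwise decay of the kernels -/

section KernelDecay

open scoped ContDiff SchwartzMap LineDeriv Laplacian RealInnerProductSpace

/-- Energy estimate for a damped oscillator `k'' + (m/s) k' + κ² k = g`. With the weight `s ^ M`,
`M ≥ 2m`, the energy `|k'|² + κ² |k|²` can only decrease through the forcing term `g`; if it
vanishes at infinity it is therefore bounded by the work done by `g`. -/
theorem energy_le {k k1 k2 g : ℝ → ℂ} {m M : ℕ} {κ D r : ℝ} (hM : 2 * m ≤ M)
    (hk : ∀ s, 0 < s → HasDerivAt k (k1 s) s) (hk1 : ∀ s, 0 < s → HasDerivAt k1 (k2 s) s)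
    (hg : Continuous g) (hk1c : Continuous k1)
    (hode : ∀ s, 0 < s → k2 s + ((m / s : ℝ) : ℂ) * k1 s + ((κ ^ 2 : ℝ) : ℂ) * k s = g s)
    (hr : 0 < r) (hD : ∀ R, r ≤ R → ∫ s in r..R, s ^ M * (‖k1 s‖ * ‖g s‖) ≤ D)
    (hlim : Filter.Tendsto (fun s => s ^ M * (‖k1 s‖ ^ 2 + κ ^ 2 * ‖k s‖ ^ 2))
      Filter.atTop (nhds 0)) :
    r ^ M * (‖k1 r‖ ^ 2 + κ ^ 2 * ‖k r‖ ^ 2) ≤ 2 * D := by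
  set W : ℝ → ℝ := fun s => s ^ M * (‖k1 s‖ ^ 2 + κ ^ 2 * ‖k s‖ ^ 2) with hW
  have hder : ∀ s, 0 < s → HasDerivAt W (M * s ^ (M - 1) * (‖k1 s‖ ^ 2 + κ ^ 2 * ‖k s‖ ^ 2) +
      s ^ M * (2 * ⟪k1 s, k2 s⟫ + κ ^ 2 * (2 * ⟪k s, k1 s⟫))) s := by
    intro s hs
    exact (hasDerivAt_pow M s).mul ((hk1 s hs).norm_sq.add ((hk s hs).norm_sq.const_mul _))
  have hlow : ∀ s, 0 < s → -(M * s ^ (M - 1) * (‖k1 s‖ ^ 2 + κ ^ 2 * ‖k s‖ ^ 2) +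
      s ^ M * (2 * ⟪k1 s, k2 s⟫ + κ ^ 2 * (2 * ⟪k s, k1 s⟫))) ≤
      2 * (s ^ M * (‖k1 s‖ * ‖g s‖)) := by
    intro s hs
    have e1 : ⟪k1 s, g s⟫ = ⟪k1 s, k2 s⟫ + m / s * ‖k1 s‖ ^ 2 + κ ^ 2 * ⟪k s, k1 s⟫ := by
      rw [← hode s hs, inner_add_right, inner_add_right, ← Complex.real_smul, ← Complex.real_smul,
        inner_smul_right, inner_smul_right, real_inner_self_eq_norm_sq, real_inner_comm (k s)]
    have e2 : |⟪k1 s, g s⟫| ≤ ‖k1 s‖ * ‖g s‖ := abs_real_inner_le_norm _ _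
    have e3 : M * s ^ (M - 1) = s ^ M * (M / s) := by
      rcases Nat.eq_zero_or_pos M with h0 | h0
      · simp [h0]
      · obtain ⟨q, rfl⟩ : ∃ q, M = q + 1 := ⟨M - 1, by omega⟩
        simp only [Nat.add_sub_cancel]
        field_simp
        ring
    -- the derivative of the weight beats the damping term `(m/s) |k'|²`
    have e4 : 2 * (m / s) ≤ M / s := by
      rw [← mul_div_assoc]
      have : (2 * m : ℝ) ≤ M := by exact_mod_cast hM
      gcongr
    have e5 : 0 ≤ M / s * (κ ^ 2 * ‖k s‖ ^ 2) := by positivity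
    have e6 := mul_le_mul_of_nonneg_right e4 (sq_nonneg ‖k1 s‖)
    have e7 := (abs_le.1 e2).1
    have e8 : -((M / s) * (‖k1 s‖ ^ 2 + κ ^ 2 * ‖k s‖ ^ 2) +
        (2 * ⟪k1 s, k2 s⟫ + κ ^ 2 * (2 * ⟪k s, k1 s⟫))) ≤ 2 * (‖k1 s‖ * ‖g s‖) := by
      nlinarith
    rw [e3]
    have := mul_le_mul_of_nonneg_left e8 (pow_pos hs M).le
    linarith
  have hint : ∀ R, r ≤ R → W r ≤ 2 * D + W R := by
    intro R hR
    have hc : ContinuousOn (fun s => -W s) (Set.Icc r R) := fun s hs =>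
      (hder s (hr.trans_le hs.1)).continuousAt.continuousWithinAt.neg
    have h1 := intervalIntegral.sub_le_integral_of_hasDeriv_right_of_le hR hc
      (φ := fun s => 2 * (s ^ M * (‖k1 s‖ * ‖g s‖)))
      (fun s hs => (hder s (hr.trans hs.1)).neg.hasDerivWithinAt)
      (Continuous.integrableOn_Icc (by fun_prop)) (fun s hs => hlow s (hr.trans hs.1))
    rw [intervalIntegral.integral_const_mul] at h1
    have := hD R hR
    linarith
  have hl2 : Filter.Tendsto (fun R => 2 * D + W R) Filter.atTop (nhds (2 * D + 0)) :=
    hlim.const_add _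
  rw [add_zero] at hl2
  exact ge_of_tendsto hl2 (Filter.eventually_atTop.2 ⟨r, hint⟩)

section radial

variable {n : ℕ} {Θ : ℝ → ℂ} {lam : ℝ}

theorem fourierInv_shell_radial (Θ : ℝ → ℂ) (lam : ℝ) {x y : Euc n} (hxy : ‖x‖ = ‖y‖) :
    𝓕⁻ (shell (n := n) Θ lam) x = 𝓕⁻ (shell (n := n) Θ lam) y := by
  let A : Euc n ≃ₗᵢ[ℝ] Euc n := Submodule.reflection (ℝ ∙ (x - y))ᗮ
  have hA : A x = y := Submodule.reflection_sub hxy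
  have hs : (shell (n := n) Θ lam) ∘ A = shell Θ lam := by
    ext ξ; simp [shell]
  rw [← hA, ← Real.fourierInv_comp_linearIsometry, hs]

theorem hasDerivAt_line (F : 𝓢(Euc n, ℂ)) (x m : Euc n) (s : ℝ) :
    HasDerivAt (fun t : ℝ => F (x + t • m)) ((∂_{m} F) (x + s • m)) s := by
  rw [SchwartzMap.lineDerivOp_apply_eq_fderiv]
  have h2 : HasDerivAt (fun t : ℝ => x + t • m) m s := by
    simpa using ((hasDerivAt_id s).smul_const m).const_add x
  exact (F.hasFDerivAt _).comp_hasDerivAt s h2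

theorem hasDerivAt_ray (F : 𝓢(Euc n, ℂ)) (e : Euc n) (s : ℝ) :
    HasDerivAt (fun t : ℝ => F (t • e)) ((∂_{e} F) (s • e)) s := by
  simpa using hasDerivAt_line F 0 e s

/-- For a radial function the second derivative transversal to a ray is `k'(r) / r`. -/
theorem lineDerivOp_sq_of_radial {F : 𝓢(Euc n, ℂ)} (hF : ∀ x y, ‖x‖ = ‖y‖ → F x = F y)
    {e m : Euc n} (he : ‖e‖ = 1) (hm : ‖m‖ = 1) (hem : ⟪e, m⟫ = 0) {r : ℝ} (hr : 0 < r) :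
    (∂_{m} (∂_{m} F)) (r • e) = ((r⁻¹ : ℝ) : ℂ) * (∂_{e} F) (r • e) := by
  set ρ : ℝ → ℝ := fun s => √(r ^ 2 + s ^ 2) with hρ
  have hpos : ∀ s, 0 < r ^ 2 + s ^ 2 := fun s => by positivity
  have hρpos : ∀ s, 0 < ρ s := fun s => Real.sqrt_pos.2 (hpos s)
  have hρd : ∀ s, HasDerivAt ρ (s / ρ s) s := by
    intro s
    have h1 : HasDerivAt (fun s : ℝ => r ^ 2 + s ^ 2) (2 * s) s := by
      simpa using (hasDerivAt_pow 2 s).const_add (r ^ 2)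
    refine (h1.sqrt (hpos s).ne').congr_deriv ?_
    rw [mul_div_mul_left _ _ two_ne_zero]
  have hnorm : ∀ s, ‖r • e + s • m‖ = ‖ρ s • e‖ := by
    intro s
    rw [norm_smul, he, mul_one, Real.norm_of_nonneg (hρpos s).le, hρ,
      eq_comm, Real.sqrt_eq_iff_eq_sq (hpos s).le (norm_nonneg _), norm_add_sq_real,
      norm_smul, norm_smul, inner_smul_left, inner_smul_right, hem, he, hm]
    simp
  have h1 : ∀ s, (∂_{m} F) (r • e + s • m) = ((s / ρ s : ℝ) : ℂ) * (∂_{e} F) (ρ s • e) := by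
    intro s
    have ha := hasDerivAt_line F (r • e) m s
    have hb : HasDerivAt (fun t => F (ρ t • e)) ((s / ρ s) • (∂_{e} F) (ρ s • e)) s :=
      HasDerivAt.scomp s (hasDerivAt_ray F e (ρ s)) (hρd s)
    have : (fun t : ℝ => F (r • e + t • m)) = fun t => F (ρ t • e) :=
      funext fun t => hF _ _ (hnorm t)
    rw [this] at ha
    rw [ha.unique hb, Complex.real_smul]
  have ha := hasDerivAt_line (∂_{m} F) (r • e) m 0
  have hρ0 : ρ 0 = r := by simp [hρ, Real.sqrt_sq hr.le]
  have hb : HasDerivAt (fun s => ((s / ρ s : ℝ) : ℂ) * (∂_{e} F) (ρ s • e))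
      (((r⁻¹ : ℝ) : ℂ) * (∂_{e} F) (r • e)) 0 := by
    have h2 : HasDerivAt (fun s => s / ρ s) r⁻¹ 0 := by
      refine ((hasDerivAt_id (0 : ℝ)).div (hρd 0) (hρpos 0).ne').congr_deriv ?_
      simp only [hρ0, id]
      field_simp
      simp
    have h3 : HasDerivAt (fun t => (∂_{e} F) (ρ t • e))
        ((0 / ρ 0) • (∂_{e} (∂_{e} F)) (ρ 0 • e)) 0 :=
      HasDerivAt.scomp 0 (hasDerivAt_ray (∂_{e} F) e (ρ 0)) (hρd 0)
    refine (h2.ofReal_comp.mul h3).congr_deriv ?_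
    simp [hρ0]
  have hfun : (fun t : ℝ => (∂_{m} F) (r • e + t • m)) =
      fun s => ((s / ρ s : ℝ) : ℂ) * (∂_{e} F) (ρ s • e) := funext h1
  rw [hfun] at ha
  simpa using ha.unique hb

/-- The Laplacian of a radial function on the ray through a basis vector. -/
theorem laplacian_of_radial {F : 𝓢(Euc n, ℂ)} (hF : ∀ x y, ‖x‖ = ‖y‖ → F x = F y) (i₀ : Fin n)
    {r : ℝ} (hr : 0 < r) :
    (Δ F) (r • EuclideanSpace.basisFun (Fin n) ℝ i₀) =
      (∂_{EuclideanSpace.basisFun (Fin n) ℝ i₀} (∂_{EuclideanSpace.basisFun (Fin n) ℝ i₀} F))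
        (r • EuclideanSpace.basisFun (Fin n) ℝ i₀) +
      ((((n - 1 : ℕ) / r : ℝ)) : ℂ) * (∂_{EuclideanSpace.basisFun (Fin n) ℝ i₀} F)
        (r • EuclideanSpace.basisFun (Fin n) ℝ i₀) := by
  set b := EuclideanSpace.basisFun (Fin n) ℝ
  rw [SchwartzMap.laplacian_eq_sum b, sum_apply, ← Finset.add_sum_erase _ _ (Finset.mem_univ i₀),
    Finset.sum_congr rfl (fun i hi => lineDerivOp_sq_of_radial hF (b.norm_eq_one i₀)
      (b.norm_eq_one i) (b.inner_eq_zero (Finset.ne_of_mem_erase hi).symm) hr)]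
  simp only [Finset.sum_const, Finset.card_erase_of_mem (Finset.mem_univ i₀), Finset.card_univ,
    Fintype.card_fin, nsmul_eq_mul]
  push_cast
  ring

/-- The kernel of a shell multiplier almost solves the Helmholtz equation: the multiplier of
`(Δ + 4π²λ²) K` is smaller than `λ²` by a factor `λ`. -/
theorem helmholtz_shell (h : IsBump Θ) (hl : 0 < lam) (x : Euc n) :
    (Δ (𝓕⁻ (shellS n h hl))) x + (((2 * Real.pi * lam) ^ 2 : ℝ) : ℂ) * (𝓕⁻ (shellS n h hl)) x =
      (lam : ℂ) * 𝓕⁻ (shell (n := n) (fun v => (4 * Real.pi ^ 2 * v : ℝ) * Θ v) lam) x := by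
  set b := EuclideanSpace.basisFun (Fin n) ℝ
  have h1 : IsBump (fun v => ((4 * Real.pi ^ 2 * v : ℝ) : ℂ) * Θ v) :=
    h.mul_left (Complex.ofRealCLM.contDiff.comp (contDiff_const.mul contDiff_id))
  have hg : ∀ i, (inner ℝ · (b i)).HasTemperateGrowth := fun i => by fun_prop
  have key : ∑ i, ((2 * Real.pi * Complex.I) • SchwartzMap.smulLeftCLM ℂ (inner ℝ · (b i))
        ((2 * Real.pi * Complex.I) • SchwartzMap.smulLeftCLM ℂ (inner ℝ · (b i)) (shellS n h hl))) +
      (((2 * Real.pi * lam) ^ 2 : ℝ) : ℂ) • shellS n h hl = (lam : ℂ) • shellS n h1 hl := by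
    ext ξ
    simp only [add_apply, sum_apply, smul_apply, SchwartzMap.smulLeftCLM_apply_apply (hg _),
      shellS_apply, smul_eq_mul, shell]
    have h5 : ∀ i, ⟪ξ, b i⟫ = ξ i := fun i => by simp [b, EuclideanSpace.inner_single_right]
    have h6 : ∀ i, 2 * Real.pi * Complex.I * (⟪ξ, b i⟫ • (2 * Real.pi * Complex.I *
        (⟪ξ, b i⟫ • Θ (lam - ‖ξ‖ ^ 2 / lam)))) =
        ((ξ i ^ 2 : ℝ) : ℂ) * (-(4 * Real.pi ^ 2) * Θ (lam - ‖ξ‖ ^ 2 / lam)) := by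
      intro i
      rw [h5, Complex.real_smul, Complex.real_smul]
      push_cast
      linear_combination (4 * (Real.pi : ℂ) ^ 2 * (ξ i) ^ 2 * Θ (lam - ‖ξ‖ ^ 2 / lam)) *
        Complex.I_sq
    rw [Finset.sum_congr rfl (fun i _ => h6 i), ← Finset.sum_mul, ← Complex.ofReal_sum,
      ← EuclideanSpace.real_norm_sq_eq ξ]
    have : (lam : ℂ) ≠ 0 := by exact_mod_cast hl.ne'
    push_cast
    field_simp
    ring
  have key2 := congrArg (fun f => (𝓕⁻ f) x) key
  simp only [FourierTransform.fourierInv_add, FourierTransform.fourierInv_smul,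
    add_apply, smul_apply, smul_eq_mul] at key2
  rw [← coe_fourierInv_shellS h1 hl, ← key2, SchwartzMap.laplacian_eq_sum b]
  congr 2
  have h2 : ∀ g : Fin n → 𝓢(Euc n, ℂ), 𝓕⁻ (∑ i, g i) = ∑ i, 𝓕⁻ (g i) :=
    fun g => map_sum (FourierTransform.fourierInvCLM ℂ 𝓢(Euc n, ℂ)) _ _
  rw [h2]
  refine Finset.sum_congr rfl fun i _ => ?_
  rw [SchwartzMap.lineDerivOp_fourierInv_eq, SchwartzMap.lineDerivOp_fourierInv_eq]

/-- A derivative of the kernel costs a factor `λ`, the radius of the shell. -/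
theorem exists_eLpNorm_lineDerivOp_kernel_le (n : ℕ) (hn : 1 ≤ n) (h : IsBump Θ) :
    ∃ C : ℝ, 0 < C ∧ ∀ (lam : ℝ) (hl : 0 < lam), 1 ≤ lam → ∀ i : Fin n,
      eLpNorm (∂_{EuclideanSpace.basisFun (Fin n) ℝ i} (𝓕⁻ (shellS n h hl)) : 𝓢(Euc n, ℂ))
        2 volume ≤ ENNReal.ofReal (C * lam * lam ^ (((n : ℝ) - 1) / 2)) := by
  obtain ⟨C, hC0, hC⟩ := exists_eLpNorm_shell_le n hn h
  refine ⟨2 * Real.pi * C, by positivity, fun lam hl hl1 i => ?_⟩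
  set b := EuclideanSpace.basisFun (Fin n) ℝ
  have hg : (inner ℝ · (b i)).HasTemperateGrowth := by fun_prop
  rw [SchwartzMap.lineDerivOp_fourierInv_eq, SchwartzMap.fourierInv_coe,
    eLpNorm_fourierInv_eq (SchwartzMap.integrable _) (SchwartzMap.memLp _ 2 volume)]
  calc _ ≤ ENNReal.ofReal (2 * Real.pi * lam) * eLpNorm (shell (n := n) Θ lam) 2 volume := by
        refine eLpNorm_le_mul_eLpNorm_of_ae_le_mul (ae_of_all _ fun ξ => ?_) 2
        simp only [smul_apply, SchwartzMap.smulLeftCLM_apply_apply hg, shellS_apply, norm_smul,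
          norm_mul, Complex.norm_I, Complex.norm_ofNat, Complex.norm_real,
          Real.norm_of_nonneg Real.pi_pos.le]
        rcases lt_or_ge lam ‖ξ‖ with h2 | h2
        · simp [shell_eq_zero h hl h2]
        · have h3 : ‖⟪ξ, b i⟫‖ ≤ lam := by
            refine (norm_inner_le_norm _ _).trans ?_
            rw [b.norm_eq_one, mul_one]; exact h2
          calc _ ≤ 2 * Real.pi * 1 * (lam * ‖shell Θ lam ξ‖) := by gcongr
            _ = _ := by ring
    _ ≤ ENNReal.ofReal (2 * Real.pi * lam) * ENNReal.ofReal (C * lam ^ (((n : ℝ) - 1) / 2)) := by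
        gcongr; exact hC lam hl1
    _ = _ := by
        rw [← ENNReal.ofReal_mul (by positivity)]
        congr 1; ring

theorem tendsto_pow_mul_sq_ray (F : 𝓢(Euc n, ℂ)) (M : ℕ) {e : Euc n} (he : ‖e‖ = 1) :
    Filter.Tendsto (fun s : ℝ => s ^ M * ‖F (s • e)‖ ^ 2) Filter.atTop (nhds 0) := by
  obtain ⟨C, hC0, hC⟩ := F.decay (M + 1) 0
  obtain ⟨B, hB0, hB⟩ := F.decay 0 0
  have hlim : Filter.Tendsto (fun s : ℝ => C * B * s⁻¹) Filter.atTop (nhds 0) := by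
    simpa using tendsto_inv_atTop_zero.const_mul (C * B)
  refine squeeze_zero' (Filter.eventually_atTop.2 ⟨1, fun s hs => ?_⟩)
    (Filter.eventually_atTop.2 ⟨1, fun s hs => ?_⟩) hlim
  · have : (0 : ℝ) ≤ s := by linarith
    positivity
  · have hs0 : 0 < s := by linarith
    have h1 := hC (s • e)
    have h2 := hB (s • e)
    simp only [norm_smul, he, mul_one, Real.norm_of_nonneg hs0.le, norm_iteratedFDeriv_zero,
      pow_zero, one_mul] at h1 h2
    calc s ^ M * ‖F (s • e)‖ ^ 2 = (s ^ (M + 1) * ‖F (s • e)‖) * ‖F (s • e)‖ * s⁻¹ := by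
          field_simp
          ring
      _ ≤ C * B * s⁻¹ := by gcongr

theorem norm_lineDerivOp_ray_le {F : 𝓢(Euc n, ℂ)} (hF : ∀ x y, ‖x‖ = ‖y‖ → F x = F y)
    (i₀ : Fin n) (x : Euc n) :
    ‖(∂_{EuclideanSpace.basisFun (Fin n) ℝ i₀} F) (‖x‖ • EuclideanSpace.basisFun (Fin n) ℝ i₀)‖ ≤
      ∑ i, ‖(∂_{EuclideanSpace.basisFun (Fin n) ℝ i} F) x‖ := by
  set b := EuclideanSpace.basisFun (Fin n) ℝ
  rcases eq_or_ne x 0 with rfl | hx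
  · rw [norm_zero, zero_smul]
    exact Finset.single_le_sum (f := fun i => ‖(∂_{b i} F) 0‖) (fun i _ => norm_nonneg _)
      (Finset.mem_univ i₀)
  · have hx0 : 0 < ‖x‖ := norm_pos_iff.2 hx
    set u : Euc n := ‖x‖⁻¹ • x with hu
    have hun : ‖u‖ = 1 := by rw [hu, norm_smul, norm_inv, norm_norm, inv_mul_cancel₀ hx0.ne']
    have hxu : ‖x‖ • u = x := by rw [hu, smul_smul, mul_inv_cancel₀ hx0.ne', one_smul]
    have h1 := hasDerivAt_ray F u ‖x‖
    have hfun : (fun t : ℝ => F (t • u)) = fun t => F (t • b i₀) := by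
      ext t
      apply hF
      rw [norm_smul t u, norm_smul t (b i₀), hun, b.norm_eq_one]
    rw [hfun] at h1
    rw [(hasDerivAt_ray F (b i₀) ‖x‖).unique h1, hxu, SchwartzMap.lineDerivOp_apply_eq_fderiv]
    conv_lhs => rw [← b.sum_repr u]
    rw [map_sum]
    refine (norm_sum_le _ _).trans (Finset.sum_le_sum fun i _ => ?_)
    rw [map_smul, norm_smul, SchwartzMap.lineDerivOp_apply_eq_fderiv]
    refine mul_le_of_le_one_left (norm_nonneg _) ?_
    rw [b.repr_apply_apply]
    refine (norm_inner_le_norm _ _).trans ?_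
    rw [b.norm_eq_one, hun, one_mul]

theorem integral_norm_mul_norm_le {f g : Euc n → ℂ} (hf : MemLp f 2 volume)
    (hg : MemLp g 2 volume) {a b : ℝ} (ha : 0 ≤ a) (hb : 0 ≤ b)
    (hfa : eLpNorm f 2 volume ≤ ENNReal.ofReal a) (hgb : eLpNorm g 2 volume ≤ ENNReal.ofReal b) :
    Integrable (fun x => ‖f x‖ * ‖g x‖) ∧ ∫ x, ‖f x‖ * ‖g x‖ ≤ a * b := by
  have hint : Integrable (fun x => ‖f x‖ * ‖g x‖) := hf.norm.integrable_mul hg.norm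
  refine ⟨hint, ?_⟩
  have h1 : eLpNorm (f • g) 1 volume ≤ eLpNorm f 2 volume * eLpNorm g 2 volume :=
    eLpNorm_smul_le_mul_eLpNorm hg.1 hf.1
  have h2 : ∫ x, ‖f x‖ * ‖g x‖ = (eLpNorm (f • g) 1 volume).toReal := by
    rw [eLpNorm_one_eq_lintegral_enorm, integral_eq_lintegral_of_nonneg_ae
      (ae_of_all _ fun x => by positivity) hint.1]
    congr 1
    refine lintegral_congr fun x => ?_
    rw [Pi.smul_apply', enorm_smul, ENNReal.ofReal_mul (norm_nonneg _), ofReal_norm, ofReal_norm]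
  rw [h2]
  refine ENNReal.toReal_le_of_le_ofReal (by positivity) (h1.trans ?_)
  rw [ENNReal.ofReal_mul ha]
  exact mul_le_mul' hfa hgb

/-- A one-dimensional integral dominated by an integral over `ℝⁿ` in polar coordinates. -/
theorem intervalIntegral_le_of_radial (hn : 1 ≤ n) {p φ : ℝ → ℝ} {Ψ : Euc n → ℝ} {A : ℝ}
    (hp : Continuous p) (hφc : Continuous φ) (hφ0 : ∀ s, 0 ≤ φ s)
    (hpφ : ∀ s, 0 < s → p s ≤ s ^ (n - 1) * φ s) (hΨ : Integrable Ψ)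
    (hφΨ : ∀ x : Euc n, φ ‖x‖ ≤ Ψ x) (hA : ∫ x, Ψ x ≤ n * A) {r R : ℝ} (hr : 0 < r)
    (hrR : r ≤ R) :
    ∫ s in r..R, p s ≤ A / volume.real (Metric.ball (0 : Euc n) 1) := by
  have hne : Nonempty (Fin n) := ⟨⟨0, hn⟩⟩
  have hw0 : 0 < volume.real (Metric.ball (0 : Euc n) 1) := by
    rw [measureReal_def]
    exact ENNReal.toReal_pos (Metric.measure_ball_pos _ _ one_pos).ne' measure_ball_lt_top.ne
  have hn0 : (0 : ℝ) < n := by exact_mod_cast hn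
  have hΦ : Integrable (fun x : Euc n => φ ‖x‖) :=
    hΨ.mono' (hφc.comp continuous_norm).aestronglyMeasurable
      (ae_of_all _ fun x => by rw [Real.norm_of_nonneg (hφ0 _)]; exact hφΨ x)
  have hΦle : ∫ x : Euc n, φ ‖x‖ ≤ n * A := (integral_mono hΦ hΨ hφΨ).trans hA
  have hpol := integral_fun_norm_addHaar (volume : Measure (Euc n)) φ
  have hpi := (integrable_fun_norm_addHaar (volume : Measure (Euc n))).1 hΦ
  simp only [finrank_euclideanSpace, Fintype.card_fin, smul_eq_mul, nsmul_eq_mul] at hpol hpi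
  rw [intervalIntegral.integral_of_le hrR]
  have hsub : Set.Ioc r R ⊆ Set.Ioi 0 := fun s hs => hr.trans hs.1
  calc _ ≤ ∫ s in Set.Ioc r R, s ^ (n - 1) * φ s := by
        refine setIntegral_mono_on ?_ (hpi.mono_set hsub) measurableSet_Ioc
          fun s hs => hpφ s (hsub hs)
        exact hp.integrableOn_Icc.mono_set Set.Ioc_subset_Icc_self
    _ ≤ ∫ s in Set.Ioi 0, s ^ (n - 1) * φ s := by
        refine setIntegral_mono_set hpi ?_ (LE.le.eventuallyLE hsub)
        filter_upwards [ae_restrict_mem measurableSet_Ioi] with s hs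
        exact mul_nonneg (pow_nonneg (le_of_lt hs) _) (hφ0 s)
    _ ≤ _ := by
        rw [le_div_iff₀ hw0]
        have h3 := hpol.symm.trans_le hΦle
        have := le_of_mul_le_mul_left h3 hn0
        linarith

/-- The work of the forcing term in the radial Helmholtz equation, bounded by Cauchy-Schwarz. -/
theorem work_le (hn : 1 ≤ n) {H : 𝓢(Euc n, ℂ)} (hHr : ∀ x y, ‖x‖ = ‖y‖ → H x = H y)
    {G : Euc n → ℂ} (hGr : ∀ x y, ‖x‖ = ‖y‖ → G x = G y) (hGc : Continuous G) (i₀ : Fin n)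
    (l : ℕ) {a c r R : ℝ} (ha : 0 ≤ a) (hc : 0 ≤ c)
    (hH : ∀ i, eLpNorm (∂_{EuclideanSpace.basisFun (Fin n) ℝ i} H : 𝓢(Euc n, ℂ)) 2 volume ≤
      ENNReal.ofReal a)
    (hG : eLpNorm (fun x => (((1 + ‖x‖ ^ 2) ^ l : ℝ) : ℂ) * G x) 2 volume ≤ ENNReal.ofReal c)
    (hr : 0 < r) (hrR : r ≤ R) :
    ∫ s in r..R, s ^ (n - 1 + l) *
      (‖(∂_{EuclideanSpace.basisFun (Fin n) ℝ i₀} H)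
        (s • EuclideanSpace.basisFun (Fin n) ℝ i₀)‖ *
      ‖G (s • EuclideanSpace.basisFun (Fin n) ℝ i₀)‖) ≤
      a * c / volume.real (Metric.ball (0 : Euc n) 1) := by
  set b := EuclideanSpace.basisFun (Fin n) ℝ
  set wG : Euc n → ℂ := fun x => (((1 + ‖x‖ ^ 2) ^ l : ℝ) : ℂ) * G x with hwG
  have hwGc : Continuous wG := (Complex.continuous_ofReal.comp (by fun_prop)).mul hGc
  have hwG2 : MemLp wG 2 volume := ⟨hwGc.aestronglyMeasurable, hG.trans_lt ENNReal.ofReal_lt_top⟩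
  have hterm : ∀ i, Integrable (fun x => ‖(∂_{b i} H) x‖ * ‖wG x‖) ∧
      ∫ x, ‖(∂_{b i} H) x‖ * ‖wG x‖ ≤ a * c := fun i =>
    integral_norm_mul_norm_le ((∂_{b i} H).memLp 2 volume) hwG2 ha hc (hH i) hG
  have hk1c : Continuous fun s : ℝ => (∂_{b i₀} H) (s • b i₀) :=
    (SchwartzMap.continuous _).comp (by fun_prop)
  have hgc : Continuous fun s : ℝ => G (s • b i₀) := hGc.comp (by fun_prop)
  refine intervalIntegral_le_of_radial hn
    (φ := fun s => (1 + s ^ 2) ^ l * (‖(∂_{b i₀} H) (s • b i₀)‖ * ‖G (s • b i₀)‖))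
    (Ψ := fun x => ∑ i, ‖(∂_{b i} H) x‖ * ‖wG x‖)
    (by fun_prop) (by fun_prop) (fun s => by positivity) (fun s hs => ?_)
    (integrable_finsetSum _ fun i _ => (hterm i).1) (fun x => ?_) ?_ hr hrR
  · have : s ^ l ≤ (1 + s ^ 2) ^ l := by
      gcongr; nlinarith [sq_nonneg (s - 1)]
    rw [pow_add, mul_assoc]
    gcongr
  · have e2 : ‖wG x‖ = (1 + ‖x‖ ^ 2) ^ l * ‖G x‖ := by
      simp only [hwG, norm_mul, Complex.norm_real]
      rw [Real.norm_of_nonneg (by positivity)]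
    have e3 := norm_lineDerivOp_ray_le hHr i₀ x
    rw [← Finset.sum_mul, e2,
      hGr (‖x‖ • b i₀) x (by rw [norm_smul, b.norm_eq_one, norm_norm, mul_one])]
    calc _ = ‖(∂_{b i₀} H) (‖x‖ • b i₀)‖ * ((1 + ‖x‖ ^ 2) ^ l * ‖G x‖) := by ring
      _ ≤ _ := by gcongr
  · rw [integral_finsetSum _ fun i _ => (hterm i).1]
    refine (Finset.sum_le_sum fun i _ => (hterm i).2).trans ?_
    simp

/-- Decay of the kernel along a ray: `r ^ (n - 1 + l) * |K(r e)|² = O(λ^{n-1})`. -/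
theorem exists_ray_decay (n : ℕ) (hn : 1 ≤ n) (h : IsBump Θ) (l : ℕ) (hl : n - 1 ≤ l) :
    ∃ C : ℝ, 0 < C ∧ ∀ lam : ℝ, 1 ≤ lam → ∀ x : Euc n, x ≠ 0 →
      ‖x‖ ^ (n - 1 + l) * ‖𝓕⁻ (shell (n := n) Θ lam) x‖ ^ 2 ≤ C * lam ^ ((n : ℝ) - 1) := by
  have hne : Nonempty (Fin n) := ⟨⟨0, hn⟩⟩
  let i₀ : Fin n := ⟨0, hn⟩
  set b := EuclideanSpace.basisFun (Fin n) ℝ with hb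
  set w := volume.real (Metric.ball (0 : Euc n) 1) with hw
  have hw0 : 0 < w := by
    rw [hw, measureReal_def]
    exact ENNReal.toReal_pos (Metric.measure_ball_pos _ _ one_pos).ne' measure_ball_lt_top.ne
  have h1 : IsBump (fun v => ((4 * Real.pi ^ 2 * v : ℝ) : ℂ) * Θ v) :=
    h.mul_left (Complex.ofRealCLM.contDiff.comp (contDiff_const.mul contDiff_id))
  obtain ⟨C₁, hC₁0, hC₁⟩ := exists_eLpNorm_lineDerivOp_kernel_le n hn h
  obtain ⟨C₂, hC₂0, hC₂⟩ := exists_eLpNorm_weighted_kernel_le n hn l _ h1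
  refine ⟨2 * (C₁ * C₂ / w), by positivity, fun lam hlam x hx => ?_⟩
  have hlam0 : 0 < lam := by linarith
  set P := lam ^ (((n : ℝ) - 1) / 2) with hP
  have hP0 : 0 < P := by positivity
  have hPP : P * P = lam ^ ((n : ℝ) - 1) := by
    rw [hP, ← Real.rpow_add hlam0]; congr 1; ring
  set H : 𝓢(Euc n, ℂ) := 𝓕⁻ (shellS n h hlam0) with hH
  have hHr : ∀ x y, ‖x‖ = ‖y‖ → H x = H y := fun x y hxy => by
    rw [hH, coe_fourierInv_shellS, coe_fourierInv_shellS]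
    exact fourierInv_shell_radial Θ lam hxy
  set G : Euc n → ℂ := 𝓕⁻ (shell (n := n) (fun v => ((4 * Real.pi ^ 2 * v : ℝ) : ℂ) * Θ v) lam)
    with hG
  have hGr : ∀ x y, ‖x‖ = ‖y‖ → G x = G y := fun x y hxy => fourierInv_shell_radial _ lam hxy
  have hGc : Continuous G := continuous_fourierInv (integrable_shell h1 hlam0)
  set k : ℝ → ℂ := fun s => H (s • b i₀)
  set k1 : ℝ → ℂ := fun s => (∂_{b i₀} H) (s • b i₀)
  set k2 : ℝ → ℂ := fun s => (∂_{b i₀} (∂_{b i₀} H)) (s • b i₀)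
  set g : ℝ → ℂ := fun s => (lam : ℂ) * G (s • b i₀)
  have hk1c : Continuous k1 := (SchwartzMap.continuous _).comp (by fun_prop)
  have hgc : Continuous g := continuous_const.mul (hGc.comp (by fun_prop))
  have hode : ∀ s, 0 < s → k2 s + (((n - 1 : ℕ) / s : ℝ) : ℂ) * k1 s +
      (((2 * Real.pi * lam) ^ 2 : ℝ) : ℂ) * k s = g s := by
    intro s hs
    have e1 := helmholtz_shell h hlam0 (s • b i₀)
    rw [← hH, laplacian_of_radial hHr i₀ hs] at e1
    exact e1
  have hD : ∀ R, ‖x‖ ≤ R → ∫ s in ‖x‖..R, s ^ (n - 1 + l) * (‖k1 s‖ * ‖g s‖) ≤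
      lam * ((C₁ * lam * P) * (C₂ * P) / w) := by
    intro R hR
    have e1 := work_le hn hHr hGr hGc i₀ l (by positivity) (by positivity)
      (hC₁ lam hlam0 hlam) (hC₂ lam hlam) (norm_pos_iff.2 hx) hR
    refine le_trans (le_of_eq ?_) (mul_le_mul_of_nonneg_left e1 hlam0.le)
    rw [← intervalIntegral.integral_const_mul]
    refine intervalIntegral.integral_congr fun s _ => ?_
    simp only [g, k1, norm_mul, Complex.norm_real, Real.norm_of_nonneg hlam0.le]
    ring
  have hlim : Filter.Tendsto (fun s => s ^ (n - 1 + l) * (‖k1 s‖ ^ 2 +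
      (2 * Real.pi * lam) ^ 2 * ‖k s‖ ^ 2)) Filter.atTop (nhds 0) := by
    have e1 := tendsto_pow_mul_sq_ray (∂_{b i₀} H) (n - 1 + l) (b.norm_eq_one i₀)
    have e2 := (tendsto_pow_mul_sq_ray H (n - 1 + l) (b.norm_eq_one i₀)).const_mul
      ((2 * Real.pi * lam) ^ 2)
    have := e1.add e2
    simp only [mul_zero, add_zero] at this
    refine this.congr fun s => ?_
    simp only [k1, k]
    ring
  have hfin := energy_le (by omega) (fun s _ => hasDerivAt_ray H (b i₀) s)
    (fun s _ => hasDerivAt_ray (∂_{b i₀} H) (b i₀) s) hgc hk1c hode (norm_pos_iff.2 hx) hD hlim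
  have hkx : k ‖x‖ = 𝓕⁻ (shell (n := n) Θ lam) x := by
    rw [← coe_fourierInv_shellS h hlam0]
    exact hHr _ _ (by rw [norm_smul, b.norm_eq_one, norm_norm, mul_one])
  rw [← hkx, ← hPP]
  have hx1 : 0 ≤ ‖x‖ ^ (n - 1 + l) * ‖k1 ‖x‖‖ ^ 2 := by positivity
  have hx2 : ‖x‖ ^ (n - 1 + l) * ‖k ‖x‖‖ ^ 2 * (2 * Real.pi * lam) ^ 2 ≤
      2 * (C₁ * C₂ / w) * (P * P) * lam ^ 2 := by
    calc _ ≤ 2 * (lam * ((C₁ * lam * P) * (C₂ * P) / w)) := by linarith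
      _ = _ := by ring
  have hpi1 : lam ^ 2 ≤ (2 * Real.pi * lam) ^ 2 := by
    have : (1 : ℝ) ≤ 2 * Real.pi := by linarith [Real.pi_gt_three]
    gcongr
    nlinarith
  have hx3 : ‖x‖ ^ (n - 1 + l) * ‖k ‖x‖‖ ^ 2 * lam ^ 2 ≤
      2 * (C₁ * C₂ / w) * (P * P) * lam ^ 2 :=
    (mul_le_mul_of_nonneg_left hpi1 (by positivity)).trans hx2
  exact le_of_mul_le_mul_right hx3 (by positivity)

/-- The pointwise kernel bound. Up to the factor `λ^{(n-1)/2}` the kernels are dominated by one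
integrable radial function that decreases in `|x|`. -/
theorem exists_kernel_bound (n : ℕ) (hn : 1 ≤ n) (h : IsBump Θ) :
    ∃ C : ℝ, 0 < C ∧ ∀ lam : ℝ, 1 ≤ lam → ∀ x : Euc n, x ≠ 0 →
      ‖𝓕⁻ (shell (n := n) Θ lam) x‖ ≤
        C * lam ^ (((n : ℝ) - 1) / 2) * (‖x‖ ^ (n - 1) * (1 + ‖x‖ ^ 2))⁻¹ := by
  -- the first exponent governs `|x| ≤ 1`, the second gives the additional decay at infinity
  obtain ⟨C₁, hC₁0, hC₁⟩ := exists_ray_decay n hn h (n - 1) le_rfl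
  obtain ⟨C₂, hC₂0, hC₂⟩ := exists_ray_decay n hn h (n - 1 + 4) (by omega)
  refine ⟨√(2 * (C₁ + C₂)), by positivity, fun lam hlam x hx => ?_⟩
  have hlam0 : 0 < lam := by linarith
  have hx0 : 0 < ‖x‖ := norm_pos_iff.2 hx
  have e1 := hC₁ lam hlam x hx
  have e2 := hC₂ lam hlam x hx
  set K := ‖𝓕⁻ (shell (n := n) Θ lam) x‖ with hK
  have hK0 : 0 ≤ K := norm_nonneg _
  rw [← div_eq_mul_inv, le_div_iff₀ (by positivity)]
  refine le_of_sq_le_sq ?_ (by positivity)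
  have e3 : (lam ^ (((n : ℝ) - 1) / 2)) ^ 2 = lam ^ ((n : ℝ) - 1) := by
    rw [sq, ← Real.rpow_add hlam0]; congr 1; ring
  rw [mul_pow _ (lam ^ _), e3, Real.sq_sqrt (by positivity)]
  have e4 : (1 + ‖x‖ ^ 2) ^ 2 ≤ 2 * (1 + ‖x‖ ^ 4) := by nlinarith [sq_nonneg (‖x‖ ^ 2 - 1)]
  calc (K * (‖x‖ ^ (n - 1) * (1 + ‖x‖ ^ 2))) ^ 2
      = (‖x‖ ^ (n - 1 + (n - 1)) * K ^ 2) * (1 + ‖x‖ ^ 2) ^ 2 := by ring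
    _ ≤ (‖x‖ ^ (n - 1 + (n - 1)) * K ^ 2) * (2 * (1 + ‖x‖ ^ 4)) := by gcongr
    _ = 2 * (‖x‖ ^ (n - 1 + (n - 1)) * K ^ 2 + ‖x‖ ^ (n - 1 + (n - 1 + 4)) * K ^ 2) := by ring
    _ ≤ 2 * (C₁ * lam ^ ((n : ℝ) - 1) + C₂ * lam ^ ((n : ℝ) - 1)) := by gcongr
    _ = _ := by ring

end radial

end KernelDecay

/-! ### The Hardy-Littlewood maximal function -/

/-- The centred Hardy-Littlewood maximal function. -/
def maxFn {n : ℕ} (u : Euc n → ℂ) (x : Euc n) : ℝ≥0∞ :=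
  ⨆ (r : ℝ) (_ : 0 < r),
    (volume (Metric.closedBall x r))⁻¹ * ∫⁻ y in Metric.closedBall x r, ‖u y‖ₑ

theorem setLIntegral_closedBall_le_maxFn {n : ℕ} (u : Euc n → ℂ) (x : Euc n) {r : ℝ}
    (hr : 0 < r) :
    ∫⁻ y in Metric.closedBall x r, ‖u y‖ₑ ≤ volume (Metric.closedBall x r) * maxFn u x := by
  have h0 : volume (Metric.closedBall x r) ≠ 0 := (Metric.measure_closedBall_pos _ _ hr).ne'
  have h1 : volume (Metric.closedBall x r) ≠ ∞ := measure_closedBall_lt_top.ne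
  calc _ = volume (Metric.closedBall x r) *
        ((volume (Metric.closedBall x r))⁻¹ * ∫⁻ y in Metric.closedBall x r, ‖u y‖ₑ) := by
        rw [← mul_assoc, ENNReal.mul_inv_cancel h0 h1, one_mul]
    _ ≤ _ := by
        gcongr
        exact le_iSup₂ (f := fun (r : ℝ) (_ : 0 < r) => (volume (Metric.closedBall x r))⁻¹ *
          ∫⁻ y in Metric.closedBall x r, ‖u y‖ₑ) r hr

theorem maxFn_mono {n : ℕ} {u v : Euc n → ℂ} (h : ∀ y, ‖u y‖ₑ ≤ ‖v y‖ₑ) (x : Euc n) :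
    maxFn u x ≤ maxFn v x := by
  unfold maxFn
  gcongr with r hr y
  exact h y

theorem maxFn_add_le {n : ℕ} {u v w : Euc n → ℂ} (hv : AEStronglyMeasurable v volume)
    (h : ∀ y, ‖u y‖ₑ ≤ ‖v y‖ₑ + ‖w y‖ₑ) (x : Euc n) :
    maxFn u x ≤ maxFn v x + maxFn w x := by
  refine iSup₂_le fun r hr => ?_
  calc _ ≤ (volume (Metric.closedBall x r))⁻¹ *
        ∫⁻ y in Metric.closedBall x r, (‖v y‖ₑ + ‖w y‖ₑ) := by gcongr with y; exact h y
    _ = (volume (Metric.closedBall x r))⁻¹ * (∫⁻ y in Metric.closedBall x r, ‖v y‖ₑ) +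
        (volume (Metric.closedBall x r))⁻¹ * ∫⁻ y in Metric.closedBall x r, ‖w y‖ₑ := by
        rw [lintegral_add_left' hv.enorm.restrict, mul_add]
    _ ≤ _ := add_le_add
        (le_iSup₂ (f := fun (r : ℝ) (_ : 0 < r) => (volume (Metric.closedBall x r))⁻¹ *
          ∫⁻ y in Metric.closedBall x r, ‖v y‖ₑ) r hr)
        (le_iSup₂ (f := fun (r : ℝ) (_ : 0 < r) => (volume (Metric.closedBall x r))⁻¹ *
          ∫⁻ y in Metric.closedBall x r, ‖w y‖ₑ) r hr)

theorem maxFn_le_of_bound {n : ℕ} {u : Euc n → ℂ} {c : ℝ≥0∞} (h : ∀ y, ‖u y‖ₑ ≤ c) (x : Euc n) :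
    maxFn u x ≤ c := by
  refine iSup₂_le fun r hr => ?_
  have h0 : volume (Metric.closedBall x r) ≠ 0 := (Metric.measure_closedBall_pos _ _ hr).ne'
  have h1 : volume (Metric.closedBall x r) ≠ ∞ := measure_closedBall_lt_top.ne
  calc _ ≤ (volume (Metric.closedBall x r))⁻¹ * ∫⁻ y in Metric.closedBall x r, c := by
        gcongr with y; exact h y
    _ = c := by
        rw [setLIntegral_const, mul_comm c, ← mul_assoc, ENNReal.inv_mul_cancel h0 h1, one_mul]

/-- The weak type `(1,1)` inequality, by the Vitali covering lemma. -/
theorem maxFn_weak {n : ℕ} (hn : 1 ≤ n) (u : Euc n → ℂ) {l : ℝ} (hl : 0 < l) :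
    volume {x | ENNReal.ofReal l < maxFn u x} ≤
      ENNReal.ofReal (5 ^ n / l) * ∫⁻ y, ‖u y‖ₑ := by
  have hne : Nonempty (Fin n) := ⟨⟨0, hn⟩⟩
  rcases eq_or_ne (∫⁻ y, ‖u y‖ₑ) ∞ with hI | hI
  · rw [hI, ENNReal.mul_top (by positivity)]
    exact le_top
  set I := ∫⁻ y, ‖u y‖ₑ with hIdef
  set S := {x | ENNReal.ofReal l < maxFn u x} with hS
  set w := volume (Metric.ball (0 : Euc n) 1) with hw
  have hw0 : w ≠ 0 := (Metric.measure_ball_pos _ _ one_pos).ne'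
  have hw1 : w ≠ ∞ := measure_ball_lt_top.ne
  have hvol : ∀ (x : Euc n) (r : ℝ), 0 ≤ r →
      volume (Metric.closedBall x r) = ENNReal.ofReal (r ^ n) * w := by
    intro x r hr
    rw [Measure.addHaar_closedBall _ _ hr]
    simp [hw]
  have hex : ∀ x : S, ∃ r : ℝ, 0 < r ∧ ENNReal.ofReal l * volume (Metric.closedBall (x : Euc n) r) ≤
      ∫⁻ y in Metric.closedBall (x : Euc n) r, ‖u y‖ₑ := by
    rintro ⟨x, hx⟩
    obtain ⟨r, hr⟩ := lt_iSup_iff.1 (show ENNReal.ofReal l < maxFn u x from hx)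
    obtain ⟨hr0, hr⟩ := lt_iSup_iff.1 hr
    refine ⟨r, hr0, ?_⟩
    rw [mul_comm _ (lintegral _ _), ← div_eq_mul_inv] at hr
    exact (ENNReal.le_div_iff_mul_le (Or.inl (Metric.measure_closedBall_pos _ _ hr0).ne')
      (Or.inl measure_closedBall_lt_top.ne)).1 hr.le
  choose r hr0 hr using hex
  -- the radii are bounded since `l * volume (closedBall x r) ≤ ‖u‖₁`, as Vitali's lemma requires
  have hbound : ∀ x : S, r x ≤ 1 + (I / (ENNReal.ofReal l * w)).toReal := by
    intro x
    have h1 : ENNReal.ofReal (r x ^ n) ≤ I / (ENNReal.ofReal l * w) := by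
      rw [ENNReal.le_div_iff_mul_le (Or.inl (mul_ne_zero (by simpa using hl) hw0))
        (Or.inl (ENNReal.mul_ne_top ENNReal.ofReal_ne_top hw1))]
      have := (hr x).trans (setLIntegral_le_lintegral _ _)
      rw [hvol _ _ (hr0 x).le] at this
      calc _ = _ := by ring
        _ ≤ _ := this
    have h2 : I / (ENNReal.ofReal l * w) ≠ ∞ :=
      ENNReal.div_ne_top hI (mul_ne_zero (by simpa using hl) hw0)
    have h3 := ENNReal.toReal_mono h2 h1
    rw [ENNReal.toReal_ofReal (by have := hr0 x; positivity)] at h3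
    rcases le_total (r x) 1 with h4 | h4
    · have : 0 ≤ (I / (ENNReal.ofReal l * w)).toReal := ENNReal.toReal_nonneg
      linarith
    · have : r x ≤ r x ^ n := le_self_pow₀ h4 (by omega)
      linarith
  obtain ⟨T, -, hTd, hTc⟩ := Vitali.exists_disjoint_subfamily_covering_enlargement_closedBall
    (Set.univ : Set S) (fun x => (x : Euc n)) r _ (fun x _ => hbound x) 5 (by norm_num)
  have hTcount : T.Countable := hTd.countable_of_nonempty_interior fun x _ => by
    refine ⟨(x : Euc n), ?_⟩
    exact Metric.ball_subset_interior_closedBall (Metric.mem_ball_self (hr0 x))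
  have hcov : S ⊆ ⋃ b ∈ T, Metric.closedBall (b : Euc n) (5 * r b) := by
    intro x hx
    obtain ⟨b, hb, hsub⟩ := hTc ⟨x, hx⟩ (Set.mem_univ _)
    exact Set.mem_biUnion hb (hsub (Metric.mem_closedBall_self (hr0 _).le))
  have : Countable T := hTcount.to_subtype
  calc volume S ≤ ∑' b : T, volume (Metric.closedBall (b : Euc n) (5 * r b)) :=
        (measure_mono hcov).trans (measure_biUnion_le _ hTcount _)
    _ ≤ ∑' b : T, ENNReal.ofReal (5 ^ n / l) *
          ∫⁻ y in Metric.closedBall (b : Euc n) (r b), ‖u y‖ₑ := by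
        refine ENNReal.tsum_le_tsum fun b => ?_
        have hb := hr0 b
        rw [hvol _ _ (by positivity)]
        have h1 := hr b
        rw [hvol _ _ hb.le] at h1
        calc ENNReal.ofReal ((5 * r b) ^ n) * w
            = ENNReal.ofReal (5 ^ n / l) * (ENNReal.ofReal l * (ENNReal.ofReal (r b ^ n) * w)) := by
              rw [← mul_assoc, ← mul_assoc, ← ENNReal.ofReal_mul (by positivity),
                ← ENNReal.ofReal_mul (by positivity), mul_pow]
              congr 2
              field_simp
          _ ≤ _ := by gcongr
    _ = ENNReal.ofReal (5 ^ n / l) *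
          ∫⁻ y in ⋃ b ∈ T, Metric.closedBall (b : Euc n) (r b), ‖u y‖ₑ := by
        rw [ENNReal.tsum_mul_left, lintegral_biUnion hTcount
          (fun b _ => Metric.isClosed_closedBall.measurableSet) hTd]
    _ ≤ _ := by
        exact mul_le_mul_right (setLIntegral_le_lintegral _ _) _

/-- The distributional inequality behind the `L^p` bounds of the maximal function: only the part
of `f` above half the level contributes. -/
theorem maxFn_weak_truncated {n : ℕ} (hn : 1 ≤ n) {f : Euc n → ℂ}
    (hf : AEStronglyMeasurable f volume) {l : ℝ} (hl : 0 < l) :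
    volume {x | ENNReal.ofReal l < maxFn f x} ≤
      ENNReal.ofReal (2 * 5 ^ n / l) * ∫⁻ y in {y | l / 2 < ‖f y‖}, ‖f y‖ₑ := by
  have hs : NullMeasurableSet {y | l / 2 < ‖f y‖} volume :=
    nullMeasurableSet_lt aemeasurable_const hf.norm.aemeasurable
  set v := {y | l / 2 < ‖f y‖}.indicator f with hv
  have h1 : ∀ x, maxFn f x ≤ maxFn v x + ENNReal.ofReal (l / 2) := by
    intro x
    refine (maxFn_add_le (w := {y | l / 2 < ‖f y‖}ᶜ.indicator f) (hf.indicator₀ hs)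
      (fun y => ?_) x).trans (add_le_add le_rfl (maxFn_le_of_bound (fun y => ?_) x))
    · by_cases hy : l / 2 < ‖f y‖ <;> simp [Set.indicator, hy]
    · by_cases hy : l / 2 < ‖f y‖
      · simp [Set.indicator, hy]
      · simp only [Set.indicator, Set.mem_compl_iff, Set.mem_ofPred_eq, hy, not_false_eq_true,
          if_true]
        rw [← ofReal_norm]
        exact ENNReal.ofReal_le_ofReal (not_lt.1 hy)
  calc _ ≤ volume {x | ENNReal.ofReal (l / 2) < maxFn v x} := by
        refine measure_mono fun x hx => ?_
        have h2 : ENNReal.ofReal (l / 2) + ENNReal.ofReal (l / 2) < maxFn v x +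
            ENNReal.ofReal (l / 2) := by
          rw [← ENNReal.ofReal_add (by positivity) (by positivity), add_halves]
          exact lt_of_lt_of_le hx (h1 x)
        exact lt_of_add_lt_add_right h2
    _ ≤ ENNReal.ofReal (5 ^ n / (l / 2)) * ∫⁻ y, ‖v y‖ₑ := maxFn_weak hn v (by positivity)
    _ = _ := by
        rw [hv, ← lintegral_indicator₀ hs]
        congr 2
        · field_simp
        · ext y
          by_cases hy : l / 2 < ‖f y‖ <;> simp [Set.indicator, hy]

/-- The radial majorant at `ρ` is bounded by a superposition of indicators of `[0, r)`, `r > ρ`. -/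
theorem kernel_majorant_le {n : ℕ} (hn : 1 ≤ n) {ρ : ℝ} (hρ : 0 < ρ) :
    ENNReal.ofReal ((ρ ^ (n - 1) * (1 + ρ ^ 2))⁻¹) ≤
      ENNReal.ofReal (2 ^ (n + 2)) *
        ∫⁻ r in Set.Ioi ρ, ENNReal.ofReal ((r ^ n)⁻¹ * (1 + r ^ 2)⁻¹) := by
  have h1 : ENNReal.ofReal (((2 * ρ) ^ n)⁻¹ * (1 + (2 * ρ) ^ 2)⁻¹) * ENNReal.ofReal ρ ≤
      ∫⁻ r in Set.Ioi ρ, ENNReal.ofReal ((r ^ n)⁻¹ * (1 + r ^ 2)⁻¹) := by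
    calc _ = ∫⁻ r in Set.Ioc ρ (2 * ρ),
          ENNReal.ofReal (((2 * ρ) ^ n)⁻¹ * (1 + (2 * ρ) ^ 2)⁻¹) := by
          rw [setLIntegral_const, Real.volume_Ioc]
          congr 2; ring
      _ ≤ ∫⁻ r in Set.Ioc ρ (2 * ρ), ENNReal.ofReal ((r ^ n)⁻¹ * (1 + r ^ 2)⁻¹) := by
          refine setLIntegral_mono' measurableSet_Ioc fun r hr => ENNReal.ofReal_le_ofReal ?_
          have hr0 : 0 < r := hρ.trans hr.1
          have := hr.2
          gcongr
      _ ≤ _ := lintegral_mono_set Set.Ioc_subset_Ioi_self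
  refine le_trans ?_ (mul_le_mul_right h1 _)
  rw [← ENNReal.ofReal_mul (by positivity), ← ENNReal.ofReal_mul (by positivity)]
  apply ENNReal.ofReal_le_ofReal
  obtain ⟨m, rfl⟩ : ∃ m, n = m + 1 := ⟨n - 1, by omega⟩
  simp only [Nat.add_sub_cancel]
  have e1 : (2 : ℝ) ^ (m + 1 + 2) * (((2 * ρ) ^ (m + 1))⁻¹ * (1 + (2 * ρ) ^ 2)⁻¹ * ρ) =
      4 * (ρ ^ m * (1 + 4 * ρ ^ 2))⁻¹ := by
    rw [mul_pow, mul_pow, pow_add, pow_succ ρ]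
    field_simp
    ring
  rw [e1, ← div_eq_mul_inv, inv_eq_one_div, div_le_div_iff₀ (by positivity) (by positivity)]
  have : 0 < ρ ^ m := by positivity
  nlinarith

/-- Convolution with the dilates of the radially decreasing majorant is controlled by the maximal
function: the majorant is a superposition of normalised indicators of balls of finite total
mass. -/
theorem exists_lintegral_majorant_le_maxFn (n : ℕ) (hn : 1 ≤ n) :
    ∃ C : ℝ, 0 < C ∧ ∀ (u : Euc n → ℂ), AEStronglyMeasurable u volume → ∀ t : ℝ, 0 < t →
      ∀ x : Euc n, ∫⁻ y, ENNReal.ofReal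
        (t ^ n * (‖t • (x - y)‖ ^ (n - 1) * (1 + ‖t • (x - y)‖ ^ 2))⁻¹) * ‖u y‖ₑ ≤
        ENNReal.ofReal C * maxFn u x := by
  have hne : Nonempty (Fin n) := ⟨⟨0, hn⟩⟩
  set w := volume (Metric.ball (0 : Euc n) 1) with hw
  have hw0 : w ≠ 0 := (Metric.measure_ball_pos _ _ one_pos).ne'
  have hw1 : w ≠ ∞ := measure_ball_lt_top.ne
  refine ⟨2 ^ (n + 2) * (Real.pi / 2 * w.toReal), by
    have := ENNReal.toReal_pos hw0 hw1; positivity, fun u hu t ht x => ?_⟩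
  set q : ℝ → ℝ≥0∞ := fun r => ENNReal.ofReal ((r ^ n)⁻¹ * (1 + r ^ 2)⁻¹) with hq
  have hqm : Measurable q := by fun_prop
  have hpt : ∀ᵐ y ∂(volume : Measure (Euc n)), ENNReal.ofReal
        (t ^ n * (‖t • (x - y)‖ ^ (n - 1) * (1 + ‖t • (x - y)‖ ^ 2))⁻¹) * ‖u y‖ₑ ≤
      ENNReal.ofReal (2 ^ (n + 2)) * ∫⁻ r in Set.Ioi (0 : ℝ), ENNReal.ofReal (t ^ n) * q r *
        (Metric.closedBall x (r / t)).indicator (fun y => ‖u y‖ₑ) y := by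
    filter_upwards [Measure.ae_ne volume x] with y hy
    have hpos : 0 < ‖t • (x - y)‖ :=
      norm_pos_iff.2 (smul_ne_zero ht.ne' (sub_ne_zero.2 hy.symm))
    rw [ENNReal.ofReal_mul (by positivity)]
    calc _ ≤ ENNReal.ofReal (t ^ n) * (ENNReal.ofReal (2 ^ (n + 2)) *
            ∫⁻ r in Set.Ioi ‖t • (x - y)‖, q r) * ‖u y‖ₑ := by
          gcongr; exact kernel_majorant_le hn hpos
      _ = ENNReal.ofReal (2 ^ (n + 2)) * ∫⁻ r in Set.Ioi ‖t • (x - y)‖,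
            ENNReal.ofReal (t ^ n) * q r * ‖u y‖ₑ := by
          rw [lintegral_mul_const _ (hqm.const_mul _), lintegral_const_mul _ hqm]
          ring
      _ ≤ ENNReal.ofReal (2 ^ (n + 2)) * ∫⁻ r in Set.Ioi ‖t • (x - y)‖,
            ENNReal.ofReal (t ^ n) * q r *
              (Metric.closedBall x (r / t)).indicator (fun y => ‖u y‖ₑ) y := by
          refine mul_le_mul_right ?_ _
          refine setLIntegral_mono' measurableSet_Ioi fun r hr => ?_
          rw [Set.indicator_of_mem]
          rw [Metric.mem_closedBall, dist_comm, dist_eq_norm, le_div_iff₀ ht]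
          have : ‖t • (x - y)‖ < r := hr
          rw [norm_smul, Real.norm_of_nonneg ht.le] at this
          linarith
      _ ≤ _ := by
          refine mul_le_mul_right ?_ _
          exact lintegral_mono_set (Set.Ioi_subset_Ioi hpos.le)
  have hmeas : AEMeasurable (Function.uncurry fun (y : Euc n) (r : ℝ) =>
      ENNReal.ofReal (t ^ n) * q r *
        (Metric.closedBall x (r / t)).indicator (fun y => ‖u y‖ₑ) y)
      ((volume : Measure (Euc n)).prod ((volume : Measure ℝ).restrict (Set.Ioi 0))) := by
    have h1 : (Function.uncurry fun (y : Euc n) (r : ℝ) => ENNReal.ofReal (t ^ n) * q r *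
        (Metric.closedBall x (r / t)).indicator (fun y => ‖u y‖ₑ) y) =
        fun z : Euc n × ℝ => ENNReal.ofReal (t ^ n) * q z.2 *
          {z : Euc n × ℝ | dist z.1 x ≤ z.2 / t}.indicator (fun z => ‖u z.1‖ₑ) z := by
      ext ⟨y, r⟩
      simp [Function.uncurry, Set.indicator]
    rw [h1]
    refine AEMeasurable.mul (by fun_prop) (AEMeasurable.indicator ?_ ?_)
    · exact hu.enorm.comp_quasiMeasurePreserving Measure.quasiMeasurePreserving_fst
    · exact measurableSet_le (by fun_prop) (by fun_prop)
  calc _ ≤ ∫⁻ y, ENNReal.ofReal (2 ^ (n + 2)) * ∫⁻ r in Set.Ioi (0 : ℝ),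
          ENNReal.ofReal (t ^ n) * q r *
          (Metric.closedBall x (r / t)).indicator (fun y => ‖u y‖ₑ) y := lintegral_mono_ae hpt
    _ = ENNReal.ofReal (2 ^ (n + 2)) * ∫⁻ r in Set.Ioi (0 : ℝ), ∫⁻ y,
          ENNReal.ofReal (t ^ n) * q r *
          (Metric.closedBall x (r / t)).indicator (fun y => ‖u y‖ₑ) y := by
        rw [lintegral_const_mul' _ _ ENNReal.ofReal_ne_top, lintegral_lintegral_swap hmeas]
    _ ≤ ENNReal.ofReal (2 ^ (n + 2)) * ∫⁻ r in Set.Ioi (0 : ℝ),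
          ENNReal.ofReal ((1 + r ^ 2)⁻¹) * (w * maxFn u x) := by
        refine mul_le_mul_right ?_ _
        refine setLIntegral_mono' measurableSet_Ioi fun r (hr : 0 < r) => ?_
        rw [lintegral_const_mul' _ _ (ENNReal.mul_ne_top ENNReal.ofReal_ne_top
          ENNReal.ofReal_ne_top), lintegral_indicator Metric.isClosed_closedBall.measurableSet]
        refine (mul_le_mul_right (setLIntegral_closedBall_le_maxFn u x (div_pos hr ht)) _).trans ?_
        rw [Measure.addHaar_closedBall _ _ (div_pos hr ht).le, finrank_euclideanSpace,
          Fintype.card_fin, ← mul_assoc, ← mul_assoc, ← mul_assoc]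
        refine le_of_eq ?_
        rw [← ENNReal.ofReal_mul (by positivity), ← ENNReal.ofReal_mul (by positivity)]
        congr 3
        field_simp
        rw [← mul_pow, mul_div_cancel₀ _ ht.ne']
    _ = _ := by
        rw [lintegral_mul_const _ (by fun_prop), ← ofReal_integral_eq_lintegral_ofReal
          integrable_inv_one_add_sq.integrableOn (ae_of_all _ fun r => by positivity),
          integral_Ioi_inv_one_add_sq, Real.arctan_zero, sub_zero,
          ENNReal.ofReal_mul (by positivity), ENNReal.ofReal_mul (by positivity),
          ENNReal.ofReal_toReal hw1]
        ring

/-! ### Domination by the maximal function -/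

section Domination

open scoped ContDiff RealInnerProductSpace

/-- The multiplier `Θ(λ (1 - |ξ/t|²))`. -/
def dil {n : ℕ} (Θ : ℝ → ℂ) (lam t : ℝ) (ξ : Euc n) : ℂ := Θ (lam * (1 - ‖t⁻¹ • ξ‖ ^ 2))

section dil

variable {n : ℕ} {Θ : ℝ → ℂ} {lam t : ℝ}

theorem dil_eq_shell (hl : 0 < lam) (ht : 0 < t) (ξ : Euc n) :
    dil Θ lam t ξ = shell Θ lam ((lam / t) • ξ) := by
  rw [dil, shell]
  congr 1
  rw [norm_smul, norm_smul, Real.norm_of_nonneg (by positivity),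
    Real.norm_of_nonneg (by positivity)]
  field_simp

theorem dil_eq_zero (h : IsBump Θ) (hl : 0 < lam) (ht : 0 < t) {ξ : Euc n} (hξ : t < ‖ξ‖) :
    dil Θ lam t ξ = 0 := by
  apply h.eq_zero
  have h1 : 1 < ‖t⁻¹ • ξ‖ := by
    rw [norm_smul, norm_inv, Real.norm_of_nonneg ht.le, ← div_eq_inv_mul, one_lt_div ht]
    exact hξ
  have h2 : 1 < ‖t⁻¹ • ξ‖ ^ 2 := one_lt_pow₀ h1 two_ne_zero
  intro hh
  have := hh.1
  nlinarith

theorem continuous_dil (h : IsBump Θ) : Continuous (dil (n := n) Θ lam t) :=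
  h.continuous.comp (by fun_prop)

theorem hasCompactSupport_dil (h : IsBump Θ) (hl : 0 < lam) (ht : 0 < t) :
    HasCompactSupport (dil (n := n) Θ lam t) :=
  HasCompactSupport.intro (isCompact_closedBall (0 : Euc n) t) fun ξ hξ =>
    dil_eq_zero h hl ht (by simpa using hξ)

theorem integrable_dil (h : IsBump Θ) (hl : 0 < lam) (ht : 0 < t) :
    Integrable (dil (n := n) Θ lam t) :=
  (continuous_dil h).integrable_of_hasCompactSupport (hasCompactSupport_dil h hl ht)

theorem memLp_dil (h : IsBump Θ) (hl : 0 < lam) (ht : 0 < t) :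
    MemLp (dil (n := n) Θ lam t) 2 volume :=
  (continuous_dil h).memLp_of_hasCompactSupport (hasCompactSupport_dil h hl ht)

theorem fourierInv_dil (hl : 0 < lam) (ht : 0 < t) (x : Euc n) :
    𝓕⁻ (dil (n := n) Θ lam t) x =
      (((t / lam) ^ n : ℝ) : ℂ) * 𝓕⁻ (shell (n := n) Θ lam) ((t / lam) • x) := by
  have h1 := Measure.integral_comp_smul_of_nonneg (volume : Measure (Euc n))
    (fun v : Euc n => Complex.exp (((2 * Real.pi * ⟪v, (t / lam) • x⟫ : ℝ) : ℂ) * Complex.I) •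
      shell Θ lam v) (lam / t) (hR := by positivity)
  rw [Real.fourierInv_eq', Real.fourierInv_eq']
  have h2 : ((lam / t) ^ n)⁻¹ = (t / lam) ^ n := by
    rw [← inv_pow, inv_div]
  rw [finrank_euclideanSpace, Fintype.card_fin, h2, Complex.real_smul] at h1
  rw [← h1]
  refine integral_congr_ae (ae_of_all _ fun v => ?_)
  simp only
  rw [dil_eq_shell hl ht, inner_smul_left, inner_smul_right]
  congr 4
  simp only [conj_trivial]
  field_simp

/-- A multiplier in `L¹` acts on `L¹` by convolution with its inverse Fourier transform. -/
theorem fourierInv_mul_fourier {m u : Euc n → ℂ} (hm : Integrable m) (hu : Integrable u)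
    (x : Euc n) :
    𝓕⁻ (fun ξ => m ξ * 𝓕 u ξ) x = ∫ y, 𝓕⁻ m (x - y) * u y := by
  set g : Euc n → ℂ := fun ξ => ((Real.fourierChar ⟪ξ, x⟫ : Circle) : ℂ) * m ξ with hg
  have hgi : Integrable g := by
    refine hm.bdd_mul (c := 1) ?_ (ae_of_all _ fun ξ => by rw [Circle.norm_coe])
    exact (continuous_subtype_val.comp (Real.continuous_fourierChar.comp
      (by fun_prop))).aestronglyMeasurable
  have h1 := VectorFourier.integral_fourierIntegral_smul_eq_flip (μ := (volume : Measure (Euc n)))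
    (ν := (volume : Measure (Euc n))) (L := innerₗ (Euc n))
    Real.continuous_fourierChar (by exact continuous_inner) hu hgi
  rw [flip_innerₗ] at h1
  have h2 : ∀ y, 𝓕 g y = 𝓕⁻ m (x - y) := by
    intro y
    rw [Real.fourier_eq, Real.fourierInv_eq]
    refine integral_congr_ae (ae_of_all _ fun ξ => ?_)
    have : ⟪ξ, x - y⟫ = -⟪ξ, y⟫ + ⟪ξ, x⟫ := by rw [inner_sub_right]; ring
    simp only [hg, Circle.smul_def, smul_eq_mul, this, AddChar.map_add_eq_mul, Circle.coe_mul]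
    ring
  rw [Real.fourierInv_eq]
  calc _ = ∫ ξ, 𝓕 u ξ • g ξ := by
        refine integral_congr_ae (ae_of_all _ fun ξ => ?_)
        simp only [hg, Circle.smul_def, smul_eq_mul]
        ring
    _ = ∫ y, u y • 𝓕 g y := h1
    _ = _ := by
        refine integral_congr_ae (ae_of_all _ fun y => ?_)
        simp only [h2, smul_eq_mul]
        ring

/-- The `L¹` endpoint: on integrable functions the maximal operator is dominated pointwise by
`λ^{(n-1)/2}` times the Hardy-Littlewood maximal function. -/
theorem exists_dil_fourier_le_maxFn (n : ℕ) (hn : 1 ≤ n) (h : IsBump Θ) :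
    ∃ C : ℝ, 0 < C ∧ ∀ lam : ℝ, 1 ≤ lam → ∀ u : Euc n → ℂ, Integrable u → ∀ t : ℝ, 0 < t →
      ∀ x, ‖𝓕⁻ (fun ξ => dil (n := n) Θ lam t ξ * 𝓕 u ξ) x‖ₑ ≤
        ENNReal.ofReal (C * lam ^ (((n : ℝ) - 1) / 2)) * maxFn u x := by
  have hne : Nonempty (Fin n) := ⟨⟨0, hn⟩⟩
  obtain ⟨C₁, hC₁0, hC₁⟩ := exists_kernel_bound n hn h
  obtain ⟨C₂, hC₂0, hC₂⟩ := exists_lintegral_majorant_le_maxFn n hn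
  refine ⟨C₁ * C₂, by positivity, fun lam hlam u hu t ht x => ?_⟩
  have hl : 0 < lam := by linarith
  rw [fourierInv_mul_fourier (integrable_dil h hl ht) hu]
  have hs : 0 < t / lam := by positivity
  calc _ ≤ ∫⁻ y, ‖𝓕⁻ (dil (n := n) Θ lam t) (x - y) * u y‖ₑ := enorm_integral_le_lintegral_enorm _
    _ ≤ ∫⁻ y, ENNReal.ofReal (C₁ * lam ^ (((n : ℝ) - 1) / 2)) *
        (ENNReal.ofReal ((t / lam) ^ n * (‖(t / lam) • (x - y)‖ ^ (n - 1) *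
          (1 + ‖(t / lam) • (x - y)‖ ^ 2))⁻¹) * ‖u y‖ₑ) := by
        refine lintegral_mono_ae ?_
        filter_upwards [Measure.ae_ne volume x] with y hy
        rw [enorm_mul, ← mul_assoc, ← ENNReal.ofReal_mul (by positivity)]
        refine mul_le_mul_left ?_ _
        rw [← ofReal_norm]
        apply ENNReal.ofReal_le_ofReal
        rw [fourierInv_dil hl ht, norm_mul, Complex.norm_real, Real.norm_of_nonneg (by positivity)]
        calc _ ≤ (t / lam) ^ n * (C₁ * lam ^ (((n : ℝ) - 1) / 2) *
              (‖(t / lam) • (x - y)‖ ^ (n - 1) * (1 + ‖(t / lam) • (x - y)‖ ^ 2))⁻¹) := by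
              refine mul_le_mul_of_nonneg_left ?_ (by positivity)
              exact hC₁ lam hlam _ (smul_ne_zero hs.ne' (sub_ne_zero.2 hy.symm))
          _ = _ := by ring
    _ ≤ ENNReal.ofReal (C₁ * lam ^ (((n : ℝ) - 1) / 2)) * (ENNReal.ofReal C₂ * maxFn u x) := by
        rw [lintegral_const_mul' _ _ ENNReal.ofReal_ne_top]
        exact mul_le_mul_right (hC₂ u hu.1 _ hs x) _
    _ = _ := by
        rw [← mul_assoc, ← ENNReal.ofReal_mul (by positivity)]
        congr 2; ring

theorem enorm_fourierInv_mul_le {m F : Euc n → ℂ} (hm : MemLp m 2 volume) (hF : MemLp F 2 volume)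
    (x : Euc n) :
    ‖𝓕⁻ (fun ξ => m ξ * F ξ) x‖ₑ ≤ eLpNorm m 2 volume * eLpNorm F 2 volume := by
  rw [Real.fourierInv_eq]
  calc _ ≤ ∫⁻ ξ, ‖Real.fourierChar ⟪ξ, x⟫ • (m ξ * F ξ)‖ₑ := enorm_integral_le_lintegral_enorm _
    _ = eLpNorm (m • F) 1 volume := by
        rw [eLpNorm_one_eq_lintegral_enorm]
        refine lintegral_congr fun ξ => ?_
        rw [Circle.smul_def, enorm_smul, ← ofReal_norm, Circle.norm_coe]
        simp
    _ ≤ _ := eLpNorm_smul_le_mul_eLpNorm hF.1 hm.1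

theorem tendsto_eLpNorm_sub_indicator_ball {v : Euc n → ℂ} (hv : MemLp v 2 volume) :
    Filter.Tendsto (fun k : ℕ => eLpNorm (v - (Metric.ball 0 k).indicator v) 2 volume)
      Filter.atTop (nhds 0) := by
  have h1 : ∀ k : ℕ, eLpNorm (v - (Metric.ball 0 k).indicator v) 2 volume =
      (∫⁻ x, ‖(v - (Metric.ball 0 k).indicator v) x‖ₑ ^ (2 : ℝ)) ^ (1 / 2 : ℝ) := by
    intro k
    rw [eLpNorm_eq_lintegral_rpow_enorm_toReal (by norm_num) (by norm_num)]
    simp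
  simp only [h1]
  have h2 : Filter.Tendsto (fun k : ℕ => ∫⁻ x, ‖(v - (Metric.ball 0 k).indicator v) x‖ₑ ^ (2 : ℝ))
      Filter.atTop (nhds (∫⁻ _ : Euc n, 0)) := by
    refine tendsto_lintegral_of_dominated_convergence' (fun x => ‖v x‖ₑ ^ (2 : ℝ)) (fun k => ?_)
      (fun k => ae_of_all _ fun x => ?_) ?_ (ae_of_all _ fun x => ?_)
    · exact ((hv.1.sub (hv.1.indicator measurableSet_ball)).enorm).pow_const _
    · refine ENNReal.rpow_le_rpow ?_ (by norm_num)
      by_cases hx : x ∈ Metric.ball (0 : Euc n) k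
      · simp [Set.indicator, hx]
      · simp only [Pi.sub_apply, Set.indicator_of_notMem hx, sub_zero, le_refl]
    · have := lintegral_rpow_enorm_lt_top_of_eLpNorm_lt_top (by norm_num) (by norm_num) hv.2
      simpa using this.ne
    · obtain ⟨K, hK⟩ := exists_nat_gt ‖x‖
      refine tendsto_const_nhds.congr' (Filter.eventually_atTop.2 ⟨K, fun k hk => ?_⟩)
      have hx : x ∈ Metric.ball (0 : Euc n) k := by
        rw [mem_ball_zero_iff]
        exact hK.trans_le (by exact_mod_cast hk)
      simp only [Pi.sub_apply, Set.indicator_of_mem hx, sub_self, enorm_zero]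
      rw [ENNReal.zero_rpow_of_pos (by norm_num)]
  rw [lintegral_zero] at h2
  have h3 := h2.ennrpow_const (1 / 2 : ℝ)
  rwa [ENNReal.zero_rpow_of_pos (by norm_num)] at h3

/-- Domination by the maximal function persists for square integrable functions, by truncation to
balls. -/
theorem dil_fourierL2_le_of_forall_integrable (h : IsBump Θ) (hl : 0 < lam) (ht : 0 < t)
    {A : ℝ≥0∞} {x : Euc n}
    (hA : ∀ u : Euc n → ℂ, Integrable u →
      ‖𝓕⁻ (fun ξ => dil (n := n) Θ lam t ξ * 𝓕 u ξ) x‖ₑ ≤ A * maxFn u x)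
    {v : Euc n → ℂ} (hv : MemLp v 2 volume) :
    ‖𝓕⁻ (fun ξ => dil (n := n) Θ lam t ξ * fourierL2 v ξ) x‖ₑ ≤ A * maxFn v x := by
  set m := dil (n := n) Θ lam t with hm
  have hm2 : MemLp m 2 volume := memLp_dil h hl ht
  have hk : ∀ k : ℕ, ‖𝓕⁻ (fun ξ => m ξ * fourierL2 v ξ) x‖ₑ ≤ A * maxFn v x +
      eLpNorm m 2 volume * eLpNorm (v - (Metric.ball 0 k).indicator v) 2 volume := by
    intro k
    set vk := (Metric.ball (0 : Euc n) k).indicator v with hvk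
    have hvk2 : MemLp vk 2 volume := hv.indicator measurableSet_ball
    have hvk1 : Integrable vk := by
      rw [hvk, integrable_indicator_iff measurableSet_ball]
      have : IsFiniteMeasure ((volume : Measure (Euc n)).restrict (Metric.ball 0 k)) :=
        ⟨by rw [Measure.restrict_apply_univ]; exact measure_ball_lt_top⟩
      exact (hv.restrict _).integrable (by norm_num)
    have e1 : 𝓕⁻ (fun ξ => m ξ * fourierL2 v ξ) x = 𝓕⁻ (fun ξ => m ξ * 𝓕 vk ξ) x +
        𝓕⁻ (fun ξ => m ξ * fourierL2 (v - vk) ξ) x := by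
      have i1 : Integrable (fun ξ => m ξ * 𝓕 vk ξ) :=
        (integrable_dil h hl ht).mul_bdd (c := ∫ y, ‖vk y‖)
          (continuous_fourier hvk1).aestronglyMeasurable (ae_of_all _ (norm_fourier_le vk))
      have i2 : Integrable (fun ξ => m ξ * fourierL2 (v - vk) ξ) :=
        hm2.integrable_mul (memLp_fourierL2 _)
      rw [← Pi.add_apply, ← fourierInv_add_fun i1 i2]
      refine Real.fourierInv_congr_ae ?_ x
      filter_upwards [fourierL2_sub hv hvk2, fourierL2_ae_eq hvk1 hvk2] with ξ h1 h2
      simp only [Pi.add_apply, h1, Pi.sub_apply, h2]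
      ring
    rw [e1]
    refine (enorm_add_le _ _).trans (add_le_add ?_ ?_)
    · refine (hA vk hvk1).trans (mul_le_mul_right (maxFn_mono (fun y => ?_) x) _)
      exact enorm_indicator_le_enorm_self _ _
    · refine (enorm_fourierInv_mul_le hm2 (memLp_fourierL2 _) x).trans ?_
      rw [eLpNorm_fourierL2 (hv.sub hvk2)]
  have hlim : Filter.Tendsto (fun k : ℕ => A * maxFn v x +
      eLpNorm m 2 volume * eLpNorm (v - (Metric.ball 0 k).indicator v) 2 volume) Filter.atTop
      (nhds (A * maxFn v x + eLpNorm m 2 volume * 0)) :=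
    (ENNReal.Tendsto.const_mul (tendsto_eLpNorm_sub_indicator_ball hv)
      (Or.inr hm2.2.ne)).const_add _
  rw [mul_zero, add_zero] at hlim
  exact ge_of_tendsto' hlim hk

end dil

end Domination

/-! ### `L²` estimates for the square function and the maximal function -/

section SquareIntegrable

open scoped RealInnerProductSpace

/-- The inverse Fourier transform of `Θ(λ (1 - |ξ/t|²)) F(ξ)`, as an operator on the
frequency side. -/
def dilOp {n : ℕ} (Θ : ℝ → ℂ) (lam t : ℝ) (F : Euc n → ℂ) (x : Euc n) : ℂ :=
  𝓕⁻ (fun ξ => dil Θ lam t ξ * F ξ) x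

section dilOp

variable {n : ℕ} {Θ : ℝ → ℂ} {lam t : ℝ} {F : Euc n → ℂ}

theorem stronglyMeasurable_dilOp (h : IsBump Θ) (hF : StronglyMeasurable F) :
    StronglyMeasurable (fun z : Euc n × ℝ => dilOp Θ lam z.2 F z.1) := by
  simp only [dilOp, Real.fourierInv_eq']
  refine StronglyMeasurable.integral_prod_right
    (f := fun (z : Euc n × ℝ) (v : Euc n) =>
      Complex.exp (((2 * Real.pi * ⟪v, z.1⟫ : ℝ) : ℂ) * Complex.I) • (dil Θ lam z.2 v * F v)) ?_
  have h1 : Measurable fun z : (Euc n × ℝ) × Euc n => lam * (1 - ‖z.1.2⁻¹ • z.2‖ ^ 2) := by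
    fun_prop
  have h2 : Continuous fun z : (Euc n × ℝ) × Euc n =>
      Complex.exp (((2 * Real.pi * ⟪z.2, z.1.1⟫ : ℝ) : ℂ) * Complex.I) := by fun_prop
  have h3 : Measurable fun z : (Euc n × ℝ) × Euc n => dil (n := n) Θ lam z.1.2 z.2 :=
    h.continuous.measurable.comp h1
  exact h2.stronglyMeasurable.smul (h3.stronglyMeasurable.mul
    (hF.comp_measurable measurable_snd))

theorem continuous_dilOp (h : IsBump Θ) (hl : 0 < lam) (ht : 0 < t) (hF : MemLp F 2 volume) :
    Continuous (dilOp Θ lam t F) :=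
  continuous_fourierInv ((memLp_dil h hl ht).integrable_mul hF)

theorem memLp_dil_mul (h : IsBump Θ) (hF : MemLp F 2 volume) :
    MemLp (fun ξ => dil Θ lam t ξ * F ξ) 2 volume := by
  obtain ⟨B, -, hB⟩ := h.exists_bound
  refine hF.of_le_mul (c := B) ((continuous_dil h).aestronglyMeasurable.mul hF.1)
    (ae_of_all _ fun ξ => ?_)
  rw [norm_mul]
  gcongr
  exact hB _

theorem lintegral_dilOp_sq (h : IsBump Θ) (hl : 0 < lam) (ht : 0 < t) (hF : MemLp F 2 volume) :
    ∫⁻ x, ‖dilOp Θ lam t F x‖ₑ ^ 2 = ∫⁻ ξ, ‖dil Θ lam t ξ‖ₑ ^ 2 * ‖F ξ‖ₑ ^ 2 := by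
  simp only [dilOp]
  rw [lintegral_enorm_fourierInv_sq (u := fun ξ => dil Θ lam t ξ * F ξ)
    ((memLp_dil h hl ht).integrable_mul hF) (memLp_dil_mul h hF)]
  simp only [enorm_mul, mul_pow]

/-- For a fixed frequency `ξ` only scales `t` with `|ξ| ≤ t ≤ (1 + 4/λ) |ξ|` are active. -/
theorem lintegral_dil_sq_le (h : IsBump Θ) (hl : 4 ≤ lam) {B : ℝ} (hB : ∀ v, ‖Θ v‖ ≤ B)
    (ξ : Euc n) (hξ : ξ ≠ 0) :
    ∫⁻ t in Set.Ioi (0 : ℝ), ENNReal.ofReal t⁻¹ * ‖dil Θ lam t ξ‖ₑ ^ 2 ≤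
      ENNReal.ofReal (4 * B ^ 2 / lam) := by
  have hl0 : 0 < lam := by linarith
  set s := ‖ξ‖ with hs
  have hs0 : 0 < s := norm_pos_iff.2 hξ
  have hB0 : 0 ≤ B := (norm_nonneg _).trans (hB 0)
  calc _ ≤ ∫⁻ t in Set.Ioi (0 : ℝ), (Set.Icc s (s * (1 + 4 / lam))).indicator
        (fun _ => ENNReal.ofReal (s⁻¹ * B ^ 2)) t := by
        refine setLIntegral_mono' measurableSet_Ioi fun t (ht : 0 < t) => ?_
        by_cases hmem : lam * (1 - ‖t⁻¹ • ξ‖ ^ 2) ∈ Set.Icc (1 / 2 : ℝ) 2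
        · have h1 : ‖t⁻¹ • ξ‖ = s / t := by
            rw [norm_smul, norm_inv, Real.norm_of_nonneg ht.le, ← div_eq_inv_mul]
          rw [h1] at hmem
          have h2 : (s / t) ^ 2 ≤ 1 := by
            have := hmem.1
            by_contra hlt
            nlinarith
          have h3 : s ≤ t := by
            have := (sq_le_one_iff₀ (by positivity)).1 h2
            rwa [div_le_one ht] at this
          have h4 : 1 - 2 / lam ≤ (s / t) ^ 2 := by
            have h5 : 1 - (s / t) ^ 2 ≤ 2 / lam := by
              rw [le_div_iff₀ hl0]; linarith [hmem.2]
            linarith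
          have h6 : 1 - 2 / lam ≤ s / t := by
            have : (s / t) ^ 2 ≤ s / t := by
              have : s / t ≤ 1 := by rwa [div_le_one ht]
              have : 0 ≤ s / t := by positivity
              nlinarith
            linarith
          have h7 : t ≤ s * (1 + 4 / lam) := by
            rw [le_div_iff₀ ht] at h6
            have h8 : 0 < 1 / lam := by positivity
            have h9 : 1 / lam ≤ 1 / 4 := by
              apply one_div_le_one_div_of_le <;> linarith
            have e1 : 2 / lam = 2 * (1 / lam) := by ring
            have e2 : 4 / lam = 4 * (1 / lam) := by ring
            rw [e1] at h6
            rw [e2]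
            have h10 : 1 ≤ (1 - 2 * (1 / lam)) * (1 + 4 * (1 / lam)) := by nlinarith
            calc t = 1 * t := (one_mul t).symm
              _ ≤ (1 - 2 * (1 / lam)) * (1 + 4 * (1 / lam)) * t := by gcongr
              _ = ((1 - 2 * (1 / lam)) * t) * (1 + 4 * (1 / lam)) := by ring
              _ ≤ s * (1 + 4 * (1 / lam)) := by gcongr
          rw [Set.indicator_of_mem (show t ∈ Set.Icc s (s * (1 + 4 / lam)) from ⟨h3, h7⟩),
            ← ofReal_norm, ← ENNReal.ofReal_pow (norm_nonneg _),
            ← ENNReal.ofReal_mul (by positivity)]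
          apply ENNReal.ofReal_le_ofReal
          have : ‖dil Θ lam t ξ‖ ≤ B := hB _
          gcongr
        · have : dil Θ lam t ξ = 0 := h.eq_zero hmem
          simp [this]
    _ ≤ ∫⁻ t, (Set.Icc s (s * (1 + 4 / lam))).indicator
        (fun _ => ENNReal.ofReal (s⁻¹ * B ^ 2)) t := setLIntegral_le_lintegral _ _
    _ = ENNReal.ofReal (4 * B ^ 2 / lam) := by
        rw [lintegral_indicator measurableSet_Icc, setLIntegral_const, Real.volume_Icc,
          ← ENNReal.ofReal_mul (by positivity)]
        congr 1
        field_simp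
        ring

/-- The `L²` bound of the square function with respect to `dt/t`. -/
theorem lintegral_square_dilOp_le (hn : 1 ≤ n) (h : IsBump Θ) (hl : 4 ≤ lam) {B : ℝ}
    (hB : ∀ v, ‖Θ v‖ ≤ B) (hFm : StronglyMeasurable F) (hF : MemLp F 2 volume) :
    ∫⁻ x, ∫⁻ t in Set.Ioi (0 : ℝ), ENNReal.ofReal t⁻¹ * ‖dilOp Θ lam t F x‖ₑ ^ 2 ≤
      ENNReal.ofReal (4 * B ^ 2 / lam) * ∫⁻ ξ, ‖F ξ‖ₑ ^ 2 := by
  have hne : Nonempty (Fin n) := ⟨⟨0, hn⟩⟩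
  have hl0 : 0 < lam := by linarith
  have hm1 : Measurable (Function.uncurry fun (x : Euc n) (t : ℝ) =>
      ENNReal.ofReal t⁻¹ * ‖dilOp Θ lam t F x‖ₑ ^ 2) := by
    have h1 := (stronglyMeasurable_dilOp (lam := lam) h hFm).measurable.enorm
    have h2 : Measurable fun z : Euc n × ℝ => ENNReal.ofReal z.2⁻¹ := by fun_prop
    exact h2.mul (h1.pow_const 2)
  have hm2 : Measurable (Function.uncurry fun (t : ℝ) (ξ : Euc n) =>
      ENNReal.ofReal t⁻¹ * (‖dil Θ lam t ξ‖ₑ ^ 2 * ‖F ξ‖ₑ ^ 2)) := by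
    have h1 : Measurable fun z : ℝ × Euc n => dil (n := n) Θ lam z.1 z.2 :=
      h.continuous.measurable.comp (by fun_prop)
    have h2 : Measurable fun z : ℝ × Euc n => ENNReal.ofReal z.1⁻¹ := by fun_prop
    have h3 : Measurable fun z : ℝ × Euc n => ‖F z.2‖ₑ := (hFm.measurable.comp measurable_snd).enorm
    exact h2.mul ((h1.enorm.pow_const 2).mul (h3.pow_const 2))
  calc _ = ∫⁻ t in Set.Ioi (0 : ℝ), ∫⁻ x, ENNReal.ofReal t⁻¹ * ‖dilOp Θ lam t F x‖ₑ ^ 2 :=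
        lintegral_lintegral_swap hm1.aemeasurable
    _ = ∫⁻ t in Set.Ioi (0 : ℝ), ∫⁻ ξ,
          ENNReal.ofReal t⁻¹ * (‖dil Θ lam t ξ‖ₑ ^ 2 * ‖F ξ‖ₑ ^ 2) := by
        refine setLIntegral_congr_fun measurableSet_Ioi fun t (ht : 0 < t) => ?_
        rw [lintegral_const_mul' _ _ ENNReal.ofReal_ne_top, lintegral_dilOp_sq h hl0 ht hF,
          lintegral_const_mul' _ _ ENNReal.ofReal_ne_top]
    _ = ∫⁻ ξ, ∫⁻ t in Set.Ioi (0 : ℝ),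
          ENNReal.ofReal t⁻¹ * (‖dil Θ lam t ξ‖ₑ ^ 2 * ‖F ξ‖ₑ ^ 2) :=
        lintegral_lintegral_swap hm2.aemeasurable
    _ ≤ ∫⁻ ξ, ENNReal.ofReal (4 * B ^ 2 / lam) * ‖F ξ‖ₑ ^ 2 := by
        refine lintegral_mono_ae ?_
        filter_upwards [Measure.ae_ne volume (0 : Euc n)] with ξ hξ
        simp only [← mul_assoc]
        rw [lintegral_mul_const' _ _ (by finiteness)]
        exact mul_le_mul_left (lintegral_dil_sq_le h hl hB ξ hξ) _
    _ = _ := lintegral_const_mul' _ _ ENNReal.ofReal_ne_top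

/-- The profile of `(s / 2λ) ∂ₛ` applied to `Θ(λ (1 - |ξ/s|²))`. -/
def dtProfile (Θ : ℝ → ℂ) (lam : ℝ) (v : ℝ) : ℂ := ((1 - v / lam : ℝ) : ℂ) * deriv Θ v

theorem isBump_dtProfile (h : IsBump Θ) : IsBump (dtProfile Θ lam) :=
  h.deriv.mul_left (Complex.ofRealCLM.contDiff.comp
    (contDiff_const.sub (contDiff_id.div_const lam)))

theorem norm_dtProfile_le (h : IsBump Θ) (hl : 4 ≤ lam) {B : ℝ} (hB : ∀ v, ‖deriv Θ v‖ ≤ B)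
    (v : ℝ) : ‖dtProfile Θ lam v‖ ≤ B := by
  by_cases hv : v ∈ Set.Icc (1 / 2 : ℝ) 2
  · rw [dtProfile, norm_mul, Complex.norm_real]
    have h1 : 0 ≤ v / lam := div_nonneg (by linarith [hv.1]) (by linarith)
    have h2 : v / lam ≤ 1 := by rw [div_le_one (by linarith)]; linarith [hv.2]
    refine (mul_le_of_le_one_left (norm_nonneg _) ?_).trans (hB v)
    rw [Real.norm_eq_abs, abs_le]
    constructor <;> linarith
  · rw [(isBump_dtProfile h).eq_zero hv, norm_zero]
    exact (norm_nonneg _).trans (hB v)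

theorem hasDerivAt_dil (h : IsBump Θ) (hl : 0 < lam) {s : ℝ} (hs : 0 < s) (ξ : Euc n) :
    HasDerivAt (fun s => dil Θ lam s ξ) (((2 * lam / s : ℝ) : ℂ) * dil (dtProfile Θ lam) lam s ξ)
      s := by
  have h1 : HasDerivAt (fun s : ℝ => lam * (1 - ‖s⁻¹ • ξ‖ ^ 2))
      (2 * lam * ‖ξ‖ ^ 2 / s ^ 3) s := by
    have e1 : (fun s : ℝ => lam * (1 - ‖s⁻¹ • ξ‖ ^ 2)) =
        fun s => lam * (1 - (s⁻¹) ^ 2 * ‖ξ‖ ^ 2) := by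
      ext s
      rw [norm_smul, mul_pow, Real.norm_eq_abs, sq_abs]
    rw [e1]
    have h2 := ((((hasDerivAt_inv hs.ne').pow 2).mul_const (‖ξ‖ ^ 2)).const_sub 1).const_mul lam
    refine h2.congr_deriv ?_
    simp only [Nat.cast_ofNat, Nat.add_one_sub_one, pow_one]
    field_simp
  have h3 : HasDerivAt Θ (deriv Θ (lam * (1 - ‖s⁻¹ • ξ‖ ^ 2))) (lam * (1 - ‖s⁻¹ • ξ‖ ^ 2)) :=
    (h.1.differentiable (by simp) _).hasDerivAt
  refine (HasDerivAt.scomp s h3 h1).congr_deriv ?_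
  rw [Complex.real_smul, dil, dtProfile, ← mul_assoc, ← Complex.ofReal_mul]
  congr 2
  rw [norm_smul, mul_pow, Real.norm_eq_abs, sq_abs]
  field_simp
  ring

theorem hasDerivAt_dilOp (h : IsBump Θ) (hl : 0 < lam) (hF : MemLp F 2 volume) {s : ℝ}
    (hs : 0 < s) (x : Euc n) :
    HasDerivAt (fun s => dilOp Θ lam s F x)
      (((2 * lam / s : ℝ) : ℂ) * dilOp (dtProfile Θ lam) lam s F x) s := by
  have h' := isBump_dtProfile (lam := lam) h
  obtain ⟨B, hB0, hB⟩ := h'.exists_bound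
  set E : Euc n → ℂ := fun ξ => Complex.exp (((2 * Real.pi * ⟪ξ, x⟫ : ℝ) : ℂ) * Complex.I)
  have hE : Continuous E := by fun_prop
  have hE1 : ∀ ξ, ‖E ξ‖ = 1 := fun ξ => Complex.norm_exp_ofReal_mul_I _
  have hm : ∀ {Ψ : ℝ → ℂ}, IsBump Ψ → ∀ s, AEStronglyMeasurable
      (fun ξ => E ξ • (dil Ψ lam s ξ * F ξ)) volume := fun hΨ s =>
    hE.aestronglyMeasurable.smul ((continuous_dil hΨ).aestronglyMeasurable.mul hF.1)
  have hbound : Integrable (fun ξ => (Metric.closedBall (0 : Euc n) (2 * s)).indicator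
      (fun ξ => (4 * lam / s * B) * ‖F ξ‖) ξ) := by
    rw [integrable_indicator_iff Metric.isClosed_closedBall.measurableSet]
    have : IsFiniteMeasure ((volume : Measure (Euc n)).restrict
        (Metric.closedBall 0 (2 * s))) :=
      ⟨by rw [Measure.restrict_apply_univ]; exact measure_closedBall_lt_top⟩
    exact ((hF.restrict _).integrable (by norm_num)).norm.const_mul _
  have key := hasDerivAt_integral_of_dominated_loc_of_deriv_le (μ := (volume : Measure (Euc n)))
    (F := fun s ξ => E ξ • (dil Θ lam s ξ * F ξ))
    (F' := fun s ξ => E ξ • (((2 * lam / s : ℝ) : ℂ) * dil (dtProfile Θ lam) lam s ξ * F ξ))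
    (x₀ := s) (s := Metric.ball s (s / 2)) (Metric.ball_mem_nhds s (by positivity))
    (bound := fun ξ => (Metric.closedBall (0 : Euc n) (2 * s)).indicator
      (fun ξ => (4 * lam / s * B) * ‖F ξ‖) ξ)
    (Filter.Eventually.of_forall fun s => hm h s)
    (((memLp_dil h hl hs).integrable_mul hF).bdd_mul (c := 1) hE.aestronglyMeasurable
      (ae_of_all _ fun ξ => (hE1 ξ).le))
    (by
      have := (hm h' s).const_mul ((2 * lam / s : ℝ) : ℂ)
      refine this.congr (ae_of_all _ fun ξ => ?_)
      simp only [smul_eq_mul]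
      ring)
    (ae_of_all _ fun ξ r hr => by
      have hr1 : s / 2 < r ∧ r < 2 * s := by
        rw [Metric.mem_ball, Real.dist_eq, abs_lt] at hr
        constructor <;> linarith [hr.1, hr.2]
      have hr0 : 0 < r := by linarith
      rw [norm_smul, hE1, one_mul, norm_mul, norm_mul, Complex.norm_real,
        Real.norm_of_nonneg (by positivity)]
      by_cases hξ : ξ ∈ Metric.closedBall (0 : Euc n) (2 * s)
      · rw [Set.indicator_of_mem hξ]
        have h2 : 2 * lam / r ≤ 4 * lam / s := by
          rw [div_le_div_iff₀ hr0 hs]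
          nlinarith
        gcongr
        exact hB _
      · rw [Set.indicator_of_notMem hξ, dil_eq_zero h' hl hr0]
        · simp
        · rw [mem_closedBall_zero_iff, not_le] at hξ
          linarith)
    hbound
    (ae_of_all _ fun ξ r hr => by
      have hr0 : 0 < r := by
        rw [Metric.mem_ball, Real.dist_eq, abs_lt] at hr
        linarith [hr.1]
      exact ((hasDerivAt_dil h hl hr0 ξ).mul_const (F ξ)).const_smul (E ξ))
  simp only [dilOp, Real.fourierInv_eq']
  refine key.2.congr_deriv ?_
  rw [← integral_const_mul]
  refine integral_congr_ae (ae_of_all _ fun ξ => ?_)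
  simp only [smul_eq_mul, E]
  ring

/-- As `s → 0` the support of the multiplier shrinks to a point, so that its `L²` norm tends
to `0`. -/
theorem tendsto_dilOp_zero (hn : 1 ≤ n) (h : IsBump Θ) (hl : 0 < lam) (hF : MemLp F 2 volume)
    (x : Euc n) :
    Filter.Tendsto (fun s => dilOp Θ lam s F x) (nhdsWithin 0 (Set.Ioi 0)) (nhds 0) := by
  have hne : Nonempty (Fin n) := ⟨⟨0, hn⟩⟩
  obtain ⟨B, hB0, hB⟩ := h.exists_bound
  set w := volume (Metric.ball (0 : Euc n) 1)
  have hw1 : w ≠ ∞ := measure_ball_lt_top.ne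
  have hle : ∀ s ∈ Set.Ioi (0 : ℝ), ‖dilOp Θ lam s F x‖ₑ ≤
      (ENNReal.ofReal (s ^ n) * w) ^ (1 / 2 : ℝ) * ENNReal.ofReal B * eLpNorm F 2 volume := by
    intro s hs
    have hs0 : 0 < s := hs
    refine (enorm_fourierInv_mul_le (memLp_dil h hl hs) hF x).trans (mul_le_mul_left ?_ _)
    have hind : dil (n := n) Θ lam s = (Metric.closedBall 0 s).indicator (dil Θ lam s) := by
      ext ξ
      by_cases hξ : ξ ∈ Metric.closedBall (0 : Euc n) s
      · rw [Set.indicator_of_mem hξ]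
      · rw [Set.indicator_of_notMem hξ]
        exact dil_eq_zero h hl hs (by simpa using hξ)
    rw [hind, eLpNorm_indicator_eq_eLpNorm_restrict Metric.isClosed_closedBall.measurableSet]
    refine (eLpNorm_le_of_ae_bound (C := B) (ae_of_all _ fun ξ => hB _)).trans (le_of_eq ?_)
    rw [Measure.restrict_apply_univ, Measure.addHaar_closedBall _ _ hs0.le]
    simp [w]
  rw [tendsto_iff_edist_tendsto_0]
  simp only [edist_zero_right]
  have hlim : Filter.Tendsto (fun s : ℝ => (ENNReal.ofReal (s ^ n) * w) ^ (1 / 2 : ℝ) *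
      ENNReal.ofReal B * eLpNorm F 2 volume) (nhds 0) (nhds 0) := by
    have h1 : Filter.Tendsto (fun s : ℝ => ENNReal.ofReal (s ^ n)) (nhds 0) (nhds 0) := by
      have : Continuous fun s : ℝ => ENNReal.ofReal (s ^ n) :=
        ENNReal.continuous_ofReal.comp (continuous_pow n)
      have h2 := this.tendsto 0
      rwa [zero_pow (by omega), ENNReal.ofReal_zero] at h2
    have h2 := (ENNReal.Tendsto.mul_const h1 (Or.inr hw1)).ennrpow_const (1 / 2 : ℝ)
    rw [zero_mul, ENNReal.zero_rpow_of_pos (by norm_num)] at h2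
    have h3 := ENNReal.Tendsto.mul_const (ENNReal.Tendsto.mul_const h2
      (b := ENNReal.ofReal B)
      (Or.inr ENNReal.ofReal_ne_top)) (Or.inr hF.2.ne) (b := eLpNorm F 2 volume)
    simpa using h3
  refine tendsto_of_tendsto_of_tendsto_of_le_of_le' tendsto_const_nhds
    (hlim.mono_left nhdsWithin_le_nhds) (Filter.Eventually.of_forall fun _ => zero_le) ?_
  filter_upwards [self_mem_nhdsWithin] with s hs
  simpa using hle s hs

/-- A function vanishing at `0` is controlled by square functions of itself and of its
logarithmic derivative. -/
theorem enorm_sq_le_of_hasDerivAt {a b : ℝ → ℂ} {c : ℝ} (hc : 0 < c) (ham : Measurable a)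
    (had : ∀ s, 0 < s → HasDerivAt a (((2 * c / s : ℝ) : ℂ) * b s) s)
    (hbc : ∀ s, 0 < s → ContinuousAt b s)
    (ha0 : Filter.Tendsto a (nhdsWithin 0 (Set.Ioi 0)) (nhds 0)) (ht : 0 < t) :
    ‖a t‖ₑ ^ 2 ≤ ENNReal.ofReal (2 * c) *
      ((∫⁻ s in Set.Ioi (0 : ℝ), ENNReal.ofReal s⁻¹ * ‖a s‖ₑ ^ 2) +
      ∫⁻ s in Set.Ioi (0 : ℝ), ENNReal.ofReal s⁻¹ * ‖b s‖ₑ ^ 2) := by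
  have hm : Measurable fun s => ENNReal.ofReal s⁻¹ * ‖a s‖ₑ ^ 2 := by
    have h2 : Measurable fun s : ℝ => ENNReal.ofReal s⁻¹ := by fun_prop
    exact h2.mul (ham.enorm.pow_const 2)
  have hstep : ∀ ε ∈ Set.Ioo 0 t, ENNReal.ofReal (‖a t‖ ^ 2 - ‖a ε‖ ^ 2) ≤
      ENNReal.ofReal (2 * c) * ((∫⁻ s in Set.Ioi (0 : ℝ), ENNReal.ofReal s⁻¹ * ‖a s‖ₑ ^ 2) +
      ∫⁻ s in Set.Ioi (0 : ℝ), ENNReal.ofReal s⁻¹ * ‖b s‖ₑ ^ 2) := by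
    rintro ε ⟨hε0, hεt⟩
    have hpos : ∀ s ∈ Set.Icc ε t, 0 < s := fun s hs => hε0.trans_le hs.1
    have hcont : ContinuousOn (fun s => 2 * c * (s⁻¹ * (‖a s‖ ^ 2 + ‖b s‖ ^ 2)))
        (Set.Icc ε t) := by
      intro s hs
      have h1 := (had s (hpos s hs)).continuousAt
      have h2 := hbc s (hpos s hs)
      have h3 : ContinuousAt (fun s : ℝ => s⁻¹) s := continuousAt_inv₀ (hpos s hs).ne'
      exact (continuousAt_const.mul (h3.mul ((h1.norm.pow 2).add
        (h2.norm.pow 2)))).continuousWithinAt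
    have h1 := intervalIntegral.sub_le_integral_of_hasDeriv_right_of_le hεt.le
      (g := fun s => ‖a s‖ ^ 2) (g' := fun s => 2 * ⟪a s, ((2 * c / s : ℝ) : ℂ) * b s⟫)
      (φ := fun s => 2 * c * (s⁻¹ * (‖a s‖ ^ 2 + ‖b s‖ ^ 2)))
      (fun s hs => ((had s (hpos s hs)).continuousAt.norm.pow 2).continuousWithinAt)
      (fun s hs => (had s (hε0.trans hs.1)).norm_sq.hasDerivWithinAt)
      (hcont.integrableOn_Icc)
      (fun s hs => by
        have hs0 : 0 < s := hε0.trans hs.1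
        have h2 : ⟪a s, ((2 * c / s : ℝ) : ℂ) * b s⟫ = 2 * c / s * ⟪a s, b s⟫ := by
          rw [← Complex.real_smul, inner_smul_right]
        have h3 : ⟪a s, b s⟫ ≤ ‖a s‖ * ‖b s‖ := real_inner_le_norm _ _
        have h4 : 2 * (‖a s‖ * ‖b s‖) ≤ ‖a s‖ ^ 2 + ‖b s‖ ^ 2 := by
          nlinarith [sq_nonneg (‖a s‖ - ‖b s‖)]
        rw [h2]
        calc 2 * (2 * c / s * ⟪a s, b s⟫) = 2 * c * (s⁻¹ * (2 * ⟪a s, b s⟫)) := by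
              field_simp
          _ ≤ 2 * c * (s⁻¹ * (‖a s‖ ^ 2 + ‖b s‖ ^ 2)) := by
              gcongr
              linarith)
    refine (ENNReal.ofReal_le_ofReal h1).trans ?_
    rw [intervalIntegral.integral_of_le hεt.le, ofReal_integral_eq_lintegral_ofReal
      (hcont.integrableOn_Icc.mono_set Set.Ioc_subset_Icc_self)
      (by
        filter_upwards [ae_restrict_mem measurableSet_Ioc] with s hs
        have : 0 < s := hε0.trans hs.1
        simp only [Pi.zero_apply]
        positivity), ← lintegral_add_left hm, ← lintegral_const_mul' _ _ ENNReal.ofReal_ne_top]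
    calc _ = ∫⁻ s in Set.Ioc ε t, ENNReal.ofReal (2 * c) *
          (ENNReal.ofReal s⁻¹ * ‖a s‖ₑ ^ 2 + ENNReal.ofReal s⁻¹ * ‖b s‖ₑ ^ 2) := by
          refine setLIntegral_congr_fun measurableSet_Ioc fun s hs => ?_
          have hs0 : 0 < s := hε0.trans hs.1
          rw [ENNReal.ofReal_mul (show 0 ≤ 2 * c by positivity),
            ENNReal.ofReal_mul (inv_nonneg.2 hs0.le),
            ENNReal.ofReal_add (by positivity) (by positivity), ENNReal.ofReal_pow (norm_nonneg _),
            ENNReal.ofReal_pow (norm_nonneg _), ofReal_norm, ofReal_norm, mul_add]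
      _ ≤ _ := lintegral_mono_set fun s hs => hε0.trans hs.1
  have hlim : Filter.Tendsto (fun ε => ENNReal.ofReal (‖a t‖ ^ 2 - ‖a ε‖ ^ 2))
      (nhdsWithin 0 (Set.Ioi 0)) (nhds (ENNReal.ofReal (‖a t‖ ^ 2 - ‖(0 : ℂ)‖ ^ 2))) :=
    ENNReal.tendsto_ofReal ((ha0.norm.pow 2).const_sub _)
  rw [norm_zero, zero_pow two_ne_zero, sub_zero, ENNReal.ofReal_pow (norm_nonneg _),
    ofReal_norm] at hlim
  exact le_of_tendsto hlim (by
    filter_upwards [Ioo_mem_nhdsGT ht] with ε hε using hstep ε hε)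

theorem enorm_dilOp_sq_le (hn : 1 ≤ n) (h : IsBump Θ) (hl : 0 < lam) (hFm : StronglyMeasurable F)
    (hF : MemLp F 2 volume) (ht : 0 < t) (x : Euc n) :
    ‖dilOp Θ lam t F x‖ₑ ^ 2 ≤ ENNReal.ofReal (2 * lam) *
      ((∫⁻ s in Set.Ioi (0 : ℝ), ENNReal.ofReal s⁻¹ * ‖dilOp Θ lam s F x‖ₑ ^ 2) +
      ∫⁻ s in Set.Ioi (0 : ℝ),
        ENNReal.ofReal s⁻¹ * ‖dilOp (dtProfile Θ lam) lam s F x‖ₑ ^ 2) := by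
  have hm : Measurable fun s => dilOp Θ lam s F x := by
    have h1 := (stronglyMeasurable_dilOp (lam := lam) h hFm).measurable
    have h2 : Measurable fun s : ℝ => (x, s) := measurable_prodMk_left
    have h3 := h1.comp h2
    simpa only [Function.comp_def] using h3
  have hd : ∀ s, 0 < s → HasDerivAt (fun s => dilOp Θ lam s F x)
      (((2 * lam / s : ℝ) : ℂ) * (fun s => dilOp (dtProfile Θ lam) lam s F x) s) s :=
    fun s hs => hasDerivAt_dilOp h hl hF hs x
  have hc : ∀ s, 0 < s → ContinuousAt (fun s => dilOp (dtProfile Θ lam) lam s F x) s :=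
    fun s hs => (hasDerivAt_dilOp (isBump_dtProfile h) hl hF hs x).continuousAt
  exact enorm_sq_le_of_hasDerivAt hl hm hd hc (tendsto_dilOp_zero hn h hl hF x) ht

theorem sq_le_iff_le_rpow (y z : ℝ≥0∞) : y ^ 2 ≤ z ↔ y ≤ z ^ (1 / 2 : ℝ) := by
  rw [one_div, ENNReal.le_rpow_inv_iff (by norm_num), ENNReal.rpow_two]

/-- The `L²` bound of the maximal function, uniform in `λ`. -/
theorem lintegral_sup_dilOp_sq_le (hn : 1 ≤ n) (h : IsBump Θ) (hl : 4 ≤ lam) {B B' : ℝ}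
    (hB : ∀ v, ‖Θ v‖ ≤ B) (hB' : ∀ v, ‖deriv Θ v‖ ≤ B')
    (hFm : StronglyMeasurable F) (hF : MemLp F 2 volume) :
    ∫⁻ x, (⨆ (t : ℝ) (_ : 0 < t), ‖dilOp Θ lam t F x‖ₑ) ^ 2 ≤
      ENNReal.ofReal (8 * (B ^ 2 + B' ^ 2)) * ∫⁻ ξ, ‖F ξ‖ₑ ^ 2 := by
  have hl0 : 0 < lam := by linarith
  have h' := isBump_dtProfile (lam := lam) h
  have hsup : ∀ x, (⨆ (t : ℝ) (_ : 0 < t), ‖dilOp Θ lam t F x‖ₑ) ^ 2 ≤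
      ENNReal.ofReal (2 * lam) *
      ((∫⁻ s in Set.Ioi (0 : ℝ), ENNReal.ofReal s⁻¹ * ‖dilOp Θ lam s F x‖ₑ ^ 2) +
      ∫⁻ s in Set.Ioi (0 : ℝ),
        ENNReal.ofReal s⁻¹ * ‖dilOp (dtProfile Θ lam) lam s F x‖ₑ ^ 2) := by
    intro x
    rw [sq_le_iff_le_rpow]
    exact iSup₂_le fun t ht =>
      (sq_le_iff_le_rpow _ _).1 (enorm_dilOp_sq_le hn h hl0 hFm hF ht x)
  have hm : Measurable fun x : Euc n =>
      ∫⁻ s in Set.Ioi (0 : ℝ), ENNReal.ofReal s⁻¹ * ‖dilOp Θ lam s F x‖ₑ ^ 2 := by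
    refine Measurable.lintegral_prod_right' (f := fun z : Euc n × ℝ =>
      ENNReal.ofReal z.2⁻¹ * ‖dilOp Θ lam z.2 F z.1‖ₑ ^ 2) ?_
    have h2 : Measurable fun z : Euc n × ℝ => ENNReal.ofReal z.2⁻¹ := by fun_prop
    exact h2.mul ((stronglyMeasurable_dilOp (lam := lam) h hFm).measurable.enorm.pow_const 2)
  calc _ ≤ _ := lintegral_mono hsup
    _ = ENNReal.ofReal (2 * lam) *
      ((∫⁻ x, ∫⁻ s in Set.Ioi (0 : ℝ), ENNReal.ofReal s⁻¹ * ‖dilOp Θ lam s F x‖ₑ ^ 2) +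
      ∫⁻ x, ∫⁻ s in Set.Ioi (0 : ℝ),
        ENNReal.ofReal s⁻¹ * ‖dilOp (dtProfile Θ lam) lam s F x‖ₑ ^ 2) := by
        rw [lintegral_const_mul' _ _ ENNReal.ofReal_ne_top, lintegral_add_left hm]
    _ ≤ ENNReal.ofReal (2 * lam) * (ENNReal.ofReal (4 * B ^ 2 / lam) * (∫⁻ ξ, ‖F ξ‖ₑ ^ 2) +
          ENNReal.ofReal (4 * B' ^ 2 / lam) * ∫⁻ ξ, ‖F ξ‖ₑ ^ 2) := by
        gcongr
        · exact lintegral_square_dilOp_le hn h hl hB hFm hF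
        · exact lintegral_square_dilOp_le hn h' hl (norm_dtProfile_le h hl hB') hFm hF
    _ = _ := by
        rw [← add_mul, ← mul_assoc, ← ENNReal.ofReal_add (by positivity) (by positivity),
          ← ENNReal.ofReal_mul (by positivity)]
        congr 2
        field_simp
        ring

end dilOp

end SquareIntegrable

/-! ### Interpolation between weak type `(1,1)` and `L²` -/

/-- The layer cake formula, as an inequality for functions which need not be measurable. -/
theorem lintegral_rpow_le_lintegral_meas {α : Type*} [MeasurableSpace α] (μ : Measure α)
    (G : α → ℝ≥0∞) {p : ℝ} (hp : 0 < p) :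
    ∫⁻ x, G x ^ p ∂μ ≤ ENNReal.ofReal p *
      ∫⁻ l in Set.Ioi (0 : ℝ), μ {x | ENNReal.ofReal l < G x} * ENNReal.ofReal (l ^ (p - 1)) := by
  -- a measurable minorant of `G ^ p` with the same integral has smaller superlevel sets
  obtain ⟨g, hgm, hgle, hgeq⟩ := exists_measurable_le_lintegral_eq μ fun x => G x ^ p
  rw [hgeq]
  have hm : ∀ k : ℕ, Measurable fun x => min (g x ^ p⁻¹) (k : ℝ≥0∞) := fun k =>
    (hgm.pow_const _).min measurable_const
  have hsup : ∀ x, g x = ⨆ k : ℕ, (min (g x ^ p⁻¹) (k : ℝ≥0∞)) ^ p := by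
    intro x
    refine le_antisymm ?_ (iSup_le fun k => ?_)
    · rcases eq_or_ne (g x) ∞ with h | h
      · rw [h, ENNReal.top_rpow_of_pos (by positivity)]
        simp only [top_le_iff, le_top, inf_of_le_right]
        rw [iSup_eq_top]
        intro b hb
        obtain ⟨k, hk⟩ := ENNReal.exists_nat_gt (r := b ^ p⁻¹)
          (ENNReal.rpow_ne_top_of_nonneg (by positivity) hb.ne)
        exact ⟨k, (ENNReal.rpow_inv_lt_iff hp).1 hk⟩
      · obtain ⟨k, hk⟩ := ENNReal.exists_nat_gt (r := g x ^ p⁻¹)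
          (ENNReal.rpow_ne_top_of_nonneg (by positivity) h)
        refine le_iSup_of_le k ?_
        rw [min_eq_left hk.le, ENNReal.rpow_inv_rpow hp.ne']
    · calc _ ≤ (g x ^ p⁻¹) ^ p := by gcongr; exact min_le_left _ _
        _ = _ := ENNReal.rpow_inv_rpow hp.ne' _
  have hmono : Monotone fun (k : ℕ) x => (min (g x ^ p⁻¹) (k : ℝ≥0∞)) ^ p := by
    intro k k' hk x
    dsimp only
    gcongr
  rw [lintegral_congr hsup, lintegral_iSup (fun k => (hm k).pow_const p) hmono]
  refine iSup_le fun k => ?_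
  have hfin : ∀ x, min (g x ^ p⁻¹) (k : ℝ≥0∞) ≠ ∞ := fun x =>
    ((min_le_right _ _).trans_lt (ENNReal.natCast_lt_top k)).ne
  have h := lintegral_rpow_eq_lintegral_meas_lt_mul μ
    (f := fun x => (min (g x ^ p⁻¹) (k : ℝ≥0∞)).toReal)
    (ae_of_all _ fun x => ENNReal.toReal_nonneg) (hm k).ennreal_toReal.aemeasurable hp
  calc _ = ∫⁻ x, ENNReal.ofReal ((min (g x ^ p⁻¹) (k : ℝ≥0∞)).toReal ^ p) ∂μ := by
        refine lintegral_congr fun x => ?_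
        rw [← ENNReal.ofReal_rpow_of_nonneg ENNReal.toReal_nonneg hp.le,
          ENNReal.ofReal_toReal (hfin x)]
    _ ≤ _ := by
        rw [h]
        refine mul_le_mul_right (setLIntegral_mono' measurableSet_Ioi fun l (hl : 0 < l) =>
          mul_le_mul_left (measure_mono fun x hx => ?_) _) _
        have h1 := (ENNReal.ofReal_lt_iff_lt_toReal hl.le (hfin x)).2 hx
        refine h1.trans_le ((min_le_left _ _).trans ?_)
        calc g x ^ p⁻¹ ≤ (G x ^ p) ^ p⁻¹ := by gcongr; exact hgle x
          _ = G x := ENNReal.rpow_rpow_inv hp.ne' _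

theorem lintegral_lintegral_norm_swap {n : ℕ} {f : Euc n → ℂ} (hf : AEStronglyMeasurable f volume)
    {Φ : ℝ × ℝ → ℝ≥0∞} (hΦ : Measurable Φ) :
    ∫⁻ l in Set.Ioi (0 : ℝ), ∫⁻ y, Φ (l, ‖f y‖) = ∫⁻ y, ∫⁻ l in Set.Ioi (0 : ℝ), Φ (l, ‖f y‖) :=
  lintegral_lintegral_swap (hΦ.comp_aemeasurable (measurable_fst.aemeasurable.prodMk
    hf.norm.aemeasurable.comp_snd))

/-- Integrating the `L¹` norm of the part of `f` above height `c l` against `l^{p-2} dl`. -/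
theorem lintegral_indicator_gt_le {n : ℕ} {f : Euc n → ℂ} (hf : AEStronglyMeasurable f volume)
    {p c : ℝ} (hp : 1 < p) (hc : 0 < c) :
    ∫⁻ l in Set.Ioi (0 : ℝ), ENNReal.ofReal (l ^ (p - 2)) *
        ∫⁻ y, ‖{y | c * l < ‖f y‖}.indicator f y‖ₑ ≤
      ENNReal.ofReal (c ^ (1 - p) / (p - 1)) * ∫⁻ y, ‖f y‖ₑ ^ p := by
  set Φ : ℝ × ℝ → ℝ≥0∞ := fun z =>
    ENNReal.ofReal (z.1 ^ (p - 2)) * {z : ℝ × ℝ | c * z.1 < z.2}.indicator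
      (fun z => ENNReal.ofReal z.2) z with hΦ
  have hΦm : Measurable Φ := by
    have h1 : MeasurableSet {z : ℝ × ℝ | c * z.1 < z.2} :=
      measurableSet_lt (by fun_prop) (by fun_prop)
    have h2 : Measurable fun z : ℝ × ℝ => ENNReal.ofReal z.2 := by fun_prop
    have h3 : Measurable fun z : ℝ × ℝ => ENNReal.ofReal (z.1 ^ (p - 2)) := by fun_prop
    exact h3.mul (h2.indicator h1)
  have e1 : ∀ l : ℝ, ENNReal.ofReal (l ^ (p - 2)) *
      ∫⁻ y, ‖{y | c * l < ‖f y‖}.indicator f y‖ₑ = ∫⁻ y, Φ (l, ‖f y‖) := by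
    intro l
    rw [← lintegral_const_mul' _ _ ENNReal.ofReal_ne_top]
    refine lintegral_congr fun y => ?_
    simp only [hΦ]
    congr 1
    by_cases h : c * l < ‖f y‖ <;> simp [h]
  simp only [e1]
  rw [lintegral_lintegral_norm_swap hf hΦm, ← lintegral_const_mul' _ _ ENNReal.ofReal_ne_top]
  refine lintegral_mono fun y => ?_
  set r := ‖f y‖ with hr
  have hr0 : 0 ≤ r := norm_nonneg _
  have hint : IntegrableOn (fun l : ℝ => l ^ (p - 2)) (Set.Ioc 0 (r / c)) :=
    (intervalIntegrable_iff_integrableOn_Ioc_of_le (by positivity)).1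
      (intervalIntegral.intervalIntegrable_rpow' (by linarith))
  calc ∫⁻ l in Set.Ioi (0 : ℝ), Φ (l, r)
      ≤ ∫⁻ l in Set.Ioi (0 : ℝ), (Set.Ioc 0 (r / c)).indicator
          (fun l => ENNReal.ofReal (l ^ (p - 2)) * ENNReal.ofReal r) l := by
        refine setLIntegral_mono' measurableSet_Ioi fun l (hl : 0 < l) => ?_
        simp only [hΦ]
        by_cases h : c * l < r
        · rw [Set.indicator_of_mem (show (l, r) ∈ {z : ℝ × ℝ | c * z.1 < z.2} from h),
            Set.indicator_of_mem]
          exact ⟨hl, by rw [le_div_iff₀ hc]; linarith⟩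
        · rw [Set.indicator_of_notMem (show (l, r) ∉ {z : ℝ × ℝ | c * z.1 < z.2} from h), mul_zero]
          exact zero_le
    _ ≤ ∫⁻ l, (Set.Ioc 0 (r / c)).indicator
          (fun l => ENNReal.ofReal (l ^ (p - 2)) * ENNReal.ofReal r) l :=
        setLIntegral_le_lintegral _ _
    _ = ENNReal.ofReal ((r / c) ^ (p - 1) / (p - 1)) * ENNReal.ofReal r := by
        rw [lintegral_indicator measurableSet_Ioc, lintegral_mul_const' _ _ ENNReal.ofReal_ne_top,
          ← ofReal_integral_eq_lintegral_ofReal hint,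
          ← intervalIntegral.integral_of_le (by positivity),
          integral_rpow (Or.inl (by linarith)), show p - 2 + 1 = p - 1 by ring,
          Real.zero_rpow (by linarith), sub_zero]
        filter_upwards [ae_restrict_mem measurableSet_Ioc] with l hl
        exact Real.rpow_nonneg hl.1.le _
    _ = _ := by
        rw [← ofReal_norm, ENNReal.ofReal_rpow_of_nonneg hr0 (by linarith),
          ← ENNReal.ofReal_mul' hr0, ← ENNReal.ofReal_mul
            (div_nonneg (by positivity) (by linarith))]
        congr 1
        have h1 : r ^ p = r ^ (p - 1) * r := by
          rcases hr0.eq_or_lt with h | h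
          · rw [← h, Real.zero_rpow (by linarith), mul_zero]
          · rw [← Real.rpow_add_one h.ne', sub_add_cancel]
        have h2 : c ^ (1 - p) = (c ^ (p - 1))⁻¹ := by
          rw [← Real.rpow_neg hc.le, neg_sub]
        rw [Real.div_rpow hr0 hc.le, h1, h2]
        ring

/-- Integrating the squared `L²` norm of the part of `f` below height `c l` against
`l^{p-3} dl`. -/
theorem lintegral_indicator_le_le {n : ℕ} {f : Euc n → ℂ} (hf : AEStronglyMeasurable f volume)
    {p c : ℝ} (hp0 : 0 < p) (hp : p < 2) (hc : 0 < c) :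
    ∫⁻ l in Set.Ioi (0 : ℝ), ENNReal.ofReal (l ^ (p - 3)) *
        ∫⁻ y, ‖{y | ‖f y‖ ≤ c * l}.indicator f y‖ₑ ^ 2 ≤
      ENNReal.ofReal (c ^ (2 - p) / (2 - p)) * ∫⁻ y, ‖f y‖ₑ ^ p := by
  set Φ : ℝ × ℝ → ℝ≥0∞ := fun z =>
    ENNReal.ofReal (z.1 ^ (p - 3)) * {z : ℝ × ℝ | z.2 ≤ c * z.1}.indicator
      (fun z => ENNReal.ofReal z.2 ^ 2) z with hΦ
  have hΦm : Measurable Φ := by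
    have h1 : MeasurableSet {z : ℝ × ℝ | z.2 ≤ c * z.1} :=
      measurableSet_le (by fun_prop) (by fun_prop)
    have h2 : Measurable fun z : ℝ × ℝ => ENNReal.ofReal z.2 ^ 2 := by fun_prop
    have h3 : Measurable fun z : ℝ × ℝ => ENNReal.ofReal (z.1 ^ (p - 3)) := by fun_prop
    exact h3.mul (h2.indicator h1)
  have e1 : ∀ l : ℝ, ENNReal.ofReal (l ^ (p - 3)) *
      ∫⁻ y, ‖{y | ‖f y‖ ≤ c * l}.indicator f y‖ₑ ^ 2 = ∫⁻ y, Φ (l, ‖f y‖) := by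
    intro l
    rw [← lintegral_const_mul' _ _ ENNReal.ofReal_ne_top]
    refine lintegral_congr fun y => ?_
    simp only [hΦ]
    congr 1
    by_cases h : ‖f y‖ ≤ c * l <;> simp [h]
  simp only [e1]
  rw [lintegral_lintegral_norm_swap hf hΦm, ← lintegral_const_mul' _ _ ENNReal.ofReal_ne_top]
  refine lintegral_mono fun y => ?_
  set r := ‖f y‖ with hr
  rcases (norm_nonneg (f y)).eq_or_lt with h0 | hr0
  · have : r = 0 := h0.symm
    have h1 : ∀ l, Φ (l, r) = 0 := fun l => by
      simp only [hΦ, this]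
      by_cases h : 0 ≤ c * l <;> simp [h]
    simp [h1]
  rw [← hr] at hr0
  have hrc : 0 < r / c := by positivity
  have hint : IntegrableOn (fun l : ℝ => l ^ (p - 3)) (Set.Ioi (r / c)) :=
    integrableOn_Ioi_rpow_of_lt (by linarith) hrc
  calc ∫⁻ l in Set.Ioi (0 : ℝ), Φ (l, r)
      ≤ ∫⁻ l in Set.Ioi (0 : ℝ), (Set.Ici (r / c)).indicator
          (fun l => ENNReal.ofReal (l ^ (p - 3)) * ENNReal.ofReal (r ^ 2)) l := by
        refine setLIntegral_mono' measurableSet_Ioi fun l (hl : 0 < l) => ?_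
        simp only [hΦ]
        by_cases h : r ≤ c * l
        · rw [Set.indicator_of_mem (show (l, r) ∈ {z : ℝ × ℝ | z.2 ≤ c * z.1} from h),
            Set.indicator_of_mem, ENNReal.ofReal_pow hr0.le]
          exact (by rw [div_le_iff₀ hc]; linarith : r / c ≤ l)
        · rw [Set.indicator_of_notMem (show (l, r) ∉ {z : ℝ × ℝ | z.2 ≤ c * z.1} from h), mul_zero]
          exact zero_le
    _ ≤ ∫⁻ l, (Set.Ici (r / c)).indicator
          (fun l => ENNReal.ofReal (l ^ (p - 3)) * ENNReal.ofReal (r ^ 2)) l :=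
        setLIntegral_le_lintegral _ _
    _ = ENNReal.ofReal ((r / c) ^ (p - 2) / (2 - p)) * ENNReal.ofReal (r ^ 2) := by
        rw [lintegral_indicator measurableSet_Ici, lintegral_mul_const' _ _ ENNReal.ofReal_ne_top,
          setLIntegral_congr Ioi_ae_eq_Ici.symm,
          ← ofReal_integral_eq_lintegral_ofReal hint, integral_Ioi_rpow_of_lt (by linarith) hrc,
          show p - 3 + 1 = p - 2 by ring, neg_div, ← div_neg, neg_sub]
        filter_upwards [ae_restrict_mem measurableSet_Ioi] with l hl
        exact Real.rpow_nonneg (hrc.le.trans (le_of_lt hl)) _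
    _ = _ := by
        rw [← ofReal_norm, ← hr, ENNReal.ofReal_rpow_of_nonneg hr0.le hp0.le,
          ← ENNReal.ofReal_mul' (by positivity), ← ENNReal.ofReal_mul
            (div_nonneg (by positivity) (by linarith))]
        congr 1
        have h1 : r ^ p = r ^ (p - 2) * r ^ 2 := by
          rw [← Real.rpow_natCast r 2, ← Real.rpow_add hr0]
          norm_num
        have h2 : c ^ (2 - p) = (c ^ (p - 2))⁻¹ := by
          rw [← Real.rpow_neg hc.le, neg_sub]
        rw [Real.div_rpow hr0.le hc.le, h1, h2]
        ring

/-- The distributional form of Marcinkiewicz interpolation between the exponents `1` and `2`. -/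
theorem lintegral_rpow_le_of_meas_le {n : ℕ} {f : Euc n → ℂ} (hf : AEStronglyMeasurable f volume)
    {p A B c : ℝ} (hp1 : 1 < p) (hp2 : p < 2) (hA : 0 ≤ A) (hB : 0 ≤ B) (hc : 0 < c)
    (G : Euc n → ℝ≥0∞)
    (hG : ∀ l, 0 < l → volume {x | ENNReal.ofReal l < G x} ≤
      ENNReal.ofReal (A / l) * (∫⁻ y, ‖{y | c * l < ‖f y‖}.indicator f y‖ₑ) +
      ENNReal.ofReal (B / l ^ 2) * ∫⁻ y, ‖{y | ‖f y‖ ≤ c * l}.indicator f y‖ₑ ^ 2) :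
    ∫⁻ x, G x ^ p ≤ ENNReal.ofReal
      (p * (A * (c ^ (1 - p) / (p - 1)) + B * (c ^ (2 - p) / (2 - p)))) * ∫⁻ y, ‖f y‖ₑ ^ p := by
  have hA' : 0 ≤ A * (c ^ (1 - p) / (p - 1)) :=
    mul_nonneg hA (div_nonneg (by positivity) (by linarith))
  have hB' : 0 ≤ B * (c ^ (2 - p) / (2 - p)) :=
    mul_nonneg hB (div_nonneg (by positivity) (by linarith))
  refine (lintegral_rpow_le_lintegral_meas volume G (by linarith)).trans ?_
  rw [ENNReal.ofReal_mul (by linarith), mul_assoc]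
  refine mul_le_mul_right ?_ _
  have hm : AEMeasurable (fun l : ℝ => ENNReal.ofReal A * (ENNReal.ofReal (l ^ (p - 2)) *
      ∫⁻ y, ‖{y | c * l < ‖f y‖}.indicator f y‖ₑ)) (volume.restrict (Set.Ioi 0)) := by
    have h1 : Measurable fun l : ℝ => ENNReal.ofReal (l ^ (p - 2)) := by fun_prop
    have h2 : Antitone fun l : ℝ => ∫⁻ y, ‖{y | c * l < ‖f y‖}.indicator f y‖ₑ := by
      intro l l' hll
      refine lintegral_mono fun y => enorm_indicator_le_of_subset (fun y hy => ?_) _ _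
      exact (mul_le_mul_of_nonneg_left hll hc.le).trans_lt hy
    exact ((h1.mul h2.measurable).const_mul _).aemeasurable
  calc _ ≤ ∫⁻ l in Set.Ioi (0 : ℝ), (ENNReal.ofReal A * (ENNReal.ofReal (l ^ (p - 2)) *
          ∫⁻ y, ‖{y | c * l < ‖f y‖}.indicator f y‖ₑ) +
        ENNReal.ofReal B * (ENNReal.ofReal (l ^ (p - 3)) *
          ∫⁻ y, ‖{y | ‖f y‖ ≤ c * l}.indicator f y‖ₑ ^ 2)) := by
        refine setLIntegral_mono' measurableSet_Ioi fun l (hl : 0 < l) => ?_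
        refine (mul_le_mul_left (hG l hl) _).trans (le_of_eq ?_)
        have h1 : A / l * l ^ (p - 1) = A * l ^ (p - 2) := by
          rw [show p - 1 = p - 2 + 1 by ring, Real.rpow_add_one hl.ne']
          field_simp
        have h2 : B / l ^ 2 * l ^ (p - 1) = B * l ^ (p - 3) := by
          rw [show p - 1 = p - 3 + 1 + 1 by ring, Real.rpow_add_one hl.ne',
            Real.rpow_add_one hl.ne']
          field_simp
        rw [add_mul, mul_right_comm, mul_right_comm (ENNReal.ofReal (B / l ^ 2)),
          ← ENNReal.ofReal_mul (by positivity), ← ENNReal.ofReal_mul (by positivity), h1, h2,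
          ENNReal.ofReal_mul hA, ENNReal.ofReal_mul hB, mul_assoc, mul_assoc]
    _ ≤ ENNReal.ofReal A * (ENNReal.ofReal (c ^ (1 - p) / (p - 1)) * ∫⁻ y, ‖f y‖ₑ ^ p) +
        ENNReal.ofReal B * (ENNReal.ofReal (c ^ (2 - p) / (2 - p)) * ∫⁻ y, ‖f y‖ₑ ^ p) := by
        rw [lintegral_add_left' hm, lintegral_const_mul' _ _ ENNReal.ofReal_ne_top,
          lintegral_const_mul' _ _ ENNReal.ofReal_ne_top]
        gcongr
        · exact lintegral_indicator_gt_le hf hp1 hc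
        · exact lintegral_indicator_le_le hf (by linarith) hp2 hc
    _ = _ := by
        rw [← mul_assoc, ← mul_assoc, ← add_mul, ← ENNReal.ofReal_mul hA, ← ENNReal.ofReal_mul hB,
          ← ENNReal.ofReal_add hA' hB']

/-! ### From decompositions `L¹ + L²` to `L^p` bounds -/

/-- The Hardy-Littlewood maximal theorem. -/
theorem exists_lintegral_maxFn_rpow_le {n : ℕ} (hn : 1 ≤ n) {p : ℝ} (hp : 1 < p) :
    ∃ C : ℝ, 0 < C ∧ ∀ f : Euc n → ℂ, AEStronglyMeasurable f volume →
      ∫⁻ x, maxFn f x ^ p ≤ ENNReal.ofReal C * ∫⁻ y, ‖f y‖ₑ ^ p := by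
  have hp' : 0 < p - 1 := by linarith
  refine ⟨p * (2 * 5 ^ n * ((1 / 2 : ℝ) ^ (1 - p) / (p - 1))), by positivity, fun f hf => ?_⟩
  refine (lintegral_rpow_le_lintegral_meas volume _ (by linarith)).trans ?_
  rw [ENNReal.ofReal_mul (by linarith), mul_assoc]
  refine mul_le_mul_right ?_ _
  calc _ ≤ ∫⁻ l in Set.Ioi (0 : ℝ), ENNReal.ofReal (2 * 5 ^ n) * (ENNReal.ofReal (l ^ (p - 2)) *
          ∫⁻ y, ‖{y | 1 / 2 * l < ‖f y‖}.indicator f y‖ₑ) := by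
        refine setLIntegral_mono' measurableSet_Ioi fun l (hl : 0 < l) => ?_
        refine (mul_le_mul_left (maxFn_weak_truncated hn hf hl) _).trans (le_of_eq ?_)
        have h1 : 2 * 5 ^ n / l * l ^ (p - 1) = 2 * 5 ^ n * l ^ (p - 2) := by
          rw [show p - 1 = p - 2 + 1 by ring, Real.rpow_add_one hl.ne']
          field_simp
        have h2 : NullMeasurableSet {y | l / 2 < ‖f y‖} volume :=
          nullMeasurableSet_lt aemeasurable_const hf.norm.aemeasurable
        rw [mul_right_comm, ← ENNReal.ofReal_mul (by positivity), h1,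
          ENNReal.ofReal_mul (by positivity), mul_assoc, ← lintegral_indicator₀ h2]
        simp only [enorm_indicator_eq_indicator_enorm, one_div, inv_mul_eq_div]
    _ ≤ _ := by
        rw [lintegral_const_mul' _ _ ENNReal.ofReal_ne_top,
          ENNReal.ofReal_mul (show (0 : ℝ) ≤ 2 * 5 ^ n by positivity), mul_assoc]
        gcongr
        exact lintegral_indicator_gt_le (c := 1 / 2) hf hp (by norm_num)

/-- Along every decomposition `f = u + v` with `u ∈ L¹` and `v ∈ L²`, the function `G` is at most
`a` times the maximal function of `u` plus a function whose `L²` norm is at most `b ‖v‖₂`. -/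
def SplitBound {n : ℕ} (G : Euc n → ℝ≥0∞) (f : Euc n → ℂ) (a b : ℝ) : Prop :=
  ∀ u v : Euc n → ℂ, Integrable u → MemLp v 2 volume → f = u + v →
    ∃ T : Euc n → ℝ≥0∞, Measurable T ∧
      ∫⁻ x, T x ^ 2 ≤ ENNReal.ofReal (b ^ 2) * ∫⁻ y, ‖v y‖ₑ ^ 2 ∧
      ∀ x, G x ≤ ENNReal.ofReal a * maxFn u x + T x

theorem exists_lintegral_rpow_le_of_splitBound {n : ℕ} (hn : 1 ≤ n) {p : ℝ} (hp1 : 1 < p)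
    (hp2 : p ≤ 2) :
    ∃ K : ℝ, 0 < K ∧ ∀ {a b : ℝ}, 0 < a → 0 < b → ∀ (f : Euc n → ℂ) (G : Euc n → ℝ≥0∞),
      MemLp f (ENNReal.ofReal p) volume → SplitBound G f a b →
      ∫⁻ x, G x ^ p ≤ ENNReal.ofReal (K * (a ^ (2 - p) * b ^ (2 * p - 2))) *
        ∫⁻ y, ‖f y‖ₑ ^ p := by
  rcases hp2.eq_or_lt with rfl | hp2
  -- for `p = 2` the trivial decomposition `f = 0 + f` is enough
  · refine ⟨1, one_pos, fun {a b} ha hb f G hf hG => ?_⟩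
    rw [ENNReal.ofReal_ofNat] at hf
    obtain ⟨T, -, hT, hGT⟩ := hG 0 f (integrable_zero _ _ _) hf (zero_add f).symm
    have h0 : ∀ x, maxFn (0 : Euc n → ℂ) x = 0 := fun x =>
      le_antisymm (maxFn_le_of_bound (fun y => by simp) x) zero_le
    simp only [h0, mul_zero, zero_add] at hGT
    simp only [ENNReal.rpow_two]
    calc _ ≤ ∫⁻ x, T x ^ 2 := lintegral_mono fun x => by gcongr; exact hGT x
      _ ≤ _ := hT
      _ = _ := by
        rw [sub_self, Real.rpow_zero, one_mul, one_mul, show (2 * 2 - 2 : ℝ) = (2 : ℕ) by norm_num,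
          Real.rpow_natCast]
  · have hp1' : 0 < p - 1 := by linarith
    have hp2' : 0 < 2 - p := by linarith
    refine ⟨p * (2 * 5 ^ n / (p - 1) + 4 / (2 - p)), by positivity,
      fun {a b} ha hb f G hf hG => ?_⟩
    -- the truncation height which balances the weak `L¹` and the `L²` contributions
    set c := a / b ^ 2 with hc
    have hc0 : 0 < c := by positivity
    have h := lintegral_rpow_le_of_meas_le hf.1 hp1 hp2 (A := 2 * 5 ^ n * a) (B := 4 * b ^ 2)
      (by positivity) (by positivity) hc0 G (fun l hl => by
        have hcl : 0 < c * l := by positivity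
        set u := {y | c * l < ‖f y‖}.indicator f with hu
        set v := {y | ‖f y‖ ≤ c * l}.indicator f with hv
        have hfuv : f = u + v := by
          ext y
          simp only [hu, hv, Pi.add_apply]
          by_cases hy : c * l < ‖f y‖
          · rw [Set.indicator_of_mem (show y ∈ {y | c * l < ‖f y‖} from hy),
              Set.indicator_of_notMem (show y ∉ {y | ‖f y‖ ≤ c * l} from not_le.2 hy), add_zero]
          · rw [Set.indicator_of_notMem (show y ∉ {y | c * l < ‖f y‖} from hy),
              Set.indicator_of_mem (show y ∈ {y | ‖f y‖ ≤ c * l} from not_lt.1 hy), zero_add]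
        obtain ⟨T, hTm, hT, hGT⟩ := hG u v (integrable_indicator_gt hp1.le hf hcl)
          (memLp_two_indicator_le hp1.le hp2.le hf hcl) hfuv
        have hsub : {x | ENNReal.ofReal l < G x} ⊆
            {x | ENNReal.ofReal (l / (2 * a)) < maxFn u x} ∪
            {x | ENNReal.ofReal ((l / 2) ^ 2) ≤ T x ^ 2} := by
          intro x hx
          by_contra hcon
          simp only [Set.mem_union, Set.mem_ofPred_eq, not_or, not_lt, not_le] at hcon hx
          have h1 : T x ≤ ENNReal.ofReal (l / 2) := by
            rw [ENNReal.ofReal_pow (by positivity)] at hcon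
            exact ((ENNReal.pow_right_strictMono two_ne_zero).lt_iff_lt.1 hcon.2).le
          have h2 : G x ≤ ENNReal.ofReal l := by
            calc G x ≤ _ := hGT x
              _ ≤ ENNReal.ofReal a * ENNReal.ofReal (l / (2 * a)) + ENNReal.ofReal (l / 2) := by
                gcongr
                exact hcon.1
              _ = ENNReal.ofReal l := by
                rw [← ENNReal.ofReal_mul ha.le,
                  ← ENNReal.ofReal_add (by positivity) (by positivity)]
                congr 1
                field_simp
                ring
          exact absurd hx (not_lt.2 h2)
        calc _ ≤ _ := (measure_mono hsub).trans (measure_union_le _ _)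
          _ ≤ ENNReal.ofReal (5 ^ n / (l / (2 * a))) * (∫⁻ y, ‖u y‖ₑ) +
              (∫⁻ x, T x ^ 2) / ENNReal.ofReal ((l / 2) ^ 2) := by
              gcongr
              · exact maxFn_weak hn u (by positivity)
              · exact meas_ge_le_lintegral_div (hTm.pow_const 2).aemeasurable
                  (ENNReal.ofReal_pos.2 (by positivity)).ne' ENNReal.ofReal_ne_top
          _ ≤ ENNReal.ofReal (2 * 5 ^ n * a / l) * (∫⁻ y, ‖u y‖ₑ) +
              ENNReal.ofReal (4 * b ^ 2 / l ^ 2) * ∫⁻ y, ‖v y‖ₑ ^ 2 := by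
              gcongr ?_ + ?_
              · refine le_of_eq ?_
                congr 2
                field_simp
              · refine (ENNReal.div_le_div_right hT _).trans (le_of_eq ?_)
                rw [ENNReal.div_eq_inv_mul, ← mul_assoc,
                  ← ENNReal.ofReal_inv_of_pos (by positivity),
                  ← ENNReal.ofReal_mul (by positivity)]
                congr 2
                field_simp
                norm_num)
    refine h.trans (le_of_eq ?_)
    congr 2
    have e1 : a * c ^ (1 - p) = a ^ (2 - p) * b ^ (2 * p - 2) := by
      rw [hc, Real.div_rpow ha.le (by positivity), ← Real.rpow_natCast b 2,
        ← Real.rpow_mul hb.le, div_eq_mul_inv, ← Real.rpow_neg hb.le, ← mul_assoc,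
        mul_comm a, ← Real.rpow_add_one ha.ne']
      congr 2 <;> push_cast <;> ring
    have e2 : b ^ 2 * c ^ (2 - p) = a ^ (2 - p) * b ^ (2 * p - 2) := by
      rw [hc, Real.div_rpow ha.le (by positivity), ← Real.rpow_natCast b 2,
        ← Real.rpow_mul hb.le, div_eq_mul_inv, ← Real.rpow_neg hb.le, mul_left_comm,
        ← Real.rpow_add hb]
      congr 2
      push_cast
      ring
    calc _ = p * (2 * 5 ^ n / (p - 1) * (a * c ^ (1 - p)) +
          4 / (2 - p) * (b ^ 2 * c ^ (2 - p))) := by ring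
      _ = _ := by rw [e1, e2]; ring

theorem eLpNorm_le_of_lintegral_rpow_le {n : ℕ} {p M : ℝ} (hp : 0 < p) (hM : 0 ≤ M)
    {G : Euc n → ℝ≥0∞} {f : Euc n → ℂ}
    (h : ∫⁻ x, G x ^ p ≤ ENNReal.ofReal M * ∫⁻ y, ‖f y‖ₑ ^ p) :
    eLpNorm G (ENNReal.ofReal p) volume ≤
      ENNReal.ofReal (M ^ (1 / p)) * eLpNorm f (ENNReal.ofReal p) volume := by
  have h0 : ENNReal.ofReal p ≠ 0 := (ENNReal.ofReal_pos.2 hp).ne'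
  rw [eLpNorm_eq_lintegral_rpow_enorm_toReal h0 ENNReal.ofReal_ne_top,
    eLpNorm_eq_lintegral_rpow_enorm_toReal h0 ENNReal.ofReal_ne_top, ENNReal.toReal_ofReal hp.le,
    ← ENNReal.ofReal_rpow_of_nonneg hM (by positivity),
    ← ENNReal.mul_rpow_of_nonneg _ _ (by positivity)]
  simp only [enorm_eq_self]
  gcongr

/-- The constants `C λ^α` and `C λ^β` of a family of decomposition bounds, `λ = 2^j`, interpolate
to `λ^e` with `e = α (2/p - 1) + β (2 - 2/p)`. The finitely many `j` with `λ < 4` are covered by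
the maximal theorem. -/
theorem exists_eLpNorm_le_of_splitBound {n : ℕ} (hn : 1 ≤ n) {p : ℝ} (hp1 : 1 < p) (hp2 : p ≤ 2)
    {α β e C D : ℝ} (hC : 0 < C) (hD : 0 < D) (he : e = α * (2 / p - 1) + β * (2 - 2 / p))
    (he1 : -1 ≤ e) {G : ℕ → (Euc n → ℂ) → Euc n → ℝ≥0∞}
    (hhigh : ∀ j, 2 ≤ j → ∀ f, MemLp f (ENNReal.ofReal p) volume →
      SplitBound (G j f) f (C * ((2 : ℝ) ^ j) ^ α) (C * ((2 : ℝ) ^ j) ^ β))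
    (hlow : ∀ j, j < 2 → ∀ f, MemLp f (ENNReal.ofReal p) volume →
      ∀ x, G j f x ≤ ENNReal.ofReal D * maxFn f x) :
    ∃ C' : ℝ, 0 < C' ∧ ∀ j f, MemLp f (ENNReal.ofReal p) volume →
      eLpNorm (G j f) (ENNReal.ofReal p) volume ≤
        ENNReal.ofReal (C' * (2 : ℝ) ^ ((j : ℝ) * e)) * eLpNorm f (ENNReal.ofReal p) volume := by
  have hp0 : 0 < p := by linarith
  obtain ⟨K, hK, hint⟩ := exists_lintegral_rpow_le_of_splitBound hn hp1 hp2
  obtain ⟨H, hH, hmax⟩ := exists_lintegral_maxFn_rpow_le hn hp1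
  refine ⟨(K * C ^ p) ^ (1 / p) + 2 * (D ^ p * H) ^ (1 / p), by positivity, fun j f hf => ?_⟩
  rcases le_or_gt 2 j with hj | hj
  · have h := eLpNorm_le_of_lintegral_rpow_le hp0 (by positivity)
      (hint (by positivity) (by positivity) f (G j f) hf (hhigh j hj f hf))
    refine h.trans (mul_le_mul_left (ENNReal.ofReal_le_ofReal ?_) _)
    have hl : (0 : ℝ) < 2 ^ j := by positivity
    have e1 : K * ((C * ((2 : ℝ) ^ j) ^ α) ^ (2 - p) * (C * ((2 : ℝ) ^ j) ^ β) ^ (2 * p - 2)) =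
        K * C ^ p * ((2 : ℝ) ^ j) ^ (p * e) := by
      rw [Real.mul_rpow hC.le (by positivity), Real.mul_rpow hC.le (by positivity),
        ← Real.rpow_mul hl.le, ← Real.rpow_mul hl.le]
      have e2 : C ^ p = C ^ (2 - p) * C ^ (2 * p - 2) := by
        rw [← Real.rpow_add hC]; congr 1; ring
      have e3 : ((2 : ℝ) ^ j) ^ (p * e) =
          ((2 : ℝ) ^ j) ^ (α * (2 - p)) * ((2 : ℝ) ^ j) ^ (β * (2 * p - 2)) := by
        rw [← Real.rpow_add hl, he]; congr 1; field_simp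
      rw [e2, e3]
      ring
    rw [e1, Real.mul_rpow (by positivity) (by positivity), ← Real.rpow_mul hl.le,
      mul_one_div, mul_div_cancel_left₀ _ hp0.ne', ← Real.rpow_natCast 2 j,
      ← Real.rpow_mul zero_le_two]
    gcongr
    exact le_add_of_nonneg_right (by positivity)
  · have h1 : ∫⁻ x, G j f x ^ p ≤ ENNReal.ofReal (D ^ p * H) * ∫⁻ y, ‖f y‖ₑ ^ p := by
      calc _ ≤ ∫⁻ x, (ENNReal.ofReal D * maxFn f x) ^ p := by
            refine lintegral_mono fun x => ?_
            gcongr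
            exact hlow j hj f hf x
        _ = ENNReal.ofReal (D ^ p) * ∫⁻ x, maxFn f x ^ p := by
            rw [← lintegral_const_mul' _ _ ENNReal.ofReal_ne_top]
            refine lintegral_congr fun x => ?_
            rw [ENNReal.mul_rpow_of_nonneg _ _ hp0.le, ENNReal.ofReal_rpow_of_nonneg hD.le hp0.le]
        _ ≤ _ := by
            rw [ENNReal.ofReal_mul (by positivity), mul_assoc]
            gcongr
            exact hmax f hf.1
    refine (eLpNorm_le_of_lintegral_rpow_le hp0 (by positivity) h1).trans
      (mul_le_mul_left (ENNReal.ofReal_le_ofReal ?_) _)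
    have hj' : (j : ℝ) ≤ 1 := by exact_mod_cast (by omega : j ≤ 1)
    -- `j ≤ 1` and `e ≥ -1`, so the claimed power of `2` is not small
    have h2 : (1 / 2 : ℝ) ≤ 2 ^ ((j : ℝ) * e) := by
      calc (1 / 2 : ℝ) = 2 ^ (-1 : ℝ) := by rw [Real.rpow_neg_one]; norm_num
        _ ≤ _ := by
          apply Real.rpow_le_rpow_of_exponent_le one_le_two
          have := (Nat.cast_nonneg j : (0 : ℝ) ≤ j)
          nlinarith
    have h3 : 0 < (D ^ p * H) ^ (1 / p) := by positivity
    have h4 : 0 < (K * C ^ p) ^ (1 / p) := by positivity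
    nlinarith

/-! ### The localized maximal and square functions -/

section Localized

variable {n : ℕ} {p : ℝ} {ψ : ℝ → ℂ} {f u v : Euc n → ℂ}

theorem integrable_highPart (hp1 : 1 < p) (hf : MemLp f (ENNReal.ofReal p) volume) :
    Integrable (highPart f) :=
  highPart_eq_indicator f ▸ integrable_indicator_gt hp1.le hf one_pos

theorem memLp_lowPart (hp1 : 1 < p) (hp2 : p ≤ 2) (hf : MemLp f (ENNReal.ofReal p) volume) :
    MemLp (lowPart f) 2 volume :=
  lowPart_eq_indicator f ▸ memLp_two_indicator_le hp1.le hp2 hf one_pos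

theorem stronglyMeasurable_fourierL2 (v : Euc n → ℂ) : StronglyMeasurable (fourierL2 v) := by
  unfold fourierL2
  split_ifs
  · exact Lp.stronglyMeasurable _
  · exact stronglyMeasurable_zero

theorem lintegral_fourierL2_sq (hv : MemLp v 2 volume) :
    ∫⁻ ξ, ‖fourierL2 v ξ‖ₑ ^ 2 = ∫⁻ y, ‖v y‖ₑ ^ 2 := by
  rw [lintegral_enorm_sq_eq, lintegral_enorm_sq_eq, eLpNorm_fourierL2 hv]

theorem BPsi_eq_add (hp1 : 1 < p) (hp2 : p ≤ 2) (hψ : IsBump ψ)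
    (hf : MemLp f (ENNReal.ofReal p) volume) (hu : Integrable u) (hv : MemLp v 2 volume)
    (huv : f = u + v) (j : ℕ) {t : ℝ} (ht : 0 < t) (x : Euc n) :
    BPsi ψ j t f x = dilOp ψ (2 ^ j) t (𝓕 u) x + dilOp ψ (2 ^ j) t (fourierL2 v) x :=
  have hl : (0 : ℝ) < 2 ^ j := by positivity
  multiplierOp_eq (m := dil ψ (2 ^ j) t) (integrable_dil hψ hl ht) (memLp_dil hψ hl ht)
    (integrable_highPart hp1 hf) (memLp_lowPart hp1 hp2 hf) hu hv (ae_of_all _ (congrFun huv)) x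

theorem squareSup_le_supOp (F : ℝ → Euc n → ℂ) (x : Euc n) : squareSup F x ≤ supOp F x := by
  refine iSup₂_le fun R hR => ?_
  rw [one_div, ENNReal.rpow_inv_le_iff (by norm_num), ENNReal.rpow_two]
  calc _ ≤ (ENNReal.ofReal R)⁻¹ * ∫⁻ _ in Set.Ioc 0 R, supOp F x ^ 2 := by
        refine mul_le_mul_right (setLIntegral_mono' measurableSet_Ioc fun t ht => ?_) _
        gcongr
        exact le_iSup₂ (f := fun (t : ℝ) (_ : 0 < t) => ‖F t x‖ₑ) t ht.1
    _ = _ := by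
        rw [setLIntegral_const, Real.volume_Ioc, sub_zero, mul_comm (supOp F x ^ 2), ← mul_assoc,
          ENNReal.inv_mul_cancel (ENNReal.ofReal_pos.2 hR).ne' ENNReal.ofReal_ne_top, one_mul]

/-- The maximal function of `B^ψ_{2^{-j},t} f` is controlled pointwise by the Hardy-Littlewood
maximal function, with a constant depending on `j`. -/
theorem exists_supOp_BPsi_le_maxFn (hn : 1 ≤ n) (hp1 : 1 < p) (hp2 : p ≤ 2) (hψ : IsBump ψ) :
    ∃ D : ℝ, 0 < D ∧ ∀ j : ℕ, j < 2 → ∀ f : Euc n → ℂ, MemLp f (ENNReal.ofReal p) volume →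
      ∀ x, supOp (fun t => BPsi ψ j t f) x ≤ ENNReal.ofReal D * maxFn f x := by
  obtain ⟨C, hC, hker⟩ := exists_dil_fourier_le_maxFn n hn hψ
  have hn' : (0 : ℝ) ≤ ((n : ℝ) - 1) / 2 := by
    have : (1 : ℝ) ≤ n := by exact_mod_cast hn
    linarith
  refine ⟨2 * (C * 2 ^ (((n : ℝ) - 1) / 2)), by positivity, fun j hj f hf x => ?_⟩
  have hl1 : (1 : ℝ) ≤ 2 ^ j := one_le_pow₀ one_le_two
  have hl2 : (2 : ℝ) ^ j ≤ 2 := by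
    calc (2 : ℝ) ^ j ≤ 2 ^ 1 := pow_le_pow_right₀ one_le_two (by omega)
      _ = 2 := pow_one 2
  have hA : ENNReal.ofReal (C * ((2 : ℝ) ^ j) ^ (((n : ℝ) - 1) / 2)) ≤
      ENNReal.ofReal (C * 2 ^ (((n : ℝ) - 1) / 2)) := by
    apply ENNReal.ofReal_le_ofReal
    gcongr
  have hh := integrable_highPart hp1 hf
  have hlow := memLp_lowPart hp1 hp2 hf
  refine iSup₂_le fun t ht => ?_
  change ‖BPsi ψ j t f x‖ₑ ≤ _
  rw [BPsi_eq_add hp1 hp2 hψ hf hh hlow (highPart_add_lowPart f).symm j ht x]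
  have b1 : ∀ u, Integrable u → ‖dilOp ψ (2 ^ j) t (𝓕 u) x‖ₑ ≤
      ENNReal.ofReal (C * 2 ^ (((n : ℝ) - 1) / 2)) * maxFn u x := fun u hu =>
    (hker _ hl1 u hu t ht x).trans (mul_le_mul_left hA _)
  have b2 := dil_fourierL2_le_of_forall_integrable hψ (by linarith) ht b1 hlow
  calc _ ≤ ‖dilOp ψ (2 ^ j) t (𝓕 (highPart f)) x‖ₑ +
        ‖dilOp ψ (2 ^ j) t (fourierL2 (lowPart f)) x‖ₑ := enorm_add_le _ _
    _ ≤ ENNReal.ofReal (C * 2 ^ (((n : ℝ) - 1) / 2)) * maxFn f x +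
        ENNReal.ofReal (C * 2 ^ (((n : ℝ) - 1) / 2)) * maxFn f x := by
        refine add_le_add ((b1 _ hh).trans (mul_le_mul_right (maxFn_mono (fun y => ?_) x) _))
          (b2.trans (mul_le_mul_right (maxFn_mono (fun y => ?_) x) _))
        · rw [highPart_eq_indicator]
          exact enorm_indicator_le_enorm_self _ _
        · rw [lowPart_eq_indicator]
          exact enorm_indicator_le_enorm_self _ _
    _ = _ := by
        rw [← two_mul, ← mul_assoc, ENNReal.ofReal_mul zero_le_two, ENNReal.ofReal_ofNat]

/-- For the maximal operator the constants are `λ^{(n-1)/2}` at `L¹` and `1` at `L²`,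
with `λ = 2^j`. -/
theorem exists_splitBound_maximalPsi (hn : 1 ≤ n) (hp1 : 1 < p) (hp2 : p ≤ 2) (hψ : IsBump ψ) :
    ∃ C : ℝ, 0 < C ∧ ∀ j : ℕ, 2 ≤ j → ∀ f : Euc n → ℂ,
      MemLp f (ENNReal.ofReal p) volume →
      SplitBound (maximalPsi ψ j f) f (C * ((2 : ℝ) ^ j) ^ (((n : ℝ) - 1) / 2))
        (C * ((2 : ℝ) ^ j) ^ (0 : ℝ)) := by
  obtain ⟨C, hC, hker⟩ := exists_dil_fourier_le_maxFn n hn hψ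
  obtain ⟨B, hB0, hB⟩ := hψ.exists_bound
  obtain ⟨B', hB'0, hB'⟩ := hψ.deriv.exists_bound
  obtain ⟨C', hC'⟩ : ∃ C', C' = C + 8 * (B ^ 2 + B' ^ 2) + 1 := ⟨_, rfl⟩
  refine ⟨C', by rw [hC']; positivity, fun j hj f hf u v hu hv huv => ?_⟩
  have hl4 : (4 : ℝ) ≤ 2 ^ j := by
    calc (4 : ℝ) = 2 ^ 2 := by norm_num
      _ ≤ 2 ^ j := pow_le_pow_right₀ one_le_two hj
  have hP : 0 ≤ B ^ 2 + B' ^ 2 := by positivity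
  refine ⟨supOp fun t => dilOp ψ (2 ^ j) t (fourierL2 v), ?_, ?_, fun x => ?_⟩
  · exact (lowerSemicontinuous_biSup fun t ht => (continuous_dilOp hψ (by linarith) ht
      (memLp_fourierL2 v)).enorm.lowerSemicontinuous).measurable
  · refine (lintegral_sup_dilOp_sq_le hn hψ hl4 hB hB' (stronglyMeasurable_fourierL2 v)
      (memLp_fourierL2 v)).trans ?_
    rw [lintegral_fourierL2_sq hv, Real.rpow_zero, mul_one]
    refine mul_le_mul_left (ENNReal.ofReal_le_ofReal ?_) _
    nlinarith
  · refine iSup₂_le fun t ht => ?_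
    change ‖BPsi ψ j t f x‖ₑ ≤ _
    rw [BPsi_eq_add hp1 hp2 hψ hf hu hv huv j ht x]
    refine (enorm_add_le _ _).trans (add_le_add ?_ ?_)
    · refine (hker _ (by linarith) u hu t ht x).trans
        (mul_le_mul_left (ENNReal.ofReal_le_ofReal ?_) _)
      gcongr
      linarith
    · exact le_iSup₂ (f := fun (t : ℝ) (_ : 0 < t) => ‖dilOp ψ (2 ^ j) t (fourierL2 v) x‖ₑ) t ht

theorem enorm_add_sq_le (a b : ℂ) : ‖a + b‖ₑ ^ 2 ≤ 2 * ‖a‖ₑ ^ 2 + 2 * ‖b‖ₑ ^ 2 := by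
  simp only [← ofReal_norm]
  rw [← ENNReal.ofReal_pow (norm_nonneg _), ← ENNReal.ofReal_pow (norm_nonneg _),
    ← ENNReal.ofReal_pow (norm_nonneg _), show (2 : ℝ≥0∞) = ENNReal.ofReal 2 by simp,
    ← ENNReal.ofReal_mul zero_le_two, ← ENNReal.ofReal_mul zero_le_two,
    ← ENNReal.ofReal_add (by positivity) (by positivity)]
  refine ENNReal.ofReal_le_ofReal ?_
  have h1 := norm_add_le a b
  have h2 := norm_nonneg (a + b)
  nlinarith [sq_nonneg (‖a‖ - ‖b‖)]

/-- A bounded part and a part with finite `dt/t` square function. -/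
theorem squareSup_le_add {F a b : ℝ → Euc n → ℂ} {x : Euc n} {A : ℝ≥0∞}
    (hF : ∀ t, 0 < t → F t x = a t x + b t x) (ha : ∀ t, 0 < t → ‖a t x‖ₑ ≤ A) :
    squareSup F x ≤ 2 * A +
      2 * (∫⁻ t in Set.Ioi (0 : ℝ), ENNReal.ofReal t⁻¹ * ‖b t x‖ₑ ^ 2) ^ (1 / 2 : ℝ) := by
  set S := ∫⁻ t in Set.Ioi (0 : ℝ), ENNReal.ofReal t⁻¹ * ‖b t x‖ₑ ^ 2 with hS
  refine iSup₂_le fun R hR => ?_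
  have hR0 : ENNReal.ofReal R ≠ 0 := (ENNReal.ofReal_pos.2 hR).ne'
  have hSq : (S ^ (1 / 2 : ℝ)) ^ 2 = S := by
    rw [one_div, ← ENNReal.rpow_two, ENNReal.rpow_inv_rpow two_ne_zero]
  rw [one_div, ENNReal.rpow_inv_le_iff (by norm_num), ENNReal.rpow_two]
  calc _ ≤ (ENNReal.ofReal R)⁻¹ * ∫⁻ t in Set.Ioc 0 R,
          (2 * A ^ 2 + 2 * (ENNReal.ofReal R * (ENNReal.ofReal t⁻¹ * ‖b t x‖ₑ ^ 2))) := by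
        refine mul_le_mul_right (setLIntegral_mono' measurableSet_Ioc fun t ht => ?_) _
        rw [hF t ht.1]
        refine (enorm_add_sq_le _ _).trans ?_
        gcongr ?_ + 2 * ?_
        · gcongr
          exact ha t ht.1
        · rw [← mul_assoc, ← ENNReal.ofReal_mul hR.le]
          refine le_mul_of_one_le_left zero_le (ENNReal.one_le_ofReal.2 ?_)
          rw [← div_eq_mul_inv, one_le_div ht.1]
          exact ht.2
    _ ≤ (ENNReal.ofReal R)⁻¹ * (ENNReal.ofReal R * (2 * A ^ 2 + 2 * S)) := by
        gcongr
        rw [lintegral_add_left measurable_const, setLIntegral_const, Real.volume_Ioc, sub_zero,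
          lintegral_const_mul' _ _ ENNReal.ofNat_ne_top,
          lintegral_const_mul' _ _ ENNReal.ofReal_ne_top, mul_add, mul_comm (2 * A ^ 2),
          mul_left_comm 2]
        gcongr
        exact lintegral_mono_set fun t ht => ht.1
    _ = 2 * A ^ 2 + 2 * S := by
        rw [← mul_assoc, ENNReal.inv_mul_cancel hR0 ENNReal.ofReal_ne_top, one_mul]
    _ ≤ 4 * A ^ 2 + 4 * S := by gcongr <;> norm_num
    _ ≤ 4 * A ^ 2 + 4 * (S ^ (1 / 2 : ℝ)) ^ 2 + 8 * A * S ^ (1 / 2 : ℝ) := by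
        rw [hSq]
        exact le_self_add
    _ = _ := by
        rw [one_div]
        ring

/-- For the square function the constants are `λ^{(n-1)/2}` at `L¹` and `λ^{-1/2}` at `L²`,
with `λ = 2^j`. -/
theorem exists_splitBound_squarePsi (hn : 1 ≤ n) (hp1 : 1 < p) (hp2 : p ≤ 2) (hψ : IsBump ψ) :
    ∃ C : ℝ, 0 < C ∧ ∀ j : ℕ, 2 ≤ j → ∀ f : Euc n → ℂ,
      MemLp f (ENNReal.ofReal p) volume →
      SplitBound (squarePsi ψ j f) f (C * ((2 : ℝ) ^ j) ^ (((n : ℝ) - 1) / 2))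
        (C * ((2 : ℝ) ^ j) ^ (-(1 / 2) : ℝ)) := by
  obtain ⟨C, hC, hker⟩ := exists_dil_fourier_le_maxFn n hn hψ
  obtain ⟨B, hB0, hB⟩ := hψ.exists_bound
  obtain ⟨C', hC'⟩ : ∃ C', C' = 2 * C + 4 * B := ⟨_, rfl⟩
  refine ⟨C', by rw [hC']; positivity, fun j hj f hf u v hu hv huv => ?_⟩
  have hl4 : (4 : ℝ) ≤ 2 ^ j := by
    calc (4 : ℝ) = 2 ^ 2 := by norm_num
      _ ≤ 2 ^ j := pow_le_pow_right₀ one_le_two hj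
  have hl0 : (0 : ℝ) < 2 ^ j := by linarith
  have hFm := stronglyMeasurable_fourierL2 v
  refine ⟨fun x => 2 * (∫⁻ t in Set.Ioi (0 : ℝ), ENNReal.ofReal t⁻¹ *
    ‖dilOp ψ (2 ^ j) t (fourierL2 v) x‖ₑ ^ 2) ^ (1 / 2 : ℝ), ?_, ?_, fun x => ?_⟩
  · refine ((Measurable.lintegral_prod_right' (f := fun z : Euc n × ℝ =>
      ENNReal.ofReal z.2⁻¹ * ‖dilOp ψ (2 ^ j) z.2 (fourierL2 v) z.1‖ₑ ^ 2)
      ?_).pow_const _).const_mul _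
    have h2 : Measurable fun z : Euc n × ℝ => ENNReal.ofReal z.2⁻¹ := by fun_prop
    exact h2.mul ((stronglyMeasurable_dilOp hψ hFm).measurable.enorm.pow_const 2)
  · have hsq : ∀ y : ℝ≥0∞, (2 * y ^ (1 / 2 : ℝ)) ^ 2 = 4 * y := fun y => by
      rw [mul_pow, one_div, ← ENNReal.rpow_two (y ^ _), ENNReal.rpow_inv_rpow two_ne_zero]
      norm_num
    simp only [hsq]
    rw [lintegral_const_mul' _ _ ENNReal.ofNat_ne_top]
    calc _ ≤ 4 * (ENNReal.ofReal (4 * B ^ 2 / 2 ^ j) * ∫⁻ y, ‖v y‖ₑ ^ 2) := by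
          rw [← lintegral_fourierL2_sq hv]
          gcongr
          exact lintegral_square_dilOp_le hn hψ hl4 hB hFm (memLp_fourierL2 v)
      _ ≤ _ := by
          rw [← mul_assoc, show (4 : ℝ≥0∞) = ENNReal.ofReal 4 by simp,
            ← ENNReal.ofReal_mul (by norm_num)]
          refine mul_le_mul_left (ENNReal.ofReal_le_ofReal ?_) _
          rw [mul_pow, ← Real.rpow_natCast (((2 : ℝ) ^ j) ^ (-(1 / 2) : ℝ)) 2,
            ← Real.rpow_mul hl0.le, show (-(1 / 2) : ℝ) * (2 : ℕ) = -1 by norm_num,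
            Real.rpow_neg_one, ← div_eq_mul_inv, ← mul_div_assoc]
          gcongr
          nlinarith
  · refine (squareSup_le_add (fun t ht => BPsi_eq_add hp1 hp2 hψ hf hu hv huv j ht x)
      (fun t ht => hker _ (by linarith) u hu t ht x)).trans (add_le_add ?_ le_rfl)
    rw [← mul_assoc, show (2 : ℝ≥0∞) = ENNReal.ofReal 2 by simp, ← ENNReal.ofReal_mul zero_le_two,
      ← mul_assoc]
    refine mul_le_mul_left (ENNReal.ofReal_le_ofReal ?_) _
    gcongr
    linarith

theorem exists_eLpNorm_maximalPsi_le (hn : 1 ≤ n) (hp1 : 1 < p) (hp2 : p ≤ 2) (hψ : IsBump ψ) :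
    ∃ C : ℝ, 0 < C ∧ ∀ (j : ℕ) (f : Euc n → ℂ), MemLp f (ENNReal.ofReal p) volume →
      eLpNorm (maximalPsi ψ j f) (ENNReal.ofReal p) volume ≤
        ENNReal.ofReal (C * (2 : ℝ) ^ ((j : ℝ) * (((n : ℝ) - 1) * (1 / p - 1 / 2)))) *
          eLpNorm f (ENNReal.ofReal p) volume := by
  obtain ⟨C, hC, hhigh⟩ := exists_splitBound_maximalPsi (n := n) hn hp1 hp2 hψ
  obtain ⟨D, hD, hlow⟩ := exists_supOp_BPsi_le_maxFn (n := n) hn hp1 hp2 hψ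
  refine exists_eLpNorm_le_of_splitBound hn hp1 hp2 hC hD (by ring) ?_ hhigh hlow
  have h1 : (1 : ℝ) ≤ n := by exact_mod_cast hn
  have h2 : 1 / 2 ≤ 1 / p := one_div_le_one_div_of_le (by linarith) hp2
  nlinarith

theorem exists_eLpNorm_squarePsi_le (hn : 1 ≤ n) (hp1 : 1 < p) (hp2 : p ≤ 2) (hψ : IsBump ψ) :
    ∃ C : ℝ, 0 < C ∧ ∀ (j : ℕ) (f : Euc n → ℂ), MemLp f (ENNReal.ofReal p) volume →
      eLpNorm (squarePsi ψ j f) (ENNReal.ofReal p) volume ≤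
        ENNReal.ofReal (C * (2 : ℝ) ^ ((j : ℝ) * ((n : ℝ) * (1 / p - 1 / 2) - 1 / 2))) *
          eLpNorm f (ENNReal.ofReal p) volume := by
  obtain ⟨C, hC, hhigh⟩ := exists_splitBound_squarePsi (n := n) hn hp1 hp2 hψ
  obtain ⟨D, hD, hlow⟩ := exists_supOp_BPsi_le_maxFn (n := n) hn hp1 hp2 hψ
  refine exists_eLpNorm_le_of_splitBound hn hp1 hp2 hC hD (by ring) ?_ hhigh
    fun j hj f hf x => (squareSup_le_supOp _ x).trans (hlow j hj f hf x)
  have h1 : (1 : ℝ) ≤ n := by exact_mod_cast hn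
  have h2 : 1 / 2 ≤ 1 / p := one_div_le_one_div_of_le (by linarith) hp2
  nlinarith

end Localized

/-! ### Minkowski's inequality for series of nonnegative functions -/

theorem eLpNorm_ennreal_eq {α : Type*} [MeasurableSpace α] {μ : Measure α} {p : ℝ} (hp : 0 < p)
    (g : α → ℝ≥0∞) : eLpNorm g (ENNReal.ofReal p) μ = (∫⁻ x, g x ^ p ∂μ) ^ (1 / p) := by
  rw [eLpNorm_eq_lintegral_rpow_enorm_toReal (ENNReal.ofReal_pos.2 hp).ne' ENNReal.ofReal_ne_top,
    ENNReal.toReal_ofReal hp.le]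
  simp only [enorm_eq_self]

theorem eLpNorm_ennreal_const_mul {α : Type*} [MeasurableSpace α] {μ : Measure α} {p : ℝ}
    (hp : 0 < p) {c : ℝ≥0∞} (hc : c ≠ ∞) (g : α → ℝ≥0∞) :
    eLpNorm (fun x => c * g x) (ENNReal.ofReal p) μ = c * eLpNorm g (ENNReal.ofReal p) μ := by
  rw [eLpNorm_ennreal_eq hp, eLpNorm_ennreal_eq hp]
  simp only [ENNReal.mul_rpow_of_nonneg _ _ hp.le]
  rw [lintegral_const_mul' _ _ (ENNReal.rpow_ne_top_of_nonneg hp.le hc),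
    ENNReal.mul_rpow_of_nonneg _ _ (by positivity), one_div, ENNReal.rpow_rpow_inv hp.ne']

theorem eLpNorm_tsum_le {α : Type*} [MeasurableSpace α] {μ : Measure α} {g : ℕ → α → ℝ≥0∞}
    (hg : ∀ i, Measurable (g i)) {p : ℝ} (hp : 1 ≤ p) :
    eLpNorm (fun x => ∑' i, g i x) (ENNReal.ofReal p) μ ≤
      ∑' i, eLpNorm (g i) (ENNReal.ofReal p) μ := by
  have hp0 : 0 < p := by linarith
  have hS : ∀ N, Measurable fun x => ∑ i ∈ Finset.range N, g i x := fun N =>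
    Finset.measurable_fun_sum _ fun i _ => hg i
  have hlim := lintegral_tendsto_of_tendsto_of_monotone (μ := μ)
    (f := fun N x => (∑ i ∈ Finset.range N, g i x) ^ p) (F := fun x => (∑' i, g i x) ^ p)
    (fun N => ((hS N).pow_const p).aemeasurable)
    (ae_of_all _ fun x => fun N N' h => by
      dsimp only
      gcongr)
    (ae_of_all _ fun x => (ENNReal.tendsto_nat_tsum fun i => g i x).ennrpow_const p)
  rw [eLpNorm_ennreal_eq hp0]
  refine le_of_tendsto' (hlim.ennrpow_const (1 / p)) fun N => ?_
  rw [← eLpNorm_ennreal_eq hp0]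
  have h := eLpNorm_sum_le (μ := μ) (p := ENNReal.ofReal p) (s := Finset.range N) (f := g)
    (fun i _ => (hg i).aestronglyMeasurable) (ENNReal.one_le_ofReal.2 hp)
  have e : (∑ i ∈ Finset.range N, g i) = fun x => ∑ i ∈ Finset.range N, g i x := by
    ext x; simp
  rw [e] at h
  exact h.trans (ENNReal.sum_le_tsum _)

/-! ### Square functions of measurable families -/

/-- The supremum over dyadic `R` in the definition of `squareSup`. It is comparable to `squareSup`,
and measurable as a countable supremum. -/
def dyadicSup {n : ℕ} (F : ℝ → Euc n → ℂ) (x : Euc n) : ℝ≥0∞ :=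
  ⨆ k : ℤ, ((ENNReal.ofReal ((2 : ℝ) ^ k))⁻¹ *
    ∫⁻ t in Set.Ioc 0 ((2 : ℝ) ^ k), ‖F t x‖ₑ ^ 2) ^ (1 / 2 : ℝ)

section SquareSup

variable {n : ℕ} {F : ℝ → Euc n → ℂ}

theorem measurable_dyadicSup (hF : Measurable fun z : Euc n × ℝ => F z.2 z.1) :
    Measurable (dyadicSup F) := by
  refine Measurable.iSup fun k => ((Measurable.lintegral_prod_right'
    (f := fun z : Euc n × ℝ => ‖F z.2 z.1‖ₑ ^ 2) ?_).const_mul _).pow_const _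
  exact hF.enorm.pow_const 2

theorem dyadicSup_le_squareSup (F : ℝ → Euc n → ℂ) (x : Euc n) : dyadicSup F x ≤ squareSup F x :=
  iSup_le fun k => le_iSup₂ (f := fun (R : ℝ) (_ : 0 < R) =>
    ((ENNReal.ofReal R)⁻¹ * ∫⁻ t in Set.Ioc 0 R, ‖F t x‖ₑ ^ 2) ^ (1 / 2 : ℝ)) ((2 : ℝ) ^ k)
    (by positivity)

theorem squareSup_le_dyadicSup (F : ℝ → Euc n → ℂ) (x : Euc n) :
    squareSup F x ≤ 2 * dyadicSup F x := by
  refine iSup₂_le fun R hR => ?_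
  obtain ⟨k, hk1, hk2⟩ := exists_mem_Ioc_zpow hR one_lt_two
  have h0 : (0 : ℝ) < 2 ^ (k + 1) := by positivity
  set I := (ENNReal.ofReal ((2 : ℝ) ^ (k + 1)))⁻¹ *
    ∫⁻ t in Set.Ioc 0 ((2 : ℝ) ^ (k + 1)), ‖F t x‖ₑ ^ 2 with hI
  have h1 : (ENNReal.ofReal R)⁻¹ ≤ 4 * (ENNReal.ofReal ((2 : ℝ) ^ (k + 1)))⁻¹ := by
    rw [← ENNReal.ofReal_inv_of_pos hR, ← ENNReal.ofReal_inv_of_pos h0,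
      show (4 : ℝ≥0∞) = ENNReal.ofReal 4 by simp, ← ENNReal.ofReal_mul (by norm_num)]
    apply ENNReal.ofReal_le_ofReal
    rw [← div_eq_mul_inv, inv_eq_one_div, div_le_div_iff₀ hR h0]
    rw [zpow_add_one₀ two_ne_zero]
    linarith
  calc _ ≤ (4 * I) ^ (1 / 2 : ℝ) := by
        rw [hI, ← mul_assoc]
        gcongr
    _ = 2 * I ^ (1 / 2 : ℝ) := by
        rw [ENNReal.mul_rpow_of_nonneg _ _ (by norm_num), show (4 : ℝ≥0∞) = 2 ^ (2 : ℝ) by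
          rw [ENNReal.rpow_two]; norm_num, one_div, ENNReal.rpow_rpow_inv two_ne_zero]
    _ ≤ _ := by
        gcongr
        exact le_iSup (fun k : ℤ => ((ENNReal.ofReal ((2 : ℝ) ^ k))⁻¹ *
          ∫⁻ t in Set.Ioc 0 ((2 : ℝ) ^ k), ‖F t x‖ₑ ^ 2) ^ (1 / 2 : ℝ)) (k + 1)

theorem average_rpow_eq_eLpNorm (F : ℝ → Euc n → ℂ) (x : Euc n) (R : ℝ) :
    ((ENNReal.ofReal R)⁻¹ * ∫⁻ t in Set.Ioc 0 R, ‖F t x‖ₑ ^ 2) ^ (1 / 2 : ℝ) =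
      eLpNorm (fun t => ‖F t x‖ₑ) (ENNReal.ofReal 2)
        ((ENNReal.ofReal R)⁻¹ • volume.restrict (Set.Ioc 0 R)) := by
  rw [eLpNorm_ennreal_eq two_pos, lintegral_smul_measure, smul_eq_mul]
  simp only [ENNReal.rpow_two]

/-- Minkowski's inequality in the variable `t`. -/
theorem squareSup_le_tsum {H : ℕ → ℝ → Euc n → ℂ} {c : ℕ → ℝ} {x : Euc n}
    (hH : ∀ j, Measurable fun t => H j t x)
    (h : ∀ t, 0 < t → ‖F t x‖ₑ ≤ ∑' j, ENNReal.ofReal (c j) * ‖H j t x‖ₑ) :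
    squareSup F x ≤ ∑' j, ENNReal.ofReal (c j) * squareSup (H j) x := by
  refine iSup₂_le fun R hR => ?_
  rw [average_rpow_eq_eLpNorm]
  calc _ ≤ eLpNorm (fun t => ∑' j, ENNReal.ofReal (c j) * ‖H j t x‖ₑ) (ENNReal.ofReal 2)
        ((ENNReal.ofReal R)⁻¹ • volume.restrict (Set.Ioc 0 R)) := by
        refine eLpNorm_mono_enorm_ae (Measure.ae_smul_measure ?_ _)
        filter_upwards [ae_restrict_mem measurableSet_Ioc] with t ht
        simpa only [enorm_eq_self] using h t ht.1
    _ ≤ ∑' j, eLpNorm (fun t => ENNReal.ofReal (c j) * ‖H j t x‖ₑ) (ENNReal.ofReal 2)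
        ((ENNReal.ofReal R)⁻¹ • volume.restrict (Set.Ioc 0 R)) :=
        eLpNorm_tsum_le (fun j => (hH j).enorm.const_mul _) one_le_two
    _ ≤ _ := by
        refine ENNReal.tsum_le_tsum fun j => ?_
        rw [eLpNorm_ennreal_const_mul two_pos ENNReal.ofReal_ne_top, ← average_rpow_eq_eLpNorm]
        gcongr
        exact le_iSup₂ (f := fun (R : ℝ) (_ : 0 < R) => ((ENNReal.ofReal R)⁻¹ *
          ∫⁻ t in Set.Ioc 0 R, ‖H j t x‖ₑ ^ 2) ^ (1 / 2 : ℝ)) R hR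

end SquareSup

/-! ### The dyadic decomposition of the Bochner-Riesz multiplier -/

/-- A smooth function which is `0` on `(-∞, 5/8]` and `1` on `[7/8, ∞)`. -/
def cutoff (v : ℝ) : ℝ := Real.smoothTransition (4 * v - 5 / 2)

theorem cutoff_eq_zero {v : ℝ} (hv : v ≤ 5 / 8) : cutoff v = 0 :=
  Real.smoothTransition.zero_of_nonpos (by linarith)

theorem cutoff_eq_one {v : ℝ} (hv : 7 / 8 ≤ v) : cutoff v = 1 :=
  Real.smoothTransition.one_of_one_le (by linarith)

/-- The profile `v^δ (χ(v) - χ(v/2))`, with `χ` the function `cutoff`. The dyadic dilates of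
`χ(v) - χ(v/2)` form a partition of unity near `0`. -/
def rieszProfile (δ v : ℝ) : ℝ := v ^ δ * (cutoff v - cutoff (v / 2))

theorem isBump_rieszProfile (δ : ℝ) : IsBump fun v => (rieszProfile δ v : ℂ) := by
  constructor
  · refine Complex.ofRealCLM.contDiff.comp (contDiff_iff_contDiffAt.2 fun v => ?_)
    rcases lt_or_ge v (5 / 8) with hv | hv
    · have h0 : rieszProfile δ =ᶠ[nhds v] fun _ => 0 := by
        rcases lt_or_ge 0 v with h | h
        · filter_upwards [Ioo_mem_nhds h hv] with w hw
          rw [rieszProfile, cutoff_eq_zero hw.2.le, cutoff_eq_zero (by linarith [hw.1, hw.2]),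
            sub_zero, mul_zero]
        · filter_upwards [Iio_mem_nhds (show v < 5 / 8 from hv)] with w (hw : w < 5 / 8)
          rw [rieszProfile, cutoff_eq_zero hw.le, cutoff_eq_zero (by linarith), sub_zero, mul_zero]
      exact contDiffAt_const.congr_of_eventuallyEq h0
    · have hc : ContDiff ℝ (⊤ : ℕ∞) cutoff :=
        Real.smoothTransition.contDiff.comp ((contDiff_const.mul contDiff_id).sub contDiff_const)
      have hc2 : ContDiff ℝ (⊤ : ℕ∞) fun v => cutoff (v / 2) := hc.comp (contDiff_id.div_const 2)
      exact (Real.contDiffAt_rpow_const_of_ne (by linarith)).mul (hc.sub hc2).contDiffAt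
  · refine closure_minimal (fun v hv => ?_) isClosed_Icc
    by_contra hcon
    refine hv ?_
    have h1 : cutoff v - cutoff (v / 2) = 0 := by
      rw [Set.mem_Icc, not_and_or, not_le, not_le] at hcon
      rcases hcon with h | h
      · rw [cutoff_eq_zero (by linarith), cutoff_eq_zero (by linarith), sub_zero]
      · rw [cutoff_eq_one (by linarith), cutoff_eq_one (by linarith), sub_self]
    simp [rieszProfile, h1]

/-- The sum telescopes; the term at the lower end vanishes because `s ≤ 1`. -/
theorem sum_rieszProfile (δ : ℝ) {s : ℝ} (hs1 : s ≤ 1) (N : ℕ) :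
    ∑ j ∈ Finset.range N, ((2 : ℝ) ^ j) ^ (-δ) * rieszProfile δ (2 ^ j * s) =
      (if 0 < s then s ^ δ else 0) * cutoff (2 ^ N * s / 2) := by
  split_ifs with hs
  · have h1 : ∀ j : ℕ, ((2 : ℝ) ^ j) ^ (-δ) * rieszProfile δ (2 ^ j * s) =
        s ^ δ * (cutoff (2 ^ (j + 1) * s / 2) - cutoff (2 ^ j * s / 2)) := by
      intro j
      have h2 : (0 : ℝ) < 2 ^ j := by positivity
      rw [rieszProfile, Real.mul_rpow h2.le hs.le, Real.rpow_neg h2.le, pow_succ]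
      have h3 : ((2 : ℝ) ^ j) ^ δ ≠ 0 := (Real.rpow_pos_of_pos h2 _).ne'
      rw [show (2 : ℝ) ^ j * 2 * s / 2 = 2 ^ j * s by ring]
      field_simp
    simp only [h1]
    rw [← Finset.mul_sum, Finset.sum_range_sub (fun j => cutoff (2 ^ j * s / 2)), pow_zero, one_mul,
      cutoff_eq_zero (show s / 2 ≤ 5 / 8 by linarith), sub_zero]
  · rw [zero_mul]
    refine Finset.sum_eq_zero fun j _ => ?_
    have h2 : (2 : ℝ) ^ j * s ≤ 0 := mul_nonpos_of_nonneg_of_nonpos (by positivity) (not_lt.1 hs)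
    rw [rieszProfile, cutoff_eq_zero (by linarith), cutoff_eq_zero (by linarith), sub_zero,
      mul_zero, mul_zero]

theorem brMultiplier_eq {n : ℕ} (δ : ℝ) (ξ : Euc n) :
    brMultiplier δ ξ = if 0 < 1 - ‖ξ‖ ^ 2 then (1 - ‖ξ‖ ^ 2) ^ δ else 0 := by
  have : ‖ξ‖ < 1 ↔ 0 < 1 - ‖ξ‖ ^ 2 := by
    rw [sub_pos, sq_lt_one_iff₀ (norm_nonneg _)]
  simp only [brMultiplier, this]

theorem sum_dil_rieszProfile {n : ℕ} (δ t : ℝ) (ξ : Euc n) (N : ℕ) :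
    ∑ j ∈ Finset.range N, (((2 : ℝ) ^ j) ^ (-δ) : ℝ) *
        dil (fun v => (rieszProfile δ v : ℂ)) (2 ^ j) t ξ =
      (brMultiplier δ (t⁻¹ • ξ) * cutoff (2 ^ N * (1 - ‖t⁻¹ • ξ‖ ^ 2) / 2) : ℝ) := by
  rw [brMultiplier_eq, ← sum_rieszProfile δ (by linarith [sq_nonneg ‖t⁻¹ • ξ‖])]
  push_cast
  rfl

/-! ### Integrability of the Bochner-Riesz multiplier -/

section Integrability

variable {n : ℕ} {δ : ℝ}

theorem brMultiplier_nonneg (ξ : Euc n) : 0 ≤ brMultiplier δ ξ := by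
  rw [brMultiplier_eq]
  split_ifs with h
  · exact Real.rpow_nonneg h.le _
  · exact le_rfl

theorem measurable_brMultiplier : Measurable (brMultiplier (n := n) δ) := by
  unfold brMultiplier
  refine Measurable.ite (measurableSet_lt (by fun_prop) (by fun_prop)) ?_ measurable_const
  fun_prop

/-- In polar coordinates the singularity at the unit sphere is that of `(1 - y)^δ`. -/
theorem integrable_brMultiplier (hn : 1 ≤ n) (hδ : -1 < δ) :
    Integrable (brMultiplier (n := n) δ) := by
  have hne : Nonempty (Fin n) := ⟨⟨0, hn⟩⟩
  have e : brMultiplier (n := n) δ =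
      (Metric.ball (0 : Euc n) 1).indicator fun ξ => (1 - ‖ξ‖ ^ 2) ^ δ := by
    ext ξ
    simp [brMultiplier, Set.indicator]
  rw [e, integrable_indicator_iff measurableSet_ball,
    integrableOn_fun_norm_addHaar volume (f := fun y => (1 - y ^ 2) ^ δ)]
  have h1 : IntegrableOn (fun y : ℝ => (1 - y) ^ δ) (Set.Ioo 0 1) := by
    have h2 : IntervalIntegrable (fun y : ℝ => y ^ δ) volume 0 1 :=
      intervalIntegral.intervalIntegrable_rpow' hδ
    have h3 := (h2.comp_sub_left 1).symm
    simp only [sub_zero, sub_self] at h3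
    exact ((intervalIntegrable_iff_integrableOn_Ioc_of_le zero_le_one).1 h3).mono_set
      Set.Ioo_subset_Ioc_self
  refine Integrable.mono' (h1.const_mul (max 1 (2 ^ δ))) ?_ ?_
  · exact Measurable.aestronglyMeasurable (by fun_prop)
  · filter_upwards [ae_restrict_mem measurableSet_Ioo] with y hy
    have hy1 : 0 < 1 - y := by linarith [hy.2]
    have hy2 : 0 < 1 + y := by linarith [hy.1]
    rw [smul_eq_mul, show 1 - y ^ 2 = (1 + y) * (1 - y) by ring, Real.mul_rpow hy2.le hy1.le,
      Real.norm_of_nonneg (by have := hy.1.le; positivity), ← mul_assoc]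
    gcongr
    have h4 : y ^ (Module.finrank ℝ (Euc n) - 1) ≤ 1 := pow_le_one₀ hy.1.le hy.2.le
    have h5 : (1 + y) ^ δ ≤ max 1 (2 ^ δ) := by
      rcases le_total 0 δ with h | h
      · refine le_max_of_le_right ?_
        gcongr
        linarith [hy.2]
      · exact le_max_of_le_left (Real.rpow_le_one_of_one_le_of_nonpos (by linarith [hy.1]) h)
    calc _ ≤ 1 * (1 + y) ^ δ := by gcongr
      _ ≤ _ := by rwa [one_mul]

theorem integrable_brMultiplier_smul (hn : 1 ≤ n) (hδ : -1 < δ) {t : ℝ} (ht : 0 < t) :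
    Integrable fun ξ : Euc n => (brMultiplier δ (t⁻¹ • ξ) : ℂ) :=
  ((integrable_brMultiplier hn hδ).comp_smul (inv_pos.2 ht).ne').ofReal

theorem memLp_brMultiplier_smul (hn : 1 ≤ n) (hδ : -(1 / 2) < δ) {t : ℝ} (ht : 0 < t) :
    MemLp (fun ξ : Euc n => (brMultiplier δ (t⁻¹ • ξ) : ℂ)) 2 volume := by
  rw [memLp_two_iff_integrable_sq_norm
    (integrable_brMultiplier_smul hn (by linarith) ht).aestronglyMeasurable]
  refine ((integrable_brMultiplier (δ := 2 * δ) hn (by linarith)).comp_smul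
    (inv_pos.2 ht).ne').congr (ae_of_all _ fun ξ => ?_)
  simp only [Complex.norm_real, Real.norm_of_nonneg (brMultiplier_nonneg _)]
  rw [brMultiplier_eq, brMultiplier_eq]
  split_ifs with h
  · rw [mul_comm, Real.rpow_mul h.le, Real.rpow_two]
  · simp

end Integrability

/-! ### The square function of the Bochner-Riesz means -/

section BochnerRieszMean

open scoped RealInnerProductSpace

variable {n : ℕ} {p δ : ℝ} {f : Euc n → ℂ}

theorem integrable_mul_fhat (hp1 : 1 < p) (hf : MemLp f (ENNReal.ofReal p) volume)
    {m : Euc n → ℂ} (hm1 : Integrable m) (hm2 : MemLp m 2 volume) :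
    Integrable fun ξ => m ξ * fhat f ξ := by
  have hu := integrable_highPart hp1 hf
  have i1 : Integrable (fun ξ => m ξ * 𝓕 (highPart f) ξ) :=
    hm1.mul_bdd (c := ∫ y, ‖highPart f y‖) (continuous_fourier hu).aestronglyMeasurable
      (ae_of_all _ (norm_fourier_le _))
  have i2 : Integrable (fun ξ => m ξ * fourierL2 (lowPart f) ξ) :=
    hm2.integrable_mul (memLp_fourierL2 _)
  exact (i1.add i2).congr (ae_of_all _ fun ξ => by simp [fhat, mul_add])

theorem stronglyMeasurable_fhat (hp1 : 1 < p) (hf : MemLp f (ENNReal.ofReal p) volume) :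
    StronglyMeasurable (fhat f) :=
  (continuous_fourier (integrable_highPart hp1 hf)).stronglyMeasurable.add
    (stronglyMeasurable_fourierL2 _)

theorem measurable_BPsi (hp1 : 1 < p) (hf : MemLp f (ENNReal.ofReal p) volume) {ψ : ℝ → ℂ}
    (hψ : IsBump ψ) (j : ℕ) : Measurable fun z : Euc n × ℝ => BPsi ψ j z.2 f z.1 :=
  (stronglyMeasurable_dilOp (lam := 2 ^ j) hψ (stronglyMeasurable_fhat hp1 hf)).measurable

/-- The dyadic decomposition of `B^δ_t f`. The partial sums of the multiplier are dominated by the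
Bochner-Riesz multiplier itself. -/
theorem tendsto_sum_BPsi (hn : 1 ≤ n) (hp1 : 1 < p) (hδ : -(1 / 2) < δ)
    (hf : MemLp f (ENNReal.ofReal p) volume) {t : ℝ} (ht : 0 < t) (x : Euc n) :
    Filter.Tendsto (fun N => ∑ j ∈ Finset.range N, ((((2 : ℝ) ^ j) ^ (-δ) : ℝ) : ℂ) *
      BPsi (fun v => (rieszProfile δ v : ℂ)) j t f x) Filter.atTop (nhds (BMean δ t f x)) := by
  set ψ : ℝ → ℂ := fun v => (rieszProfile δ v : ℂ) with hψdef
  have hψ : IsBump ψ := isBump_rieszProfile δ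
  set E : Euc n → ℂ := fun ξ => Complex.exp (((2 * Real.pi * ⟪ξ, x⟫ : ℝ) : ℂ) * Complex.I) with hE
  have hEc : Continuous E := by fun_prop
  have hE1 : ∀ ξ, ‖E ξ‖ = 1 := fun ξ => Complex.norm_exp_ofReal_mul_I _
  have hm := integrable_mul_fhat hp1 hf (integrable_brMultiplier_smul hn (by linarith) ht)
    (memLp_brMultiplier_smul hn hδ ht)
  have hj : ∀ j : ℕ, Integrable fun ξ => E ξ • (dil ψ (2 ^ j) t ξ * fhat f ξ) := fun j =>
    (integrable_mul_fhat hp1 hf (integrable_dil hψ (by positivity) ht)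
      (memLp_dil hψ (by positivity) ht)).bdd_mul (c := 1) hEc.aestronglyMeasurable
      (ae_of_all _ fun ξ => (hE1 ξ).le)
  have hsum : ∀ N, ∑ j ∈ Finset.range N, ((((2 : ℝ) ^ j) ^ (-δ) : ℝ) : ℂ) * BPsi ψ j t f x =
      ∫ ξ, E ξ • ((brMultiplier δ (t⁻¹ • ξ) *
        cutoff (2 ^ N * (1 - ‖t⁻¹ • ξ‖ ^ 2) / 2) : ℝ) * fhat f ξ) := by
    intro N
    have h1 : ∀ j, BPsi ψ j t f x = ∫ ξ, E ξ • (dil ψ (2 ^ j) t ξ * fhat f ξ) := fun j =>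
      Real.fourierInv_eq' _ _
    simp only [h1, ← integral_const_mul]
    rw [← integral_finsetSum _ fun j _ => (hj j).const_mul _]
    refine integral_congr_ae (ae_of_all _ fun ξ => ?_)
    dsimp only
    rw [← sum_dil_rieszProfile, Finset.sum_mul, Finset.smul_sum]
    refine Finset.sum_congr rfl fun j _ => ?_
    simp only [smul_eq_mul]
    ring
  simp only [hsum]
  have hB : BMean δ t f x = ∫ ξ, E ξ • ((brMultiplier δ (t⁻¹ • ξ) : ℂ) * fhat f ξ) :=
    Real.fourierInv_eq' _ _
  rw [hB]
  have hcut : Continuous cutoff := Real.smoothTransition.continuous.comp (by fun_prop)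
  -- the partial sums are the Bochner-Riesz multiplier times a cutoff with values in `[0, 1]`
  refine tendsto_integral_of_dominated_convergence
    (fun ξ => ‖(brMultiplier δ (t⁻¹ • ξ) : ℂ) * fhat f ξ‖) (fun N => ?_) hm.norm
    (fun N => ae_of_all _ fun ξ => ?_) (ae_of_all _ fun ξ => ?_)
  · have h1 : Measurable fun ξ : Euc n => brMultiplier δ (t⁻¹ • ξ) :=
      measurable_brMultiplier.comp (by fun_prop)
    have h2 : Measurable fun ξ : Euc n => cutoff (2 ^ N * (1 - ‖t⁻¹ • ξ‖ ^ 2) / 2) :=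
      hcut.measurable.comp (by fun_prop)
    exact (hEc.measurable.smul ((Complex.measurable_ofReal.comp (h1.mul h2)).mul
      (stronglyMeasurable_fhat hp1 hf).measurable)).aestronglyMeasurable
  · rw [norm_smul, hE1, one_mul, norm_mul, norm_mul, Complex.ofReal_mul, norm_mul]
    refine mul_le_mul_of_nonneg_right (mul_le_of_le_one_right (norm_nonneg _) ?_) (norm_nonneg _)
    rw [Complex.norm_real, cutoff, Real.norm_of_nonneg (Real.smoothTransition.nonneg _)]
    exact Real.smoothTransition.le_one _
  · refine tendsto_const_nhds.congr' ?_
    by_cases hs : 0 < 1 - ‖t⁻¹ • ξ‖ ^ 2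
    · obtain ⟨N₀, hN₀⟩ := pow_unbounded_of_one_lt (2 / (1 - ‖t⁻¹ • ξ‖ ^ 2)) (one_lt_two (α := ℝ))
      filter_upwards [Filter.eventually_ge_atTop N₀] with N hN
      have h1 : 2 / (1 - ‖t⁻¹ • ξ‖ ^ 2) < 2 ^ N :=
        hN₀.trans_le (pow_le_pow_right₀ one_le_two hN)
      rw [div_lt_iff₀ hs] at h1
      rw [cutoff_eq_one (by linarith), mul_one]
    · refine Filter.Eventually.of_forall fun N => ?_
      have : brMultiplier δ (t⁻¹ • ξ) = 0 := by rw [brMultiplier_eq, if_neg hs]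
      simp only [this, zero_mul]

theorem squareBR_le_tsum (hn : 1 ≤ n) (hp1 : 1 < p) (hδ : -(1 / 2) < δ)
    (hf : MemLp f (ENNReal.ofReal p) volume) (x : Euc n) :
    squareBR δ f x ≤ ∑' j : ℕ, ENNReal.ofReal (((2 : ℝ) ^ j) ^ (-δ)) *
      squarePsi (fun v => (rieszProfile δ v : ℂ)) j f x := by
  refine squareSup_le_tsum (fun j => ?_) fun t ht => ?_
  · have h1 := (measurable_BPsi hp1 hf (isBump_rieszProfile δ) j).comp
      (measurable_prodMk_left (x := x))
    simpa only [Function.comp_def] using h1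
  · refine le_of_tendsto' (tendsto_sum_BPsi hn hp1 hδ hf ht x).enorm fun N => ?_
    refine (enorm_sum_le _ _).trans (le_trans (le_of_eq ?_) (ENNReal.sum_le_tsum (Finset.range N)))
    refine Finset.sum_congr rfl fun j _ => ?_
    rw [enorm_mul, ← ofReal_norm, Complex.norm_real, Real.norm_of_nonneg (by positivity)]

theorem exists_eLpNorm_squareBR_le (hn : 1 ≤ n) (hp1 : 1 < p) (hp2 : p ≤ 2)
    (hδ : (n : ℝ) * (1 / p - 1 / 2) - 1 / 2 < δ) :
    ∃ C : ℝ, 0 < C ∧ ∀ f : Euc n → ℂ, MemLp f (ENNReal.ofReal p) volume →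
      eLpNorm (squareBR δ f) (ENNReal.ofReal p) volume ≤
        ENNReal.ofReal C * eLpNorm f (ENNReal.ofReal p) volume := by
  set e := (n : ℝ) * (1 / p - 1 / 2) - 1 / 2 with he
  have hδ' : -(1 / 2) < δ := by
    have h1 : 1 / 2 ≤ 1 / p := one_div_le_one_div_of_le (by linarith) hp2
    have h2 : 0 ≤ (n : ℝ) * (1 / p - 1 / 2) := mul_nonneg (Nat.cast_nonneg n) (by linarith)
    linarith
  have hψ := isBump_rieszProfile δ
  obtain ⟨C, hC, hbound⟩ := exists_eLpNorm_squarePsi_le hn hp1 hp2 hψ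
  set r : ℝ := 2 ^ (e - δ) with hr
  have hr0 : 0 < r := by positivity
  have hr1 : r < 1 := Real.rpow_lt_one_of_one_lt_of_neg one_lt_two (by linarith)
  have hr2 : 0 < 1 - r := by linarith
  refine ⟨2 * C * (1 - r)⁻¹, by positivity, fun f hf => ?_⟩
  have hp0 : 0 < p := by linarith
  set D : ℕ → Euc n → ℝ≥0∞ :=
    fun j => dyadicSup fun t => BPsi (fun v => (rieszProfile δ v : ℂ)) j t f with hD
  have hDm : ∀ j, Measurable (D j) := fun j => measurable_dyadicSup (measurable_BPsi hp1 hf hψ j)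
  calc _ ≤ eLpNorm (fun x => ∑' j : ℕ, ENNReal.ofReal (((2 : ℝ) ^ j) ^ (-δ) * 2) * D j x)
        (ENNReal.ofReal p) volume := by
        refine eLpNorm_mono_enorm fun x => ?_
        simp only [enorm_eq_self]
        refine (squareBR_le_tsum hn hp1 hδ' hf x).trans (ENNReal.tsum_le_tsum fun j => ?_)
        rw [ENNReal.ofReal_mul (by positivity), ENNReal.ofReal_ofNat, mul_assoc]
        gcongr
        exact squareSup_le_dyadicSup _ x
    _ ≤ ∑' j : ℕ, eLpNorm (fun x => ENNReal.ofReal (((2 : ℝ) ^ j) ^ (-δ) * 2) * D j x)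
        (ENNReal.ofReal p) volume :=
        eLpNorm_tsum_le (fun j => (hDm j).const_mul _) hp1.le
    _ ≤ ∑' j : ℕ, ENNReal.ofReal (2 * C * r ^ j) * eLpNorm f (ENNReal.ofReal p) volume := by
        refine ENNReal.tsum_le_tsum fun j => ?_
        rw [eLpNorm_ennreal_const_mul hp0 ENNReal.ofReal_ne_top]
        have h1 : eLpNorm (D j) (ENNReal.ofReal p) volume ≤ _ :=
          (eLpNorm_mono_enorm fun x => by
            simp only [enorm_eq_self]
            exact dyadicSup_le_squareSup _ x).trans (hbound j f hf)
        refine (mul_le_mul_right h1 _).trans (le_of_eq ?_)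
        rw [← mul_assoc, ← ENNReal.ofReal_mul (by positivity)]
        congr 2
        have h2 : r ^ j = ((2 : ℝ) ^ j) ^ (-δ) * 2 ^ ((j : ℝ) * e) := by
          rw [hr, ← Real.rpow_natCast 2 j, ← Real.rpow_mul zero_le_two, ← Real.rpow_add two_pos,
            ← Real.rpow_natCast, ← Real.rpow_mul zero_le_two]
          congr 1
          ring
        rw [h2]
        ring
    _ = _ := by
        rw [ENNReal.tsum_mul_right, ← ENNReal.ofReal_tsum_of_nonneg (fun j => by positivity)
          ((summable_geometric_of_lt_one hr0.le hr1).mul_left _), tsum_mul_left,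
          tsum_geometric_of_lt_one hr0.le hr1]

end BochnerRieszMean

end BochnerRiesz

end

theorem mainTheorem6 (n : ℕ) (hn : 1 ≤ n) (p : ℝ) (hp1 : 1 < p) (hp2 : p ≤ 2) :
    (∀ ψ : ℝ → ℂ, ContDiff ℝ (⊤ : ℕ∞) ψ → tsupport ψ ⊆ Set.Ioo (1 / 2 : ℝ) 2 →
      ∀ ε : ℝ, 0 < ε → ∃ C : ℝ, 0 < C ∧
        ∀ (j : ℕ) (f : BochnerRiesz.Euc n → ℂ), MemLp f (ENNReal.ofReal p) volume →
          eLpNorm (BochnerRiesz.maximalPsi ψ j f) (ENNReal.ofReal p) volume ≤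
            ENNReal.ofReal (C * (2 : ℝ) ^ ((j : ℝ) * (((n : ℝ) - 1) * (1 / p - 1 / 2) + ε))) *
              eLpNorm f (ENNReal.ofReal p) volume ∧
          eLpNorm (BochnerRiesz.squarePsi ψ j f) (ENNReal.ofReal p) volume ≤
            ENNReal.ofReal (C * (2 : ℝ) ^ ((j : ℝ) * ((n : ℝ) * (1 / p - 1 / 2) - 1 / 2 + ε))) *
              eLpNorm f (ENNReal.ofReal p) volume) ∧
    (∀ δ : ℝ, (n : ℝ) * (1 / p - 1 / 2) - 1 / 2 < δ → ∃ C : ℝ, 0 < C ∧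
      ∀ f : BochnerRiesz.Euc n → ℂ, MemLp f (ENNReal.ofReal p) volume →
        eLpNorm (BochnerRiesz.squareBR δ f) (ENNReal.ofReal p) volume ≤
          ENNReal.ofReal C * eLpNorm f (ENNReal.ofReal p) volume) := by
  refine ⟨fun ψ hψ hsupp ε hε => ?_,
    fun δ hδ => BochnerRiesz.exists_eLpNorm_squareBR_le hn hp1 hp2 hδ⟩
  have hb : BochnerRiesz.IsBump ψ := ⟨hψ, hsupp.trans Set.Ioo_subset_Icc_self⟩
  obtain ⟨C₁, hC₁, h₁⟩ := BochnerRiesz.exists_eLpNorm_maximalPsi_le (n := n) hn hp1 hp2 hb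
  obtain ⟨C₂, hC₂, h₂⟩ := BochnerRiesz.exists_eLpNorm_squarePsi_le (n := n) hn hp1 hp2 hb
  refine ⟨C₁ + C₂, by positivity, fun j f hf => ⟨?_, ?_⟩⟩
  · refine (h₁ j f hf).trans (mul_le_mul_left (ENNReal.ofReal_le_ofReal ?_) _)
    gcongr
    · linarith
    · exact one_le_two
    · linarith
  · refine (h₂ j f hf).trans (mul_le_mul_left (ENNReal.ofReal_le_ofReal ?_) _)
    gcongr
    · linarith
    · exact one_le_two
    · linarith
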